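/- Let $\Gamma$ be a graph (possibly infinite) without loops and multiple edges, with vertex set $I$. For $i,j\in I$ put $i\cdot i=2$, $i\cdot j=-1$ if $i$ and $j$ are joined by an edge, and $i\cdot j=0$ otherwise. Let $\nu=\sum_{i}\nu_i\, i\in\mathbb N[I]$, $m=|\nu|=\sum_i\nu_i$ (with $m=0$ allowed), and let $\mathrm{Seq}(\nu)$ be the set of sequences $\mathbf i=i_1\dots i_m$ of vertices in which each $i$ appears $\nu_i$ times; $S_m$ acts on it by permuting the entries, and $s_k=(k,k+1)$. Let $R(\nu)$ be the ring of $\mathbb Z$-linear combinations of braid-like dotted diagrams on $m$ labelled strands modulo isotopy and the local relations below. In algebraic terms it is the unital ring with generators $1_{\mathbf i}$ (vertical strands), $x_{k,\mathbf i}$ ($1\le k\le m$; a dot on the $k$-th strand) and $\delta_{k,\mathbf i}$ ($1\le k<m$; a crossing of the $k$-th and $(k+1)$-st strands), for $\mathbf i\in\mathrm{Seq}(\nu)$, and the following relations. * $1_{\mathbf i}1_{\mathbf j}=0$ for $\mathbf i\ne\mathbf j$, $\;1_{\mathbf i}^2=1_{\mathbf i}$, $\;\sum_{\mathbf i}1_{\mathbf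 i}=1$, $\;1_{\mathbf i}x_{k,\mathbf i}=x_{k,\mathbf i}=x_{k,\mathbf i}1_{\mathbf i}$, $\;1_{s_k\mathbf i}\delta_{k,\mathbf i}=\delta_{k,\mathbf i}=\delta_{k,\mathbf i}1_{\mathbf i}$. * $x_{k,\mathbf i}x_{l,\mathbf i}=x_{l,\mathbf i}x_{k,\mathbf i}$; $\;x_{l,s_k\mathbf i}\delta_{k,\mathbf i}=\delta_{k,\mathbf i}x_{l,\mathbf i}$ for $l\ne k,k+1$; $\;\delta_{k,s_l\mathbf i}\delta_{l,\mathbf i}=\delta_{l,s_k\mathbf i}\delta_{k,\mathbf i}$ for $|k-l|>1$. * $\delta_{k,s_k\mathbf i}\delta_{k,\mathbf i}$ equals $0$ if $i_k=i_{k+1}$, equals $1_{\mathbf i}$ if $i_k\cdot i_{k+1}=0$, and equals $x_{k,\mathbf i}+x_{k+1,\mathbf i}$ if $i_k\cdot i_{k+1}=-1$. * $x_{k,s_k\mathbf i}\delta_{k,\mathbf i}-\delta_{k,\mathbf i}x_{k+1,\mathbf i}$ and $\delta_{k,\mathbf i}x_{k,\mathbf i}-x_{k+1,s_k\mathbf i}\delta_{k,\mathbf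 i}$ both equal $1_{\mathbf i}$ if $i_k=i_{k+1}$ and both equal $0$ otherwise. * $\delta_{k,s_{k+1}s_k\mathbf i}\,\delta_{k+1,s_k\mathbf i}\,\delta_{k,\mathbf i}-\delta_{k+1,s_ks_{k+1}\mathbf i}\,\delta_{k,s_{k+1}\mathbf i}\,\delta_{k+1,\mathbf i}$ equals $1_{\mathbf i}$ if $i_k=i_{k+2}$ and $i_k\cdot i_{k+1}=-1$, and equals $0$ otherwise. For $d\in\mathbb Z$ let $R(\nu)_d$ be the additive subgroup generated by the products of generators of total degree $d$, where $\deg 1_{\mathbf i}=0$, $\deg x_{k,\mathbf i}=2$, $\deg\delta_{k,\mathbf i}=-i_k\cdot i_{k+1}$. Let $\mathrm{Pol}(\nu)=\prod_{\mathbf i\in\mathrm{Seq}(\nu)}\mathbb Z[x_{1,\mathbf i},\dots,x_{m,\mathbf i}]$, on which $w\in S_m$ acts by $x_{a,\mathbf i}\mapsto x_{w(a),w\mathbf i}$, and let $\mathrm{Sym}(\nu)=\mathrm{Pol}(\nu)^{S_m}$. **Theorem.** 1. The natural ring homomorphism $\mathrm{Pol}(\nu)\to R(\nu)$ is injective, and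 under this inclusion the center of $R(\nu)$ is exactly $\mathrm{Sym}(\nu)$. 2. There is a ring isomorphism $$\bigotimes_{i:\,\nu_i\neq0}\mathbb Z[x_1,\dots,x_{\nu_i}]^{S_{\nu_i}}\;\cong\;\mathrm{Sym}(\nu)$$ taking $\otimes_i p_i$ to the element whose $\mathbf i$-component, for each $\mathbf i\in\mathrm{Seq}(\nu)$, is $\prod_i p_i\big(x_{a,\mathbf i} : i_a=i\big)$. 3. $R(\nu)=\bigoplus_{d\in\mathbb Z}R(\nu)_d$ is a graded ring, and it is a free graded module of rank $(m!)^2$ over its center: there are homogeneous elements $b_k\in R(\nu)_{e_k}$, $1\le k\le (m!)^2$, that form a basis of $R(\nu)$ over its center $Z$ and are such that $\sum_k z_kb_k$ ($z_k\in Z$) lies in $R(\nu)_d$ if and only if $z_k\in R(\nu)_{d-e_k}$ for all $k$. 4. $R(\nu)$ is left and right Noetherian. 5. $R(\nu)$ is indecomposable: it is nonzero and not isomorphic to a product of two nonzero rings. -/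

import Mathlib

open scoped TensorProduct Nat

noncomputable section

namespace KLR

universe u

variable {I : Type u}

/-! ### The Cartan form and sequences of vertices -/

open Classical in
/-- The bilinear form of the graph `Γ` on vertices: `i · i = 2`, `i · j = -1` if `i` and `j` are
joined by an edge, and `i · j = 0` otherwise. -/
def cartan (Γ : SimpleGraph I) (i j : I) : ℤ :=
  if i = j then 2 else if Γ.Adj i j then -1 else 0

/-- `|ν| = ∑ i, ν i`. -/
abbrev size (ν : I →₀ ℕ) : ℕ := ν.sum fun _ n => n

/-- `Seq(ν)`: the sequences of vertices of length `m = |ν|` in which every vertex `i` appears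
`ν i` times (that is, the sum in `ℕ[I]` of the entries is `ν`). -/
def Seq (ν : I →₀ ℕ) : Type u :=
  {s : Fin (size ν) → I // ∑ a, Finsupp.single (s a) 1 = ν}

namespace Seq

variable {ν : I →₀ ℕ}

instance : CoeFun (Seq ν) (fun _ => Fin (size ν) → I) := ⟨Subtype.val⟩

theorem mem_support (s : Seq ν) (a : Fin (size ν)) : s a ∈ ν.support := by
  have h : Finsupp.single (s a) 1 ≤ ν := by
    conv_rhs => rw [← s.2]
    exact Finset.single_le_sum (f := fun b => Finsupp.single (s b) 1)
      (fun _ _ => zero_le) (Finset.mem_univ a)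
  have h1 := h (s a)
  rw [Finsupp.single_eq_same] at h1
  rw [Finsupp.mem_support_iff]
  omega

instance : Finite (Seq ν) :=
  Finite.of_injective
    (fun s : Seq ν => fun a => (⟨s a, s.mem_support a⟩ : ν.support))
    (fun _ _ h => Subtype.ext (funext fun a => congrArg Subtype.val (congrFun h a)))

instance : Fintype (Seq ν) := Fintype.ofFinite _

/-- The symmetric group `S_m` permutes the entries of a sequence: the entry of `i` in position `a`
becomes the entry of `w i` in position `w a`. -/
instance : MulAction (Equiv.Perm (Fin (size ν))) (Seq ν) where
  smul w s := ⟨fun a => s (w⁻¹ a),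
    (Equiv.sum_comp w⁻¹ (fun a => Finsupp.single (s a) 1)).trans s.2⟩
  one_smul _ := rfl
  mul_smul w v s := Subtype.ext (funext fun a => by
    change s ((w * v)⁻¹ a) = s (v⁻¹ (w⁻¹ a))
    rw [mul_inv_rev]; rfl)

end Seq

/-! ### The ring `R(ν)` -/

/-- The elementary diagrams with `m = |ν|` strands: the diagrams `1_i` made of vertical strands,
the diagrams `x_{a,i}` with one dot, on the `a`-th strand, and the diagrams `δ_{a,i}` with one
crossing, of the strands `a` and `b = a + 1`. The sequence `i` is the one read at the bottom. -/
inductive Gen (ν : I →₀ ℕ) : Type u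
  | idem (i : Seq ν) : Gen ν
  | dot (a : Fin (size ν)) (i : Seq ν) : Gen ν
  | cross (a b : Fin (size ν)) (h : a.val + 1 = b.val) (i : Seq ν) : Gen ν

/-- The degrees of the elementary diagrams. -/
def Gen.deg (Γ : SimpleGraph I) {ν : I →₀ ℕ} : Gen ν → ℤ
  | .idem _ => 0
  | .dot _ _ => 2
  | .cross a b _ i => -cartan Γ (i a) (i b)

/-- An elementary diagram as an element of the free ring on them. -/
abbrev fIdem {ν : I →₀ ℕ} (i : Seq ν) : FreeAlgebra ℤ (Gen ν) :=
  FreeAlgebra.ι ℤ (Gen.idem i)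

/-- An elementary diagram as an element of the free ring on them. -/
abbrev fDot {ν : I →₀ ℕ} (a : Fin (size ν)) (i : Seq ν) : FreeAlgebra ℤ (Gen ν) :=
  FreeAlgebra.ι ℤ (Gen.dot a i)

/-- An elementary diagram as an element of the free ring on them. -/
abbrev fCross {ν : I →₀ ℕ} (a b : Fin (size ν)) (h : a.val + 1 = b.val) (i : Seq ν) :
    FreeAlgebra ℤ (Gen ν) :=
  FreeAlgebra.ι ℤ (Gen.cross a b h i)

/-- The defining relations of `R(ν)`. In a product `x * y` the diagram `x` is put on top of `y`. -/
inductive Rel (Γ : SimpleGraph I) (ν : I →₀ ℕ) :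
    FreeAlgebra ℤ (Gen ν) → FreeAlgebra ℤ (Gen ν) → Prop
  /- The `1_i` are orthogonal idempotents that add up to `1`, and the generators begin and end at
  the sequences that they should; so diagrams that do not match have product zero. -/
  | idem_mul_self (i : Seq ν) : Rel Γ ν (fIdem i * fIdem i) (fIdem i)
  | idem_mul_of_ne (i j : Seq ν) (hij : i ≠ j) : Rel Γ ν (fIdem i * fIdem j) 0
  | sum_idem : Rel Γ ν (∑ i : Seq ν, fIdem i) 1
  | idem_mul_dot (a : Fin (size ν)) (i : Seq ν) : Rel Γ ν (fIdem i * fDot a i) (fDot a i)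
  | dot_mul_idem (a : Fin (size ν)) (i : Seq ν) : Rel Γ ν (fDot a i * fIdem i) (fDot a i)
  | idem_mul_cross (a b : Fin (size ν)) (h : a.val + 1 = b.val) (i : Seq ν) :
      Rel Γ ν (fIdem (Equiv.swap a b • i) * fCross a b h i) (fCross a b h i)
  | cross_mul_idem (a b : Fin (size ν)) (h : a.val + 1 = b.val) (i : Seq ν) :
      Rel Γ ν (fCross a b h i * fIdem i) (fCross a b h i)
  /- Isotopies: dots and crossings on disjoint sets of strands slide past each other. -/
  | dot_mul_dot (a b : Fin (size ν)) (i : Seq ν) :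
      Rel Γ ν (fDot a i * fDot b i) (fDot b i * fDot a i)
  | dot_mul_cross_far (a b c : Fin (size ν)) (h : a.val + 1 = b.val) (i : Seq ν)
      (hca : c ≠ a) (hcb : c ≠ b) :
      Rel Γ ν (fDot c (Equiv.swap a b • i) * fCross a b h i) (fCross a b h i * fDot c i)
  | cross_mul_cross_far (a b c d : Fin (size ν)) (h : a.val + 1 = b.val) (h' : c.val + 1 = d.val)
      (hbc : b < c) (i : Seq ν) :
      Rel Γ ν (fCross a b h (Equiv.swap c d • i) * fCross c d h' i)
        (fCross c d h' (Equiv.swap a b • i) * fCross a b h i)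
  /- Double crossings. -/
  | cross_sq_same (a b : Fin (size ν)) (h : a.val + 1 = b.val) (i : Seq ν) (hi : i a = i b) :
      Rel Γ ν (fCross a b h (Equiv.swap a b • i) * fCross a b h i) 0
  | cross_sq_zero (a b : Fin (size ν)) (h : a.val + 1 = b.val) (i : Seq ν)
      (hi : cartan Γ (i a) (i b) = 0) :
      Rel Γ ν (fCross a b h (Equiv.swap a b • i) * fCross a b h i) (fIdem i)
  | cross_sq_edge (a b : Fin (size ν)) (h : a.val + 1 = b.val) (i : Seq ν)
      (hi : cartan Γ (i a) (i b) = -1) :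
      Rel Γ ν (fCross a b h (Equiv.swap a b • i) * fCross a b h i) (fDot a i + fDot b i)
  /- Sliding a dot through a crossing of two strands with different labels. -/
  | slide_ne_left (a b : Fin (size ν)) (h : a.val + 1 = b.val) (i : Seq ν) (hi : i a ≠ i b) :
      Rel Γ ν (fDot a (Equiv.swap a b • i) * fCross a b h i) (fCross a b h i * fDot b i)
  | slide_ne_right (a b : Fin (size ν)) (h : a.val + 1 = b.val) (i : Seq ν) (hi : i a ≠ i b) :
      Rel Γ ν (fDot b (Equiv.swap a b • i) * fCross a b h i) (fCross a b h i * fDot a i)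
  /- Sliding a dot through a crossing of two strands with the same label. -/
  | slide_same_left (a b : Fin (size ν)) (h : a.val + 1 = b.val) (i : Seq ν) (hi : i a = i b) :
      Rel Γ ν (fDot a (Equiv.swap a b • i) * fCross a b h i - fCross a b h i * fDot b i) (fIdem i)
  | slide_same_right (a b : Fin (size ν)) (h : a.val + 1 = b.val) (i : Seq ν) (hi : i a = i b) :
      Rel Γ ν (fCross a b h i * fDot a i - fDot b (Equiv.swap a b • i) * fCross a b h i) (fIdem i)
  /- Triple crossings. -/
  | braid_easy (a b c : Fin (size ν)) (h : a.val + 1 = b.val) (h' : b.val + 1 = c.val) (i : Seq ν)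
      (hi : ¬ (i a = i c ∧ cartan Γ (i a) (i b) = -1)) :
      Rel Γ ν
        (fCross a b h (Equiv.swap b c • Equiv.swap a b • i) *
          fCross b c h' (Equiv.swap a b • i) * fCross a b h i)
        (fCross b c h' (Equiv.swap a b • Equiv.swap b c • i) *
          fCross a b h (Equiv.swap b c • i) * fCross b c h' i)
  | braid_hard (a b c : Fin (size ν)) (h : a.val + 1 = b.val) (h' : b.val + 1 = c.val) (i : Seq ν)
      (hi : i a = i c) (hi' : cartan Γ (i a) (i b) = -1) :
      Rel Γ ν
        (fCross a b h (Equiv.swap b c • Equiv.swap a b • i) *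
          fCross b c h' (Equiv.swap a b • i) * fCross a b h i -
        fCross b c h' (Equiv.swap a b • Equiv.swap b c • i) *
          fCross a b h (Equiv.swap b c • i) * fCross b c h' i)
        (fIdem i)

/-- The ring `R(ν)` of the graph `Γ`, over `ℤ`. -/
def R (Γ : SimpleGraph I) (ν : I →₀ ℕ) : Type u := RingQuot (Rel Γ ν)

variable (Γ : SimpleGraph I) (ν : I →₀ ℕ)

instance : Ring (R Γ ν) := inferInstanceAs (Ring (RingQuot (Rel Γ ν)))

/-- The quotient map from the free ring onto `R(ν)`. -/
def mk : FreeAlgebra ℤ (Gen ν) →+* R Γ ν := RingQuot.mkRingHom (Rel Γ ν)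

/-- The class in `R(ν)` of an elementary diagram. -/
def gen (g : Gen ν) : R Γ ν := mk Γ ν (FreeAlgebra.ι ℤ g)

/-- The part of `R(ν)` of degree `d`: the span of the products of elementary diagrams whose degrees
add up to `d`. -/
def degreePart (d : ℤ) : AddSubgroup (R Γ ν) :=
  AddSubgroup.closure
    {x | ∃ l : List (Gen ν), (l.map (Gen.deg Γ)).sum = d ∧ x = (l.map (gen Γ ν)).prod}

variable {Γ ν}

theorem mk_rel {x y : FreeAlgebra ℤ (Gen ν)} (h : Rel Γ ν x y) : mk Γ ν x = mk Γ ν y :=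
  RingQuot.mkRingHom_rel h

variable (Γ) in
/-- The idempotent `1_i` of `R(ν)`. -/
def idem (i : Seq ν) : R Γ ν := gen Γ ν (.idem i)

variable (Γ) in
/-- The element `x_{a,i}` of `R(ν)`. -/
def dot (a : Fin (size ν)) (i : Seq ν) : R Γ ν := gen Γ ν (.dot a i)

theorem idem_mul_self (i : Seq ν) : idem Γ i * idem Γ i = idem Γ i := by
  simpa [idem, dot, gen] using mk_rel (Rel.idem_mul_self (Γ := Γ) i)

theorem idem_mul_of_ne {i j : Seq ν} (h : i ≠ j) : idem Γ i * idem Γ j = 0 := by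
  simpa [idem, dot, gen] using mk_rel (Rel.idem_mul_of_ne (Γ := Γ) i j h)

theorem sum_idem : ∑ i : Seq ν, idem Γ i = 1 := by
  simpa [idem, dot, gen] using mk_rel (Rel.sum_idem (Γ := Γ) (ν := ν))

theorem idem_mul_dot (a : Fin (size ν)) (i : Seq ν) : idem Γ i * dot Γ a i = dot Γ a i := by
  simpa [idem, dot, gen] using mk_rel (Rel.idem_mul_dot (Γ := Γ) a i)

theorem dot_mul_idem (a : Fin (size ν)) (i : Seq ν) : dot Γ a i * idem Γ i = dot Γ a i := by
  simpa [idem, dot, gen] using mk_rel (Rel.dot_mul_idem (Γ := Γ) a i)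

theorem dot_mul_dot (a b : Fin (size ν)) (i : Seq ν) :
    dot Γ a i * dot Γ b i = dot Γ b i * dot Γ a i := by
  simpa [idem, dot, gen] using mk_rel (Rel.dot_mul_dot (Γ := Γ) a b i)

/-! ### The polynomial subring `Pol(ν)` and its invariants `Sym(ν)` -/

variable (ν) in
/-- `Pol(ν)`, the product over `i ∈ Seq(ν)` of the polynomial rings `ℤ[x_{1,i}, …, x_{m,i}]`. -/
abbrev Pol : Type u := Seq ν → MvPolynomial (Fin (size ν)) ℤ

/-- The symmetric group permutes the strands together with their labels and dots: `w` takes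
`x_{a,i}` to `x_{w a, w i}`. -/
def permute (w : Equiv.Perm (Fin (size ν))) : Pol ν →+* Pol ν where
  toFun f i := MvPolynomial.rename w (f (w⁻¹ • i))
  map_one' := by ext1 i; simp
  map_zero' := by ext1 i; simp
  map_mul' f g := by ext1 i; simp
  map_add' f g := by ext1 i; simp

variable (ν) in
/-- The ring of `S_m`-invariants of `Pol(ν)`. -/
def invariants : Subring (Pol ν) where
  carrier := {f | ∀ w, permute w f = f}
  one_mem' w := map_one _
  zero_mem' w := map_zero _
  mul_mem' hf hg w := by rw [map_mul, hf w, hg w]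
  add_mem' hf hg w := by rw [map_add, hf w, hg w]
  neg_mem' hf w := by rw [map_neg, hf w]

variable (Γ ν) in
/-- The set of all `1_i` and all `x_{a,i}`. -/
def polGens : Set (R Γ ν) :=
  Set.range (idem Γ) ∪ Set.range fun p : Fin (size ν) × Seq ν => dot Γ p.1 p.2

theorem polGens_comm : ∀ x ∈ polGens Γ ν, ∀ y ∈ polGens Γ ν, x * y = y * x := by
  have key (i j : Seq ν) (hij : i ≠ j) {x y : R Γ ν} (hx : x * idem Γ i = x)
      (hy : idem Γ j * y = y) : x * y = 0 := by
    rw [← hx, ← hy, mul_assoc, ← mul_assoc (idem Γ i), idem_mul_of_ne hij]; simp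
  rintro _ (⟨i, rfl⟩ | ⟨⟨a, i⟩, rfl⟩) _ (⟨j, rfl⟩ | ⟨⟨b, j⟩, rfl⟩) <;>
    rcases eq_or_ne i j with rfl | h
  · rfl
  · rw [idem_mul_of_ne h, idem_mul_of_ne h.symm]
  · rw [idem_mul_dot, dot_mul_idem]
  · rw [key i j h (idem_mul_self i) (idem_mul_dot b j),
      key j i h.symm (dot_mul_idem b j) (idem_mul_self i)]
  · rw [idem_mul_dot, dot_mul_idem]
  · rw [key i j h (dot_mul_idem a i) (idem_mul_self j),
      key j i h.symm (idem_mul_self j) (idem_mul_dot a i)]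
  · exact dot_mul_dot a b i
  · rw [key i j h (dot_mul_idem a i) (idem_mul_dot b j),
      key j i h.symm (dot_mul_idem b j) (idem_mul_dot a i)]

variable (Γ ν) in
/-- The subring of `R(ν)` generated by all `1_i` and all `x_{a,i}`; it is commutative. -/
abbrev polClosure : Subring (R Γ ν) := Subring.closure (polGens Γ ν)

instance : CommRing (polClosure Γ ν) :=
  { (polClosure Γ ν).toRing with
    mul_comm := (Subring.isMulCommutative_closure (polGens_comm (Γ := Γ) (ν := ν))).is_comm.comm }

variable (Γ) in
/-- `1_i` as an element of the commutative subring `polClosure`. -/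
def pIdem (i : Seq ν) : polClosure Γ ν :=
  ⟨idem Γ i, Subring.subset_closure (Or.inl ⟨i, rfl⟩)⟩

variable (Γ) in
/-- `x_{a,i}` as an element of the commutative subring `polClosure`. -/
def pDot (a : Fin (size ν)) (i : Seq ν) : polClosure Γ ν :=
  ⟨dot Γ a i, Subring.subset_closure (Or.inr ⟨(a, i), rfl⟩)⟩

variable (Γ ν) in
/-- The ring homomorphism `Pol(ν) → R(ν)` taking `f = (f_i)` to
`∑ i, 1_i * f_i(x_{1,i}, …, x_{m,i})`. -/
def polToR : Pol ν →+* R Γ ν :=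
  (polClosure Γ ν).subtype.comp
    { toFun := fun f => ∑ i, pIdem Γ i *
        MvPolynomial.eval₂ (Int.castRingHom (polClosure Γ ν)) (fun a => pDot Γ a i) (f i)
      map_one' := by
        simp only [Pi.one_apply, MvPolynomial.eval₂_one, mul_one]
        exact Subtype.ext (by simpa [pIdem] using sum_idem (Γ := Γ) (ν := ν))
      map_zero' := by simp
      map_add' := fun f g => by
        simp [MvPolynomial.eval₂_add, mul_add, Finset.sum_add_distrib]
      map_mul' := fun f g => by
        rw [Finset.sum_mul_sum]
        refine Finset.sum_congr rfl fun i _ => ?_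
        rw [Finset.sum_eq_single i]
        · have h : pIdem Γ i * pIdem Γ i = pIdem Γ i := Subtype.ext (idem_mul_self i)
          rw [mul_mul_mul_comm, h, Pi.mul_apply, MvPolynomial.eval₂_mul]
        · intro j _ hji
          have h : pIdem Γ i * pIdem Γ j = 0 := Subtype.ext (idem_mul_of_ne hji.symm)
          rw [mul_mul_mul_comm, h, zero_mul]
        · simp }

variable (Γ ν) in
/-- `Sym(ν)`, the ring of `S_m`-invariants of `Pol(ν)`, as a subring of `R(ν)`. -/
def Sym : Subring (R Γ ν) := (invariants ν).map (polToR Γ ν)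

/-- A ring is indecomposable if it is not zero and is not isomorphic to a product of two nonzero
rings. -/
def IsIndecomposableRing (A : Type u) [Ring A] : Prop :=
  Nontrivial A ∧ ∀ (S T : Type u) [Ring S] [Ring T],
    Nonempty (A ≃+* S × T) → Subsingleton S ∨ Subsingleton T

end KLR

end

/-! The ring acts on Pol(ν). Dots multiply by variables. A crossing of equal labels acts by the
divided difference ∂f = (f - sf)/(x_a - x_b). A crossing of different labels acts by the
transposition, followed by the factor x_a + x_b for one chosen orientation of each edge (`crossOp`,
`genOp_rel`). An element of Pol(ν) acts by multiplication, so Pol(ν) embeds in R(ν).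

Upper bound. The sums of crossings over all sequences satisfy nil Hecke relations modulo Pol(ν).
Every such system is spanned over its polynomial part by normal form words
(`BraidLike.tower_le_nf`), of which there are m! here (`exists_eq_sum`).

Lower bound. For equal labels s = 1 - (x_a - x_b)∂, and for different labels the crossing is already
a nonzero multiple of s. Hence for every w in S_m some element of R(ν) acts as g·w, where all
components of g are nonzero (`exists_rho_eq_permute`). By Dedekind's theorem the m! permutations are
independent over polynomials. They lie, up to these factors, in the span of the m! words, so a
determinant argument makes the words independent. Thus the action is faithful and R(ν) is free over
Pol(ν) on the words.

Center. A central z commutes with Pol(ν), so it acts as multiplication by g = z·1. Commuting with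
the operators g_w·w makes g invariant. Conversely, every generator acts linearly over the invariants
(`center_eq_Sym`).

Freeness over the center. At a sequence s, the variable x_k is a root of the product of X - x_b over
b ≥ k with s_b = s_k. This polynomial is monic over the ring generated by the stabilizer invariants
and the x_l with l < k. So Pol(ν) is spanned over Sym(ν) by monomials with bounded exponents, whose
number is |Seq(ν)| times the order of a stabilizer, that is m!. Dedekind's theorem again gives
independence (`eq_zero_of_sum_monElt`). Together with the words this yields (m!)² basis elements.
They are homogeneous because each monomial sits at a single sequence.

The rest. The relations are homogeneous, so degrees are recorded by a homomorphism to the group ring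
R(ν)[ℤ], which gives the grading. Sym(ν) and the tensor product are both free over ℤ on families of
multisets of exponents, and comparing coefficients identifies them. R(ν) is finite over its center,
which is Noetherian by Artin–Tate. A central idempotent is an invariant, determined by one component
in a domain, so it is 0 or 1. -/

noncomputable section

/-! ### Spanning by normal forms in rings with generators of braid type -/

namespace KLR

section Spanning

variable {A : Type*} [Ring A]

/-- The additive subgroups `a_n` generated by products of elements of `P` and `d 0, …, d (n - 1)` in
which `d (n - 1)` occurs at most once. -/
def tower (P : Submodule ℤ A) (d : ℕ → A) : ℕ → Submodule ℤ A
  | 0 => P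
  | n + 1 => tower P d n ⊔ tower P d n * Submodule.span ℤ {d n} * tower P d n

/-- The relations, up to elements of `P`, of a nil Hecke algebra. -/
structure BraidLike (P : Submodule ℤ A) (d : ℕ → A) : Prop where
  one_le : 1 ≤ P
  mul_le : P * P ≤ P
  left : ∀ k, Submodule.span ℤ {d k} * P ≤ P * Submodule.span ℤ {d k} ⊔ P
  right : ∀ k, P * Submodule.span ℤ {d k} ≤ Submodule.span ℤ {d k} * P ⊔ P
  sq : ∀ k, d k * d k ∈ P
  far : ∀ k l, k + 1 < l → d k * d l = d l * d k
  braid : ∀ k, d k * d (k + 1) * d k - d (k + 1) * d k * d (k + 1) ∈ P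

/-- The word `d (n - 1) * d (n - 2) * ⋯` with `j` factors. -/
def run (d : ℕ → A) : ℕ → ℕ → A
  | _, 0 => 1
  | 0, _ + 1 => 1
  | n + 1, j + 1 => d n * run d n j

/-- The normal form words. -/
def nf (d : ℕ → A) (c : ℕ → ℕ) : ℕ → A
  | 0 => 1
  | n + 1 => nf d c n * run d (n + 1) (c n)

variable {P : Submodule ℤ A} {d : ℕ → A}

theorem tower_le_succ (n : ℕ) : tower P d n ≤ tower P d (n + 1) := le_sup_left

theorem tower_mono {n k : ℕ} (h : n ≤ k) : tower P d n ≤ tower P d k :=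
  monotone_nat_of_le_succ (f := tower P d) tower_le_succ h

namespace BraidLike

theorem one_le_tower (h : BraidLike P d) (n : ℕ) : 1 ≤ tower P d n :=
  h.one_le.trans (tower_mono (Nat.zero_le n))

local notation "D" k => Submodule.span ℤ ({d k} : Set A)

theorem far_span {k l : ℕ} (h : BraidLike P d) (hkl : k + 1 < l) :
    ((D k) * D l) = (D l) * D k := by
  rw [Submodule.span_mul_span, Submodule.span_mul_span, Set.singleton_mul_singleton,
    Set.singleton_mul_singleton, h.far k l hkl]

theorem sq_span (h : BraidLike P d) (k : ℕ) : ((D k) * D k) ≤ P := by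
  rw [Submodule.span_mul_span, Set.singleton_mul_singleton, Submodule.span_singleton_le_iff_mem]
  exact h.sq k

theorem braid_span (h : BraidLike P d) (k : ℕ) :
    ((D (k + 1)) * (D k) * D (k + 1)) ≤ ((D k) * (D (k + 1)) * D k) ⊔ P := by
  simp only [Submodule.span_mul_span, Set.singleton_mul_singleton,
    Submodule.span_singleton_le_iff_mem]
  refine Submodule.mem_sup.2 ⟨_, Submodule.mem_span_singleton_self _, _,
    neg_mem (h.braid k), by abel⟩

/-- Crossings that are far away from those in `tower P d n` commute with it up to `tower P d n`. -/
theorem far_tower (h : BraidLike P d) (n : ℕ) (hm : ∀ l ≤ n, tower P d l * tower P d l ≤ tower P d l)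
    (k : ℕ) (hk : n + 1 ≤ k) :
    ((D k) * tower P d n ≤ tower P d n * (D k) ⊔ tower P d n) ∧
    (tower P d n * (D k) ≤ (D k) * tower P d n ⊔ tower P d n) := by
  induction n with
  | zero => exact ⟨h.left k, h.right k⟩
  | succ n ih =>
    obtain ⟨h1, h2⟩ := ih (fun l hl => hm l (by omega)) (by omega)
    set a := tower P d n with ha
    set b := tower P d (n + 1) with hb
    have hbb : b * b ≤ b := hm _ le_rfl
    have hab : a ≤ b := tower_le_succ n
    have hone : 1 ≤ a := h.one_le_tower n
    have hDb : (D n) ≤ b := by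
      refine le_trans ?_ (le_sup_right : a * (D n) * a ≤ b)
      calc (D n) = 1 * (D n) * 1 := by simp
        _ ≤ _ := by gcongr
    have hf := h.far_span (show n + 1 < k by omega)
    have e : b = a ⊔ a * (D n) * a := rfl
    have s1 : (D k) * a ≤ b * (D k) ⊔ b := h1.trans (by gcongr)
    have s2 : a * (D k) ≤ (D k) * b ⊔ b := h2.trans (by gcongr)
    have c1 : (D k) * b ≤ b * (D k) ⊔ b := by
      conv_lhs => rw [e]
      rw [Submodule.mul_sup]
      refine sup_le s1 ?_
      calc (D k) * (a * (D n) * a) = ((D k) * a) * ((D n) * a) := by simp only [mul_assoc]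
        _ ≤ (a * (D k) ⊔ a) * ((D n) * a) := by gcongr
        _ = a * (D n) * ((D k) * a) ⊔ a * (D n) * a := by
          rw [Submodule.sup_mul]; simp only [mul_assoc]
          rw [← mul_assoc (D k), ← hf]; simp only [mul_assoc]
        _ ≤ b * b * (b * (D k) ⊔ b) ⊔ b * b * b := by gcongr
        _ ≤ _ := by
          have hbbb : b * b * b ≤ b := (mul_le_mul' hbb le_rfl).trans hbb
          rw [Submodule.mul_sup, ← mul_assoc]
          refine sup_le (sup_le (le_sup_of_le_left ?_) (le_sup_of_le_right hbbb)) (le_sup_of_le_right hbbb)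
          gcongr
    have c2 : b * (D k) ≤ (D k) * b ⊔ b := by
      conv_lhs => rw [e]
      rw [Submodule.sup_mul]
      refine sup_le s2 ?_
      calc (a * (D n) * a) * (D k) = a * (D n) * (a * (D k)) := by simp only [mul_assoc]
        _ ≤ a * (D n) * ((D k) * a ⊔ a) := by gcongr
        _ = a * (D k) * ((D n) * a) ⊔ a * (D n) * a := by
          rw [Submodule.mul_sup]; simp only [mul_assoc]
          rw [← mul_assoc (D n), hf]; simp only [mul_assoc]
        _ ≤ ((D k) * b ⊔ b) * (b * b) ⊔ b * b * b := by gcongr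
        _ ≤ _ := by
          have hbbb : b * b * b ≤ b := (mul_le_mul' hbb le_rfl).trans hbb
          rw [Submodule.sup_mul, mul_assoc]
          refine sup_le (sup_le (le_sup_of_le_left ?_) (le_sup_of_le_right ?_)) (le_sup_of_le_right hbbb)
          · gcongr; rwa [← mul_assoc]
          · rwa [← mul_assoc]
    exact ⟨c1, c2⟩

/-- This is the step that keeps `d n` from occurring twice. Write a_n for the tower. For n > 0 the
crossing d_n passes through a_{n-1} up to terms without it, so the two copies of d_n meet either
each other or a single d_{n-1}. The square relation or the braid relation then reduces their number.
-/
theorem sandwich (h : BraidLike P d) (n : ℕ)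
    (hm : ∀ l ≤ n, tower P d l * tower P d l ≤ tower P d l) :
    (D n) * tower P d n * (D n) ≤ tower P d (n + 1) := by
  cases n with
  | zero =>
    change (D 0) * P * (D 0) ≤ P ⊔ P * (D 0) * P
    calc (D 0) * P * (D 0) ≤ (P * (D 0) ⊔ P) * (D 0) := by gcongr; exact h.left 0
      _ = P * ((D 0) * (D 0)) ⊔ P * (D 0) * 1 := by rw [Submodule.sup_mul]; simp only [mul_assoc, mul_one]
      _ ≤ P * P ⊔ P * (D 0) * P := by
        gcongr
        · exact h.sq_span 0
        · exact h.one_le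
      _ ≤ _ := by gcongr; exact h.mul_le
  | succ n =>
    obtain ⟨h1, h2⟩ := h.far_tower n (fun l hl => hm l (by omega)) (n + 1) le_rfl
    set a := tower P d n with ha
    set b := tower P d (n + 1) with hb
    set c := tower P d (n + 2) with hc
    have hbb : b * b ≤ b := hm _ le_rfl
    have hab : a ≤ b := tower_le_succ n
    have hone : 1 ≤ a := h.one_le_tower n
    have hDb : (D n) ≤ b := by
      refine le_trans ?_ (le_sup_right : a * (D n) * a ≤ b)
      calc (D n) = 1 * (D n) * 1 := by simp
        _ ≤ _ := by gcongr
    have hPb : P ≤ b := tower_mono (Nat.zero_le _)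
    have hbDb : b * (D (n + 1)) * b ≤ c := le_sup_right
    have hbc : b ≤ c := le_sup_left
    have hbD : b * (D (n + 1)) ≤ c := by
      refine le_trans ?_ hbDb
      conv_lhs => rw [← mul_one (b * (D (n + 1)))]
      gcongr; exact hone.trans hab
    have hDb' : (D (n + 1)) * b ≤ c := by
      refine le_trans ?_ hbDb
      conv_lhs => rw [← one_mul ((D (n + 1)) * b), ← mul_assoc]
      gcongr; exact hone.trans hab
    have e : b = a ⊔ a * (D n) * a := rfl
    conv_lhs => rw [e]
    rw [Submodule.mul_sup, Submodule.sup_mul]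
    refine sup_le ?_ ?_
    · calc (D (n + 1)) * a * (D (n + 1)) ≤ (a * (D (n + 1)) ⊔ a) * (D (n + 1)) := by gcongr
        _ = a * ((D (n + 1)) * (D (n + 1))) ⊔ a * (D (n + 1)) := by
          rw [Submodule.sup_mul]; simp only [mul_assoc]
        _ ≤ b * b ⊔ b * (D (n + 1)) := by gcongr; exact (h.sq_span _).trans hPb
        _ ≤ c := sup_le (hbb.trans hbc) hbD
    · calc (D (n + 1)) * (a * (D n) * a) * (D (n + 1))
          = ((D (n + 1)) * a) * (D n) * (a * (D (n + 1))) := by simp only [mul_assoc]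
        _ ≤ (a * (D (n + 1)) ⊔ a) * (D n) * ((D (n + 1)) * a ⊔ a) := by gcongr
        _ = (a * ((D (n + 1)) * (D n) * (D (n + 1))) * a ⊔ a * ((D n) * (D (n + 1)) * a)) ⊔
            (a * (D (n + 1)) * ((D n) * a) ⊔ a * (D n) * a) := by
          simp only [Submodule.sup_mul, Submodule.mul_sup, mul_assoc]
        _ ≤ c := by
          refine sup_le (sup_le ?_ ?_) (sup_le ?_ ?_)
          -- The main term: the braid relation trades two factors `d (n + 1)` for one, modulo `P`.
          · calc a * ((D (n + 1)) * (D n) * (D (n + 1))) * a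
                ≤ a * (((D n) * (D (n + 1)) * D n) ⊔ P) * a := by
                  gcongr; exact h.braid_span n
              _ = (a * (D n)) * (D (n + 1)) * ((D n) * a) ⊔ a * P * a := by
                  simp only [Submodule.sup_mul, Submodule.mul_sup, mul_assoc]
              _ ≤ (b * b) * (D (n + 1)) * (b * b) ⊔ b * b * b := by gcongr
              _ ≤ b * (D (n + 1)) * b ⊔ b := by
                  gcongr
                  exact (mul_le_mul' hbb le_rfl).trans hbb
              _ ≤ c := sup_le hbDb hbc
          · calc a * ((D n) * (D (n + 1)) * a) = (a * (D n)) * (D (n + 1)) * a := by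
                  simp only [mul_assoc]
              _ ≤ (b * b) * (D (n + 1)) * b := by gcongr
              _ ≤ b * (D (n + 1)) * b := by gcongr
              _ ≤ c := hbDb
          · calc a * (D (n + 1)) * ((D n) * a) ≤ b * (D (n + 1)) * (b * b) := by gcongr
              _ ≤ b * (D (n + 1)) * b := by gcongr
              _ ≤ c := hbDb
          · exact le_trans le_sup_right hbc

/-- With `sandwich`, a product of two elements containing `d n` once is rewritten with at most one
`d n`. Since `sandwich` itself uses that the lower stages are rings, the induction is strong. -/
theorem tower_mul_le (h : BraidLike P d) (n : ℕ) :
    tower P d n * tower P d n ≤ tower P d n := by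
  induction n using Nat.strong_induction_on with
  | _ n ih =>
    cases n with
    | zero => exact h.mul_le
    | succ n =>
      have hs := h.sandwich n (fun l hl => ih l (by omega))
      have haa := ih n (by omega)
      set a := tower P d n with ha
      have e : tower P d (n + 1) = a ⊔ a * (D n) * a := rfl
      rw [e] at hs ⊢
      have h3 : a * (a * (D n) * a) ≤ a ⊔ a * (D n) * a := by
        refine le_sup_of_le_right ?_
        calc a * (a * (D n) * a) = (a * a) * (D n) * a := by simp only [mul_assoc]
          _ ≤ _ := by gcongr
      have h4 : (a * (D n) * a) * a ≤ a ⊔ a * (D n) * a := by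
        refine le_sup_of_le_right ?_
        rw [mul_assoc]
        gcongr
      have h5 : (a * (D n) * a) * (a * (D n) * a) ≤ a ⊔ a * (D n) * a := by
        calc (a * (D n) * a) * (a * (D n) * a) = a * ((D n) * (a * a) * (D n)) * a := by
              simp only [mul_assoc]
          _ ≤ a * ((D n) * a * (D n)) * a := by gcongr
          _ ≤ a * (a ⊔ a * (D n) * a) * a := by gcongr
          _ = a * a * a ⊔ (a * a) * (D n) * (a * a) := by
            simp only [Submodule.sup_mul, Submodule.mul_sup, mul_assoc]
          _ ≤ a ⊔ a * (D n) * a := by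
            gcongr
            exact (mul_le_mul' haa le_rfl).trans haa
      rw [Submodule.sup_mul, Submodule.mul_sup, Submodule.mul_sup]
      exact sup_le (sup_le (haa.trans le_sup_left) h3) (sup_le h4 h5)

/-- Expand the right-hand factor by induction and move the last crossing to the right through the
stage below. It then stands directly before a run, which it lengthens by one letter; the correction
terms have lost that crossing. -/
theorem tower_succ_le (h : BraidLike P d) (n : ℕ) :
    tower P d (n + 1) ≤ ⨆ j : Fin (n + 2), tower P d n * Submodule.span ℤ {run d (n + 1) j} := by
  have base (n : ℕ) : tower P d n ≤
      ⨆ j : Fin (n + 2), tower P d n * Submodule.span ℤ {run d (n + 1) j} := by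
    refine le_trans ?_ (le_iSup _ (0 : Fin (n + 2)))
    simp [run, ← Submodule.one_eq_span]
  induction n with
  | zero =>
    refine sup_le (base 0) ?_
    change P * (D 0) * P ≤ _
    calc P * (D 0) * P ≤ P * (P * (D 0) ⊔ P) := by rw [mul_assoc]; gcongr; exact h.left 0
      _ = (P * P) * (D 0) ⊔ P * P := by rw [Submodule.mul_sup, mul_assoc]
      _ ≤ P * (D 0) ⊔ P := by gcongr <;> exact h.mul_le
      _ ≤ _ := by
        refine sup_le ?_ (base 0)
        refine le_trans ?_ (le_iSup _ (1 : Fin 2))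
        simp [run, tower]
  | succ n ih =>
    have hbb := h.tower_mul_le (n + 1)
    have h1 := (h.far_tower n (fun l _ => h.tower_mul_le l) (n + 1) le_rfl).1
    refine sup_le (base _) ?_
    set b := tower P d (n + 1) with hb
    set a := tower P d n with ha
    have hab : a ≤ b := tower_le_succ n
    calc b * (D (n + 1)) * b ≤ b * (D (n + 1)) *
          ⨆ j : Fin (n + 2), a * Submodule.span ℤ {run d (n + 1) j} := by gcongr
      _ = ⨆ j : Fin (n + 2), b * ((D (n + 1)) * a) * Submodule.span ℤ {run d (n + 1) j} := by
        rw [Submodule.mul_iSup]; simp only [mul_assoc]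
      _ ≤ _ := by
        refine iSup_le fun j => ?_
        have hr : Submodule.span ℤ {run d (n + 1) j} ≤ b := by
          -- Runs lie in the tower, so the correction terms, in which the new crossing has
          -- disappeared, stay in `b`.
          have key : ∀ (n j : ℕ), Submodule.span ℤ {run d n j} ≤ tower P d n := by
            intro n
            induction n with
            | zero =>
              intro j
              refine le_trans ?_ (h.one_le_tower 0)
              cases j <;> simp [run, Submodule.one_eq_span]
            | succ n ih =>
              intro j
              cases j with
              | zero =>
                refine le_trans ?_ (h.one_le_tower _)
                simp [run, Submodule.one_eq_span]
              | succ j =>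
                have : Submodule.span ℤ {run d (n + 1) (j + 1)} =
                    1 * (D n) * Submodule.span ℤ {run d n j} := by
                  rw [one_mul, Submodule.span_mul_span, Set.singleton_mul_singleton]; rfl
                rw [this]
                refine le_trans ?_ le_sup_right
                gcongr
                · exact h.one_le_tower n
                · exact ih j
          exact key _ _
        calc b * ((D (n + 1)) * a) * Submodule.span ℤ {run d (n + 1) j}
            ≤ b * (a * (D (n + 1)) ⊔ a) * Submodule.span ℤ {run d (n + 1) j} := by gcongr
          _ = (b * a) * ((D (n + 1)) * Submodule.span ℤ {run d (n + 1) j}) ⊔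
              b * a * Submodule.span ℤ {run d (n + 1) j} := by
            simp only [Submodule.mul_sup, Submodule.sup_mul, mul_assoc]
          _ ≤ (b * b) * ((D (n + 1)) * Submodule.span ℤ {run d (n + 1) j}) ⊔ b * b * b := by
            gcongr
          _ ≤ b * ((D (n + 1)) * Submodule.span ℤ {run d (n + 1) j}) ⊔ b := by
            gcongr
            exact (mul_le_mul' hbb le_rfl).trans hbb
          _ ≤ _ := by
            refine sup_le ?_ (base _)
            refine le_trans (le_of_eq ?_) (le_iSup _ j.succ)
            rw [Submodule.span_mul_span, Set.singleton_mul_singleton]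
            rfl

theorem tower_le_nf (h : BraidLike P d) (n : ℕ) :
    tower P d n ≤ ⨆ c : (i : Fin n) → Fin (i + 2),
      P * Submodule.span ℤ {nf d (fun i => if hi : i < n then (c ⟨i, hi⟩ : ℕ) else 0) n} := by
  induction n with
  | zero =>
    refine le_trans (le_of_eq ?_) (le_iSup _ finZeroElim)
    simp [nf, ← Submodule.one_eq_span, tower]
  | succ n ih =>
    refine (h.tower_succ_le n).trans (iSup_le fun j => ?_)
    refine le_trans (mul_le_mul' ih le_rfl) ?_
    rw [Submodule.iSup_mul]
    refine iSup_le fun c => ?_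
    refine le_trans (le_of_eq ?_) (le_iSup _ (Fin.snoc (α := fun i : Fin (n + 1) => Fin (i + 2)) c j))
    rw [mul_assoc, Submodule.span_mul_span, Set.singleton_mul_singleton]
    -- The exponents are padded by zero beyond the range; the padding is invisible to the word.
    have key : ∀ (k : ℕ) (c c' : ℕ → ℕ), (∀ i < k, c i = c' i) → nf d c k = nf d c' k := by
      intro k c c' hc
      induction k with
      | zero => rfl
      | succ k ih' => rw [nf, nf, ih' fun i hi => hc i (by omega), hc k (by omega)]
    congr 3
    rw [nf]
    congr 1
    · refine key _ _ _ fun i hi => ?_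
      rw [dif_pos hi, dif_pos (by omega)]
      exact (congrArg Fin.val (Fin.snoc_castSucc (α := fun i : Fin (n + 1) => Fin (i + 2))
        j c ⟨i, hi⟩)).symm
    · simp only [lt_add_iff_pos_right, zero_lt_one, dite_true]
      exact congrArg (run d (n + 1)) (congrArg Fin.val
        (Fin.snoc_last (α := fun i : Fin (n + 1) => Fin (i + 2)) j c)).symm

theorem mem_tower (h : BraidLike P d) {n k : ℕ} (hk : k < n) : d k ∈ tower P d n := by
  refine tower_mono (Nat.succ_le_of_lt hk) ?_
  refine Submodule.mem_sup_right ?_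
  have h1 := Submodule.one_le.1 (h.one_le_tower k)
  simpa using Submodule.mul_mem_mul (Submodule.mul_mem_mul h1
    (Submodule.mem_span_singleton_self (R := ℤ) (d k))) h1

end BraidLike

end Spanning

end KLR

end

noncomputable section

/-! ### A determinant criterion for linear independence -/

namespace KLR

section LinearAlgebra

/-- If a module over a domain contains `N` linearly independent elements in the span of `N` elements,
then the latter are linearly independent. -/
theorem eq_zero_of_span {S M ι κ : Type*} [CommRing S] [IsDomain S] [AddCommGroup M] [Module S M]
    [Fintype ι] [Fintype κ] (hcard : Fintype.card ι = Fintype.card κ) (v : ι → M) (w : κ → M)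
    (hw : LinearIndependent S w) (a : κ → ι → S) (ha : ∀ k, w k = ∑ i, a k i • v i)
    (c : ι → S) (hc : ∑ i, c i • v i = 0) : c = 0 := by
  classical
  let e : ι ≃ κ := Fintype.equivOfCardEq hcard
  let B : Matrix ι ι S := Matrix.of fun i j => a (e i) j
  -- A left null vector of the coefficient matrix would be a linear relation among the `w k`.
  have hdet : B.det ≠ 0 := by
    intro h0
    obtain ⟨y, hy, hyB⟩ := Matrix.exists_vecMul_eq_zero_iff.2 h0
    refine hy (funext fun i => ?_)
    have h1 : ∑ i, y i • w (e i) = 0 := by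
      simp_rw [ha, Finset.smul_sum, smul_smul]
      rw [Finset.sum_comm]
      refine Finset.sum_eq_zero fun j _ => ?_
      rw [← Finset.sum_smul]
      have := congrFun hyB j
      simp only [Matrix.vecMul, dotProduct, B, Matrix.of_apply, Pi.zero_apply] at this
      rw [this, zero_smul]
    exact Fintype.linearIndependent_iff.1 (hw.comp e e.injective) y h1 i
  -- Cramer's rule expresses the `v j`, up to the determinant, through the independent elements,
  -- without passing to the fraction field.
  have hadj (j : ι) : B.det • v j = ∑ i, B.adjugate j i • w (e i) := by
    simp_rw [ha, Finset.smul_sum, smul_smul]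
    rw [Finset.sum_comm]
    simp_rw [← Finset.sum_smul]
    have h (l : ι) : ∑ i, B.adjugate j i * a (e i) l = if j = l then B.det else 0 := by
      have := congrFun (congrFun (Matrix.adjugate_mul B) j) l
      simpa [Matrix.mul_apply, Matrix.one_apply, B] using this
    simp [h]
  have h1 : ∑ i, (Matrix.vecMul c B.adjugate) i • w (e i) = 0 := by
    have : B.det • ∑ i, c i • v i = 0 := by rw [hc, smul_zero]
    simp_rw [Finset.smul_sum, smul_comm B.det, hadj, Finset.smul_sum, smul_smul] at this
    rw [Finset.sum_comm] at this
    simpa [Matrix.vecMul, dotProduct, Finset.sum_smul] using this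
  have h2 : Matrix.vecMul c B.adjugate = 0 := funext fun i =>
    Fintype.linearIndependent_iff.1 (hw.comp e e.injective) _ h1 i
  have h3 : B.det • c = 0 := by
    have := congrArg (fun x => Matrix.vecMul x B) h2
    simpa [Matrix.vecMul_vecMul, Matrix.adjugate_mul, Matrix.vecMul_smul] using this
  exact (smul_eq_zero.1 h3).resolve_left hdet

/-- A square matrix over a domain with independent rows has independent columns. -/
theorem eq_zero_of_rows {S ι κ : Type*} [CommRing S] [IsDomain S] [Fintype ι] [Fintype κ]
    (hcard : Fintype.card ι = Fintype.card κ) (B : κ → ι → S)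
    (hB : ∀ y : κ → S, (∀ i, ∑ k, y k * B k i = 0) → y = 0)
    (z : ι → S) (hz : ∀ k, ∑ i, z i * B k i = 0) : z = 0 := by
  classical
  let e : ι ≃ κ := Fintype.equivOfCardEq hcard
  let M : Matrix ι ι S := Matrix.of fun i j => B (e i) j
  have hdet : M.det ≠ 0 := by
    intro h0
    obtain ⟨y, hy, hyB⟩ := Matrix.exists_vecMul_eq_zero_iff.2 h0
    refine hy ?_
    have := hB (y ∘ e.symm) fun i => by
      have := congrFun hyB i
      rw [← e.sum_comp]
      simpa [Matrix.vecMul, dotProduct, M] using this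
    funext i
    simpa using congrFun this (e i)
  by_contra h
  exact hdet (Matrix.exists_mulVec_eq_zero_iff.1 ⟨z, h, funext fun i => by
    simpa [Matrix.mulVec, dotProduct, M, mul_comm] using hz (e i)⟩)

end LinearAlgebra

end KLR

end

noncomputable section

/-! ### Divided differences and the crossing operators -/

namespace KLR

universe u

variable {I : Type u}

section Operators

open MvPolynomial Equiv

variable {τ : Type*}

theorem X_sub_X_ne_zero {a b : τ} (h : a ≠ b) : (X a - X b : MvPolynomial τ ℤ) ≠ 0 :=
  sub_ne_zero.2 fun e => h (X_injective e)

theorem X_add_X_ne_zero (a b : τ) : (X a + X b : MvPolynomial τ ℤ) ≠ 0 := by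
  intro h
  have := congrArg (eval fun _ => (1 : ℤ)) h
  simp at this

open Classical in
/-- The polynomial by which the crossing of strands with different labels `i`, `j` differs from the
permutation of variables; it depends on an orientation of the graph. -/
def coef (Γ : SimpleGraph I) (i j : I) (a b : τ) : MvPolynomial τ ℤ :=
  if Γ.Adj i j ∧ WellOrderingRel i j then X a + X b else 1

theorem coef_ne_zero (Γ : SimpleGraph I) (i j : I) (a b : τ) : coef Γ i j a b ≠ 0 := by
  rw [coef]
  split_ifs
  · exact X_add_X_ne_zero a b
  · exact one_ne_zero

theorem coef_comm (Γ : SimpleGraph I) (i j : I) (a b : τ) : coef Γ i j a b = coef Γ i j b a := by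
  simp only [coef, add_comm]

theorem rename_coef (Γ : SimpleGraph I) (i j : I) (a b : τ) (w : Perm τ) :
    rename w (coef Γ i j a b) = coef Γ i j (w a) (w b) := by
  rw [coef, coef]
  split_ifs <;> simp

/-- The well-order on `I` orients every edge, so exactly one of the two factors is `X a + X b` and
the other is 1. -/
theorem coef_mul_of_adj {Γ : SimpleGraph I} {i j : I} (h : Γ.Adj i j) (a b : τ) :
    coef Γ i j a b * coef Γ j i a b = X a + X b := by
  rcases trichotomous_of (WellOrderingRel (α := I)) i j with h1 | h1 | h1
  · rw [coef, coef, if_pos ⟨h, h1⟩, if_neg fun h2 => asymm_of WellOrderingRel h1 h2.2, mul_one]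
  · exact absurd h1 h.ne
  · rw [coef, coef, if_neg fun h2 => asymm_of WellOrderingRel h1 h2.2, if_pos ⟨h.symm, h1⟩, one_mul]

theorem coef_mul_of_not_adj {Γ : SimpleGraph I} {i j : I} (h : ¬ Γ.Adj i j) (a b : τ) :
    coef Γ i j a b * coef Γ j i a b = 1 := by
  rw [coef, coef, if_neg fun h1 => h h1.1, if_neg fun h1 => h h1.1.symm, one_mul]

variable [DecidableEq τ]

theorem rename_swap_comm {a b c d : τ} (hac : a ≠ c) (had : a ≠ d) (hbc : b ≠ c) (hbd : b ≠ d)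
    (f : MvPolynomial τ ℤ) :
    rename (swap a b) (rename (swap c d) f) = rename (swap c d) (rename (swap a b) f) := by
  rw [rename_rename, rename_rename]
  congr 2
  ext x
  simp only [Function.comp_apply]
  rcases eq_or_ne x a with rfl | ha
  · simp [swap_apply_of_ne_of_ne, *]
  rcases eq_or_ne x b with rfl | hb
  · simp [swap_apply_of_ne_of_ne, *]
  rcases eq_or_ne x c with rfl | hc
  · simp [swap_apply_of_ne_of_ne, *, had.symm, hbd.symm, hac.symm, hbc.symm]
  rcases eq_or_ne x d with rfl | hd
  · simp [swap_apply_of_ne_of_ne, *, had.symm, hbd.symm, hac.symm, hbc.symm]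
  · simp [swap_apply_of_ne_of_ne, *]

/-- The map f ↦ f - sf obeys the twisted Leibniz rule pq - s(p)s(q) = (p - s(p))q + s(p)(q - s(q)),
which reduces divisibility to variables. -/
theorem X_sub_X_dvd (a b : τ) (f : MvPolynomial τ ℤ) :
    (X a - X b : MvPolynomial τ ℤ) ∣ f - rename (swap a b) f := by
  induction f using MvPolynomial.induction_on with
  | C r => simp
  | add p q hp hq =>
    rw [map_add, add_sub_add_comm]
    exact dvd_add hp hq
  | mul_X p c hp =>
    rw [map_mul, rename_X]
    have h : (X a - X b : MvPolynomial τ ℤ) ∣ X c - X (swap a b c) := by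
      rcases eq_or_ne c a with rfl | ha
      · rw [swap_apply_left]
      rcases eq_or_ne c b with rfl | hb
      · rw [swap_apply_right, ← dvd_neg, neg_sub]
      · rw [swap_apply_of_ne_of_ne ha hb, sub_self]; exact dvd_zero _
    have e : p * X c - rename (swap a b) p * X (swap a b c) =
        (p - rename (swap a b) p) * X c + rename (swap a b) p * (X c - X (swap a b c)) := by ring
    rw [e]
    exact dvd_add (hp.mul_right _) (h.mul_left _)

open Classical in
/-- The divided difference operator `f ↦ (f - s f) / (x_a - x_b)`. -/
def divDiff (a b : τ) : MvPolynomial τ ℤ →ₗ[ℤ] MvPolynomial τ ℤ :=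
  if h : a = b then 0 else
    { toFun := fun f => (X_sub_X_dvd a b f).choose
      map_add' := fun f g => by
        refine mul_left_cancel₀ (X_sub_X_ne_zero h) ?_
        rw [mul_add, ← (X_sub_X_dvd a b (f + g)).choose_spec, ← (X_sub_X_dvd a b f).choose_spec,
          ← (X_sub_X_dvd a b g).choose_spec, map_add]
        ring
      map_smul' := fun c f => by
        refine mul_left_cancel₀ (X_sub_X_ne_zero h) ?_
        rw [RingHom.id_apply, mul_smul_comm, ← (X_sub_X_dvd a b (c • f)).choose_spec,
          ← (X_sub_X_dvd a b f).choose_spec, map_smul, smul_sub] }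

theorem divDiff_spec {a b : τ} (h : a ≠ b) (f : MvPolynomial τ ℤ) :
    (X a - X b) * divDiff a b f = f - rename (swap a b) f := by
  rw [divDiff, dif_neg h]
  exact (X_sub_X_dvd a b f).choose_spec.symm

theorem eq_divDiff {a b : τ} (h : a ≠ b) {f g : MvPolynomial τ ℤ}
    (hg : (X a - X b) * g = f - rename (swap a b) f) : g = divDiff a b f :=
  mul_left_cancel₀ (X_sub_X_ne_zero h) (hg.trans (divDiff_spec h f).symm)

theorem rename_swap_swap (a b : τ) (f : MvPolynomial τ ℤ) :
    rename (swap a b) (rename (swap a b) f) = f := by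
  rw [rename_rename]
  have : (swap a b : τ → τ) ∘ swap a b = id := by ext x; simp
  rw [this, rename_id_apply]

theorem rename_divDiff {a b : τ} (h : a ≠ b) (w : Perm τ) (f : MvPolynomial τ ℤ) :
    rename w (divDiff a b f) = divDiff (w a) (w b) (rename w f) := by
  refine eq_divDiff (fun e => h (w.injective e)) ?_
  have := congrArg (rename w) (divDiff_spec h f)
  simp only [map_mul, map_sub, rename_X, rename_rename] at this ⊢
  rw [this]
  congr 3
  ext x
  simp [Equiv.swap_apply_apply]

theorem divDiff_mul {a b : τ} (h : a ≠ b) {p : MvPolynomial τ ℤ} (hp : rename (swap a b) p = p)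
    (f : MvPolynomial τ ℤ) : divDiff a b (p * f) = p * divDiff a b f := by
  refine (eq_divDiff h ?_).symm
  rw [mul_left_comm, divDiff_spec h, map_mul, hp, mul_sub]

theorem rename_swap_divDiff {a b : τ} (h : a ≠ b) (f : MvPolynomial τ ℤ) :
    rename (swap a b) (divDiff a b f) = divDiff a b f := by
  refine mul_left_cancel₀ (X_sub_X_ne_zero h) ?_
  have := congrArg (rename (swap a b)) (divDiff_spec h f)
  simp only [map_mul, map_sub, rename_X, swap_apply_left, swap_apply_right,
    rename_swap_swap] at this
  rw [divDiff_spec h]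
  linear_combination -this

theorem divDiff_divDiff {a b : τ} (h : a ≠ b) (f : MvPolynomial τ ℤ) :
    divDiff a b (divDiff a b f) = 0 := by
  refine mul_left_cancel₀ (X_sub_X_ne_zero h) ?_
  rw [divDiff_spec h, rename_swap_divDiff h, sub_self, mul_zero]

theorem divDiff_left {a b : τ} (h : a ≠ b) (f : MvPolynomial τ ℤ) :
    X a * divDiff a b f - divDiff a b (X b * f) = f := by
  refine mul_left_cancel₀ (X_sub_X_ne_zero h) ?_
  rw [mul_sub, divDiff_spec h, mul_left_comm, divDiff_spec h, map_mul, rename_X, swap_apply_right]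
  ring

theorem divDiff_right {a b : τ} (h : a ≠ b) (f : MvPolynomial τ ℤ) :
    divDiff a b (X a * f) - X b * divDiff a b f = f := by
  refine mul_left_cancel₀ (X_sub_X_ne_zero h) ?_
  rw [mul_sub, divDiff_spec h, mul_left_comm, divDiff_spec h, map_mul, rename_X, swap_apply_left]
  ring

/-- After multiplication by (x_a - x_b)(x_c - x_d) both sides become f - sf - tf + stf for the
commuting transpositions s and t. -/
theorem divDiff_comm {a b c d : τ} (hab : a ≠ b) (hcd : c ≠ d) (hac : a ≠ c) (had : a ≠ d)
    (hbc : b ≠ c) (hbd : b ≠ d) (f : MvPolynomial τ ℤ) :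
    divDiff a b (divDiff c d f) = divDiff c d (divDiff a b f) := by
  refine mul_left_cancel₀ (X_sub_X_ne_zero hab) (mul_left_cancel₀ (X_sub_X_ne_zero hcd) ?_)
  rw [mul_left_comm _ _ (divDiff c d _), divDiff_spec hab, divDiff_spec hcd]
  have h1 := divDiff_spec hcd f
  have h2 := divDiff_spec hab f
  have h3 := congrArg (rename (swap a b)) h1
  have h4 := congrArg (rename (swap c d)) h2
  have e := rename_swap_comm hac had hbc hbd f
  simp only [map_mul, map_sub, rename_X, swap_apply_of_ne_of_ne hac.symm hbc.symm,
    swap_apply_of_ne_of_ne had.symm hbd.symm, swap_apply_of_ne_of_ne hac had,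
    swap_apply_of_ne_of_ne hbc hbd] at h3 h4
  linear_combination h1 - h2 - h3 + h4 + e

theorem swap_braid {a b c : τ} (hab : a ≠ b) (hac : a ≠ c) (hbc : b ≠ c) :
    swap a b * swap b c * swap a b = swap b c * swap a b * swap b c := by
  ext x
  rcases eq_or_ne x a with rfl | ha
  · simp [swap_apply_of_ne_of_ne, *, hac.symm, hbc.symm]
  rcases eq_or_ne x b with rfl | hb
  · simp [swap_apply_of_ne_of_ne, *, hac.symm, hbc.symm]
  rcases eq_or_ne x c with rfl | hc
  · simp [swap_apply_of_ne_of_ne, *, hac.symm, hbc.symm]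
  · simp [swap_apply_of_ne_of_ne, *]

theorem rename_swap_braid {a b c : τ} (hab : a ≠ b) (hac : a ≠ c) (hbc : b ≠ c)
    (f : MvPolynomial τ ℤ) :
    rename (swap a b) (rename (swap b c) (rename (swap a b) f)) =
      rename (swap b c) (rename (swap a b) (rename (swap b c) f)) := by
  simp only [rename_rename]
  congr 1
  congr 1
  exact congrArg (fun w : Perm τ => (w : τ → τ)) (swap_braid hab hac hbc)

/-- Clearing denominators turns the triple divided difference into antisymmetrization over S₃. Only
the term of the longest element remembers which reduced word was used, so the braid relation for
permutations gives the one for divided differences. -/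
theorem divDiff_braid_aux {a b c : τ} (hab : a ≠ b) (hac : a ≠ c) (hbc : b ≠ c)
    (f : MvPolynomial τ ℤ) :
    (X a - X b) * (X a - X c) * (X b - X c) * divDiff a b (divDiff b c (divDiff a b f)) =
      f - rename (swap a b) f - rename (swap b c) f + rename (swap a b) (rename (swap b c) f)
      + rename (swap b c) (rename (swap a b) f)
      - rename (swap a b) (rename (swap b c) (rename (swap a b) f)) := by
  have h1 := divDiff_spec hab f
  have h2 := divDiff_spec hbc (divDiff a b f)
  have h3 := divDiff_spec hab (divDiff b c (divDiff a b f))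
  have h4 := congrArg (rename (swap a b)) h2
  have h5 := congrArg (rename (swap b c)) h1
  have h6 := congrArg (rename (swap a b)) h5
  have h7 := rename_swap_divDiff hab f
  have ea : swap b c a = a := swap_apply_of_ne_of_ne hab hac
  have ec : swap a b c = c := swap_apply_of_ne_of_ne hac.symm hbc.symm
  simp only [map_mul, map_sub, rename_X, ea, ec, swap_apply_left, swap_apply_right] at h4 h5 h6
  rw [h7] at h4
  linear_combination (X a - X c) * (X b - X c) * h3 + (X a - X c) * h2 - (X b - X c) * h4 + h1
    - h5 + h6

theorem divDiff_braid {a b c : τ} (hab : a ≠ b) (hac : a ≠ c) (hbc : b ≠ c)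
    (f : MvPolynomial τ ℤ) :
    divDiff a b (divDiff b c (divDiff a b f)) = divDiff b c (divDiff a b (divDiff b c f)) := by
  have h1 := divDiff_spec hbc f
  have h2 := divDiff_spec hab (divDiff b c f)
  have h3 := divDiff_spec hbc (divDiff a b (divDiff b c f))
  have h4 := congrArg (rename (swap b c)) h2
  have h5 := congrArg (rename (swap a b)) h1
  have h6 := congrArg (rename (swap b c)) h5
  have h7 := rename_swap_divDiff hbc f
  have ea : swap b c a = a := swap_apply_of_ne_of_ne hab hac
  have ec : swap a b c = c := swap_apply_of_ne_of_ne hac.symm hbc.symm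
  simp only [map_mul, map_sub, rename_X, ea, ec, swap_apply_left, swap_apply_right] at h4 h5 h6
  rw [h7] at h4
  have h8 := rename_swap_braid hab hac hbc f
  refine mul_left_cancel₀ (mul_ne_zero (mul_ne_zero (X_sub_X_ne_zero hab) (X_sub_X_ne_zero hac))
    (X_sub_X_ne_zero hbc)) ((divDiff_braid_aux hab hac hbc f).trans ?_)
  linear_combination -((X a - X c) * (X a - X b) * h3 + (X a - X c) * h2 - (X a - X b) * h4 + h1
    - h5 + h6) - h8

open Classical in
/-- The action on polynomials of the crossing of the strands `a` and `b`, labelled `i` and `j`. -/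
def crossOp (Γ : SimpleGraph I) (a b : τ) (i j : I) : MvPolynomial τ ℤ →ₗ[ℤ] MvPolynomial τ ℤ :=
  if i = j then divDiff a b
  else LinearMap.mulLeft ℤ (coef Γ i j a b) ∘ₗ (rename (swap a b)).toLinearMap

theorem crossOp_same (Γ : SimpleGraph I) (a b : τ) (i : I) (f : MvPolynomial τ ℤ) :
    crossOp Γ a b i i f = divDiff a b f := by
  rw [crossOp, if_pos rfl]

theorem crossOp_of_ne (Γ : SimpleGraph I) (a b : τ) {i j : I} (h : i ≠ j) (f : MvPolynomial τ ℤ) :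
    crossOp Γ a b i j f = coef Γ i j a b * rename (swap a b) f := by
  rw [crossOp, if_neg h]; rfl

theorem crossOp_sq_of_ne (Γ : SimpleGraph I) (a b : τ) {i j : I} (h : i ≠ j)
    (f : MvPolynomial τ ℤ) :
    crossOp Γ a b j i (crossOp Γ a b i j f) = coef Γ i j a b * coef Γ j i a b * f := by
  rw [crossOp_of_ne Γ a b h, crossOp_of_ne Γ a b h.symm, map_mul, rename_coef, rename_swap_swap,
    swap_apply_left, swap_apply_right, coef_comm Γ i j b a]
  ring

theorem crossOp_X (Γ : SimpleGraph I) {a b c : τ} (hca : c ≠ a) (hcb : c ≠ b) (hab : a ≠ b)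
    (i j : I) (f : MvPolynomial τ ℤ) :
    X c * crossOp Γ a b i j f = crossOp Γ a b i j (X c * f) := by
  have hc := swap_apply_of_ne_of_ne hca hcb
  rcases eq_or_ne i j with rfl | h
  · rw [crossOp_same, crossOp_same, divDiff_mul hab (by rw [rename_X, hc])]
  · rw [crossOp_of_ne Γ a b h, crossOp_of_ne Γ a b h, map_mul, rename_X, hc]
    ring

theorem crossOp_comm (Γ : SimpleGraph I) {a b c d : τ} (hab : a ≠ b) (hcd : c ≠ d) (hac : a ≠ c)
    (had : a ≠ d) (hbc : b ≠ c) (hbd : b ≠ d) (i j k l : I) (f : MvPolynomial τ ℤ) :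
    crossOp Γ a b i j (crossOp Γ c d k l f) = crossOp Γ c d k l (crossOp Γ a b i j f) := by
  have mixed {a b c d : τ} (hab : a ≠ b) (hcd : c ≠ d) (hac : a ≠ c)
      (had : a ≠ d) (hbc : b ≠ c) (hbd : b ≠ d) (i : I) {k l : I} (h : k ≠ l)
      (f : MvPolynomial τ ℤ) :
      crossOp Γ a b i i (crossOp Γ c d k l f) = crossOp Γ c d k l (crossOp Γ a b i i f) := by
    rw [crossOp_of_ne Γ c d h, crossOp_of_ne Γ c d h, crossOp_same, crossOp_same,
      divDiff_mul hab, rename_divDiff hab, swap_apply_of_ne_of_ne hac had,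
      swap_apply_of_ne_of_ne hbc hbd]
    rw [rename_coef, swap_apply_of_ne_of_ne hac.symm hbc.symm,
      swap_apply_of_ne_of_ne had.symm hbd.symm]
  rcases eq_or_ne i j with rfl | h1 <;> rcases eq_or_ne k l with rfl | h2
  · simp only [crossOp_same]
    exact divDiff_comm hab hcd hac had hbc hbd f
  · exact mixed hab hcd hac had hbc hbd i h2 f
  · exact (mixed hcd hab hac.symm hbc.symm had.symm hbd.symm k h1 f).symm
  · simp only [crossOp_of_ne Γ _ _ h1, crossOp_of_ne Γ _ _ h2, map_mul, rename_coef,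
      swap_apply_of_ne_of_ne hac.symm hbc.symm, swap_apply_of_ne_of_ne had.symm hbd.symm,
      swap_apply_of_ne_of_ne hac had, swap_apply_of_ne_of_ne hbc hbd]
    have e := rename_swap_comm hac had hbc hbd f
    rw [e]
    ring

/-- The triple crossing relations, except for the labels `i`, `j`, `i`. -/
theorem crossOp_braid (Γ : SimpleGraph I) {a b c : τ} (hab : a ≠ b) (hac : a ≠ c) (hbc : b ≠ c)
    (i j k : I) (h : i ≠ k ∨ i = j) (f : MvPolynomial τ ℤ) :
    crossOp Γ a b j k (crossOp Γ b c i k (crossOp Γ a b i j f)) =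
      crossOp Γ b c i j (crossOp Γ a b i k (crossOp Γ b c j k f)) := by
  have ea : swap b c a = a := swap_apply_of_ne_of_ne hab hac
  have ec : swap a b c = c := swap_apply_of_ne_of_ne hac.symm hbc.symm
  rcases eq_or_ne i j with rfl | hij
  · rcases eq_or_ne i k with rfl | hik
    · simp only [crossOp_same]
      exact divDiff_braid hab hac hbc f
    · simp only [crossOp_same, crossOp_of_ne Γ _ _ hik, map_mul, rename_coef, ea, ec,
        swap_apply_left, swap_apply_right, rename_divDiff hab]
      -- The product of the two coefficients is symmetric in `b` and `c`, so it may leave the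
      -- divided difference.
      rw [← mul_assoc, ← mul_assoc, divDiff_mul hbc]
      · rw [rename_divDiff hac, swap_apply_left, ec]
      · simp only [map_mul, rename_coef, ea, swap_apply_left, swap_apply_right]
        ring
  · have hik : i ≠ k := h.resolve_right hij
    rcases eq_or_ne j k with rfl | hjk
    · simp only [crossOp_same, crossOp_of_ne Γ _ _ hik, map_mul, rename_coef, ea, ec,
        swap_apply_left, swap_apply_right, rename_divDiff hbc]
      rw [← mul_assoc, ← mul_assoc, divDiff_mul hab]
      · rw [rename_divDiff hac, swap_apply_right, ea]
      · simp only [map_mul, rename_coef, ec, swap_apply_left, swap_apply_right]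
        ring
    · simp only [crossOp_of_ne Γ _ _ hik, crossOp_of_ne Γ _ _ hij, crossOp_of_ne Γ _ _ hjk,
        map_mul, rename_coef, ea, ec, swap_apply_left, swap_apply_right]
      rw [rename_swap_braid hab hac hbc]
      ring

/-- The triple crossing relations for the labels `i`, `j`, `i`. -/
theorem crossOp_braid_sub (Γ : SimpleGraph I) {a b c : τ} (hab : a ≠ b) (hac : a ≠ c) (hbc : b ≠ c)
    {i j : I} (hij : i ≠ j) (f : MvPolynomial τ ℤ) :
    (X a - X c) * (crossOp Γ a b j i (crossOp Γ b c i i (crossOp Γ a b i j f)) -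
      crossOp Γ b c i j (crossOp Γ a b i i (crossOp Γ b c j i f))) =
      (coef Γ i j a b * coef Γ j i a b - coef Γ i j b c * coef Γ j i b c) * f := by
  have ea : swap b c a = a := swap_apply_of_ne_of_ne hab hac
  have ec : swap a b c = c := swap_apply_of_ne_of_ne hac.symm hbc.symm
  simp only [crossOp_same, crossOp_of_ne Γ _ _ hij, crossOp_of_ne Γ _ _ hij.symm, map_mul,
    rename_coef, ea, ec, swap_apply_left, swap_apply_right, rename_divDiff hab, rename_divDiff hbc,
    rename_swap_swap]
  have h1 := divDiff_spec hac (coef Γ i j b a * f)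
  have h2 := divDiff_spec hac (coef Γ j i c b * f)
  have eb : swap a c b = b := swap_apply_of_ne_of_ne hab.symm hbc
  simp only [map_mul, rename_coef, eb, swap_apply_left, swap_apply_right] at h1 h2
  rw [coef_comm Γ i j b c, coef_comm Γ i j b a] at *
  rw [coef_comm Γ j i c b] at h2 ⊢
  linear_combination coef Γ j i a b * h1 - coef Γ i j c b * h2

end Operators

end KLR

end

noncomputable section

/-! ### The action of `R(ν)` on `Pol(ν)` -/

namespace KLR

universe u

variable {I : Type u}

section Representation

open MvPolynomial Equiv

variable {Γ : SimpleGraph I} {ν : I →₀ ℕ}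

theorem Seq.smul_apply (w : Perm (Fin (size ν))) (s : Seq ν) (x : Fin (size ν)) :
    (w • s) x = s (w⁻¹ x) := rfl

theorem Seq.swap_swap_smul (a b : Fin (size ν)) (s : Seq ν) : swap a b • swap a b • s = s := by
  rw [smul_smul, swap_mul_self, one_smul]

theorem Seq.swap_smul_of_eq {a b : Fin (size ν)} {s : Seq ν} (h : s a = s b) :
    swap a b • s = s := by
  refine Subtype.ext (funext fun x => ?_)
  change s ((swap a b)⁻¹ x) = s x
  rw [swap_inv]
  rcases eq_or_ne x a with rfl | ha
  · rw [swap_apply_left, h]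
  rcases eq_or_ne x b with rfl | hb
  · rw [swap_apply_right, h]
  · rw [swap_apply_of_ne_of_ne ha hb]

instance : DecidableEq (Seq ν) := Classical.decEq _

/-- The endomorphism of `Pol(ν)` that takes the component at `s` to the component at `t` by `F`. -/
def block (s t : Seq ν)
    (F : MvPolynomial (Fin (size ν)) ℤ →ₗ[ℤ] MvPolynomial (Fin (size ν)) ℤ) :
    Module.End ℤ (Pol ν) :=
  LinearMap.single ℤ (fun _ : Seq ν => MvPolynomial (Fin (size ν)) ℤ) t ∘ₗ F ∘ₗ LinearMap.proj s

variable {F G : MvPolynomial (Fin (size ν)) ℤ →ₗ[ℤ] MvPolynomial (Fin (size ν)) ℤ}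

theorem block_apply (s t : Seq ν) (f : Pol ν) : block s t F f = Pi.single t (F (f s)) := rfl

theorem block_mul (s t r : Seq ν) : block t r G * block s t F = block s r (G ∘ₗ F) := by
  refine LinearMap.ext fun f => ?_
  rw [Module.End.mul_apply, block_apply, block_apply, block_apply, Pi.single_eq_same]
  rfl

theorem block_mul_of_ne {s t t' r : Seq ν} (h : t ≠ t') : block t' r G * block s t F = 0 := by
  refine LinearMap.ext fun f => ?_
  rw [Module.End.mul_apply, block_apply, block_apply, Pi.single_eq_of_ne' h]
  simp

theorem block_add (s t : Seq ν) : block s t (G + F) = block s t G + block s t F := by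
  simp only [block, LinearMap.comp_add, LinearMap.add_comp]

theorem block_sub (s t : Seq ν) : block s t (G - F) = block s t G - block s t F := by
  simp only [block, LinearMap.comp_sub, LinearMap.sub_comp]

theorem block_zero (s t : Seq ν) : block s t 0 = 0 := by
  simp only [block, LinearMap.comp_zero, LinearMap.zero_comp]

theorem sum_block : ∑ s : Seq ν, block s s LinearMap.id = 1 := by
  refine LinearMap.ext fun f => ?_
  rw [LinearMap.sum_apply]
  simp only [block_apply, LinearMap.id_apply]
  exact Finset.univ_sum_single f

/-- Multiplication by a polynomial. -/
abbrev mulBy (p : MvPolynomial (Fin (size ν)) ℤ) :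
    MvPolynomial (Fin (size ν)) ℤ →ₗ[ℤ] MvPolynomial (Fin (size ν)) ℤ := LinearMap.mulLeft ℤ p

variable (Γ)

/-- The action of the elementary diagrams on `Pol(ν)`. -/
def genOp : Gen ν → Module.End ℤ (Pol ν)
  | .idem s => block s s LinearMap.id
  | .dot a s => block s s (mulBy (X a))
  | .cross a b _ s => block s (swap a b • s) (crossOp Γ a b (s a) (s b))

theorem cartan_same (i : I) : cartan Γ i i = 2 := if_pos rfl

variable {Γ}

theorem cartan_eq_zero {i j : I} (h : cartan Γ i j = 0) : i ≠ j ∧ ¬ Γ.Adj i j := by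
  unfold cartan at h
  by_cases h1 : i = j
  · simp [h1] at h
  · by_cases h2 : Γ.Adj i j
    · simp [h1, h2] at h
    · exact ⟨h1, h2⟩

theorem cartan_eq_neg_one {i j : I} : cartan Γ i j = -1 ↔ Γ.Adj i j := by
  unfold cartan
  constructor
  · intro h
    split_ifs at h with h1 h2
    exact h2
  · intro h
    rw [if_neg h.ne, if_pos h]

/-- Apart from the relations among the idempotents, both sides map one component to one component,
so each relation reduces to an identity of operators on a single polynomial ring. The end sequences
are matched first, because they are equal only as products of transpositions. -/
theorem genOp_rel {x y : FreeAlgebra ℤ (Gen ν)} (h : Rel Γ ν x y) :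
    FreeAlgebra.lift ℤ (genOp Γ) x = FreeAlgebra.lift ℤ (genOp Γ) y := by
  have ne {a b : Fin (size ν)} (h : a.val + 1 = b.val) : a ≠ b := fun e => by
    rw [e] at h; omega
  cases h with
  | idem_mul_self i => simp [genOp, block_mul]
  | idem_mul_of_ne i j hij => simp [genOp, block_mul_of_ne hij.symm]
  | sum_idem => simpa [genOp] using sum_block
  | idem_mul_dot a i => simp [genOp, block_mul]
  | dot_mul_idem a i => simp [genOp, block_mul]
  | idem_mul_cross a b h i => simp [genOp, block_mul]
  | cross_mul_idem a b h i => simp [genOp, block_mul]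
  | dot_mul_dot a b i =>
    simp only [map_mul, FreeAlgebra.lift_ι_apply, genOp, block_mul]
    congr 1
    refine LinearMap.ext fun f => ?_
    simp [mul_left_comm]
  | dot_mul_cross_far a b c h i hca hcb =>
    simp only [map_mul, FreeAlgebra.lift_ι_apply, genOp, block_mul]
    congr 1
    refine LinearMap.ext fun f => ?_
    exact crossOp_X Γ hca hcb (ne h) _ _ f
  | cross_mul_cross_far a b c d h h' hbc i =>
    have hab : a < b := Fin.lt_def.2 (by omega)
    have hcd : c < d := Fin.lt_def.2 (by omega)
    have hac := (hab.trans hbc).ne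
    have hbd := (hbc.trans hcd).ne
    have had := (hab.trans (hbc.trans hcd)).ne
    simp only [map_mul, FreeAlgebra.lift_ι_apply, genOp, block_mul]
    have e : swap c d • swap a b • i = swap a b • swap c d • i := by
      refine Subtype.ext (funext fun x => ?_)
      change i ((swap a b)⁻¹ ((swap c d)⁻¹ x)) = i ((swap c d)⁻¹ ((swap a b)⁻¹ x))
      exact congrArg i.1 (DFunLike.congr_fun (Equiv.Perm.disjoint_swap_swap (x := a) (y := b)
        (z := c) (t := d) (by simp [hab.ne, hac, hbd, had, hbc.ne, hcd.ne])).commute.eq x)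
    rw [e]
    congr 1
    refine LinearMap.ext fun f => ?_
    simp only [LinearMap.comp_apply, Seq.smul_apply, swap_inv]
    rw [swap_apply_of_ne_of_ne hac had, swap_apply_of_ne_of_ne hbc.ne hbd,
      swap_apply_of_ne_of_ne hac.symm hbc.ne', swap_apply_of_ne_of_ne had.symm hbd.symm]
    exact crossOp_comm Γ hab.ne hcd.ne hac had hbc.ne hbd _ _ _ _ f
  | cross_sq_same a b h i hi =>
    simp only [map_mul, FreeAlgebra.lift_ι_apply, genOp, block_mul, map_zero]
    rw [Seq.swap_swap_smul, ← block_zero i i]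
    congr 1
    refine LinearMap.ext fun f => ?_
    simp only [LinearMap.comp_apply, Seq.smul_apply, swap_inv, swap_apply_left, swap_apply_right,
      hi, crossOp_same]
    exact divDiff_divDiff (ne h) f
  | cross_sq_zero a b h i hi =>
    simp only [map_mul, FreeAlgebra.lift_ι_apply, genOp, block_mul]
    rw [Seq.swap_swap_smul]
    congr 1
    refine LinearMap.ext fun f => ?_
    obtain ⟨h1, h2⟩ := cartan_eq_zero hi
    simp only [LinearMap.comp_apply, Seq.smul_apply, swap_inv, swap_apply_left, swap_apply_right]
    rw [crossOp_sq_of_ne Γ a b h1, coef_mul_of_not_adj h2, one_mul]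
    rfl
  | cross_sq_edge a b h i hi =>
    simp only [map_mul, map_add, FreeAlgebra.lift_ι_apply, genOp, block_mul]
    rw [Seq.swap_swap_smul, ← block_add]
    congr 1
    refine LinearMap.ext fun f => ?_
    have h1 := cartan_eq_neg_one.1 hi
    simp only [LinearMap.comp_apply, Seq.smul_apply, swap_inv, swap_apply_left, swap_apply_right]
    rw [crossOp_sq_of_ne Γ a b h1.ne, coef_mul_of_adj h1]
    simp [add_mul]
  | slide_ne_left a b h i hi =>
    simp only [map_mul, FreeAlgebra.lift_ι_apply, genOp, block_mul]
    congr 1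
    refine LinearMap.ext fun f => ?_
    simp only [LinearMap.comp_apply, crossOp_of_ne Γ _ _ hi, LinearMap.mulLeft_apply, map_mul,
      rename_X, swap_apply_right]
    ring
  | slide_ne_right a b h i hi =>
    simp only [map_mul, FreeAlgebra.lift_ι_apply, genOp, block_mul]
    congr 1
    refine LinearMap.ext fun f => ?_
    simp only [LinearMap.comp_apply, crossOp_of_ne Γ _ _ hi, LinearMap.mulLeft_apply, map_mul,
      rename_X, swap_apply_left]
    ring
  | slide_same_left a b h i hi =>
    simp only [map_mul, map_sub, FreeAlgebra.lift_ι_apply, genOp, block_mul]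
    rw [Seq.swap_smul_of_eq hi, ← block_sub]
    congr 1
    refine LinearMap.ext fun f => ?_
    simp only [LinearMap.sub_apply, LinearMap.comp_apply, hi, crossOp_same, LinearMap.mulLeft_apply]
    exact divDiff_left (ne h) f
  | slide_same_right a b h i hi =>
    simp only [map_mul, map_sub, FreeAlgebra.lift_ι_apply, genOp, block_mul]
    rw [Seq.swap_smul_of_eq hi, ← block_sub]
    congr 1
    refine LinearMap.ext fun f => ?_
    simp only [LinearMap.sub_apply, LinearMap.comp_apply, hi, crossOp_same, LinearMap.mulLeft_apply]
    exact divDiff_right (ne h) f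
  | braid_easy a b c h h' i hi =>
    have hac : a ≠ c := fun e => by rw [e] at h; omega
    have e : swap b c • swap a b • swap b c • i = swap a b • swap b c • swap a b • i := by
      rw [smul_smul, smul_smul, smul_smul, smul_smul, swap_braid (ne h) hac (ne h')]
    simp only [map_mul, FreeAlgebra.lift_ι_apply, genOp, block_mul]
    rw [e]
    by_cases hh : i a ≠ i c ∨ i a = i b
    · congr 1
      refine LinearMap.ext fun f => ?_
      simp only [LinearMap.comp_apply, Seq.smul_apply, swap_inv, swap_apply_left, swap_apply_right,
        swap_apply_of_ne_of_ne (ne h) hac, swap_apply_of_ne_of_ne hac.symm (ne h').symm]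
      exact crossOp_braid Γ (ne h) hac (ne h') _ _ _ hh f
    -- The remaining labels are `i, j, i` with `i ≠ j` not joined: both coefficient products in
    -- `crossOp_braid_sub` are then 1 and the difference vanishes.
    · push Not at hh
      congr 1
      refine LinearMap.ext fun f => ?_
      simp only [LinearMap.comp_apply, Seq.smul_apply, swap_inv, swap_apply_left, swap_apply_right,
        swap_apply_of_ne_of_ne (ne h) hac, swap_apply_of_ne_of_ne hac.symm (ne h').symm]
      have h1 := crossOp_braid_sub Γ (ne h) hac (ne h') hh.2 f
      have h2 : ¬ Γ.Adj (i a) (i b) := fun h3 => hi ⟨hh.1, cartan_eq_neg_one.2 h3⟩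
      rw [coef_mul_of_not_adj h2, coef_mul_of_not_adj h2, sub_self, zero_mul] at h1
      rw [← hh.1]
      exact sub_eq_zero.1 ((mul_eq_zero.1 h1).resolve_left (X_sub_X_ne_zero hac))
  | braid_hard a b c h h' i hi hi' =>
    have hac : a ≠ c := fun e => by rw [e] at h; omega
    have e : swap b c • swap a b • swap b c • i = swap a b • swap b c • swap a b • i := by
      rw [smul_smul, smul_smul, smul_smul, smul_smul, swap_braid (ne h) hac (ne h')]
    have e' : swap a b • swap b c • swap a b • i = i := by
      refine Subtype.ext (funext fun x => ?_)
      simp only [Seq.smul_apply]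
      change i ((swap a b)⁻¹ ((swap b c)⁻¹ ((swap a b)⁻¹ x))) = i x
      simp only [swap_inv]
      rcases eq_or_ne x a with rfl | ha
      · simp [hi, swap_apply_of_ne_of_ne hac.symm (ne h').symm]
      rcases eq_or_ne x b with rfl | hb
      · simp [swap_apply_of_ne_of_ne (ne h) hac]
      rcases eq_or_ne x c with rfl | hc
      · simp [swap_apply_of_ne_of_ne ha hb, hi]
      · simp [swap_apply_of_ne_of_ne ha hb, swap_apply_of_ne_of_ne hb hc]
    simp only [map_mul, map_sub, FreeAlgebra.lift_ι_apply, genOp, block_mul]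
    rw [e, e', ← block_sub]
    congr 1
    refine LinearMap.ext fun f => ?_
    simp only [LinearMap.sub_apply, LinearMap.comp_apply, Seq.smul_apply, swap_inv, swap_apply_left,
      swap_apply_right,
      swap_apply_of_ne_of_ne (ne h) hac, swap_apply_of_ne_of_ne hac.symm (ne h').symm]
    have h3 := cartan_eq_neg_one.1 hi'
    have h1 := crossOp_braid_sub Γ (ne h) hac (ne h') h3.ne f
    -- (x_a + x_b) - (x_b + x_c) = x_a - x_c is exactly the factor to be cancelled, which leaves the
    -- identity operator.
    rw [coef_mul_of_adj h3, coef_mul_of_adj h3, add_sub_add_comm, sub_add_sub_cancel] at h1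
    rw [← hi]
    exact mul_left_cancel₀ (X_sub_X_ne_zero hac) h1

variable (Γ ν) in
/-- The polynomial representation of `R(ν)`. -/
def rho : R Γ ν →+* Module.End ℤ (Pol ν) :=
  RingQuot.lift (⟨(FreeAlgebra.lift ℤ (genOp Γ)).toRingHom, fun _ _ h => genOp_rel h⟩ :
    {f : FreeAlgebra ℤ (Gen ν) →+* Module.End ℤ (Pol ν) // ∀ ⦃x y⦄, Rel Γ ν x y → f x = f y})

theorem rho_gen (g : Gen ν) : rho Γ ν (gen Γ ν g) = genOp Γ g := by
  have : rho Γ ν (gen Γ ν g) =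
    (FreeAlgebra.lift ℤ (genOp Γ)).toRingHom (FreeAlgebra.ι ℤ g) := RingQuot.lift_mkRingHom_apply _ _ _
  rw [this]
  simp

theorem polToR_apply (f : Pol ν) : polToR Γ ν f = ((∑ s, pIdem Γ s *
    eval₂ (Int.castRingHom (polClosure Γ ν)) (fun a => pDot Γ a s) (f s) : polClosure Γ ν) :
    R Γ ν) := rfl

theorem rho_polToR (f g : Pol ν) : rho Γ ν (polToR Γ ν f) g = f * g := by
  have key (s : Seq ν) (p : MvPolynomial (Fin (size ν)) ℤ) :
      rho Γ ν ((pIdem Γ s * eval₂ (Int.castRingHom (polClosure Γ ν)) (fun a => pDot Γ a s) p :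
        polClosure Γ ν) : R Γ ν) = block s s (mulBy p) := by
    induction p using MvPolynomial.induction_on with
    | C r =>
      rw [eval₂_C, eq_intCast, mul_comm, ← zsmul_eq_mul, AddSubgroupClass.coe_zsmul, map_zsmul]
      change r • rho Γ ν (gen Γ ν (.idem s)) = _
      rw [rho_gen]
      refine LinearMap.ext fun f => ?_
      simp only [genOp, LinearMap.smul_apply, block_apply, LinearMap.id_apply,
        LinearMap.mulLeft_apply, C_mul']
      exact (Pi.single_smul' s r (f s)).symm
    | add p q hp hq =>
      rw [eval₂_add, mul_add, Subring.coe_add, map_add, hp, hq, ← block_add]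
      congr 1
      refine LinearMap.ext fun f => ?_
      simp [add_mul]
    | mul_X p a hp =>
      rw [eval₂_mul, eval₂_X, ← mul_assoc, Subring.coe_mul, map_mul, hp]
      change _ * rho Γ ν (gen Γ ν (.dot a s)) = _
      rw [rho_gen, genOp, block_mul]
      congr 1
      refine LinearMap.ext fun f => ?_
      simp
  rw [polToR_apply, AddSubmonoidClass.coe_finsetSum, map_sum, LinearMap.sum_apply]
  simp only [key, block_apply]
  exact Finset.univ_sum_single (f * g)

/-- An element f is recovered from its action as f·1. -/
theorem polToR_injective : Function.Injective (polToR Γ ν) := fun f g h => by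
  have := congrArg (fun x => rho Γ ν x 1) h
  simpa only [rho_polToR, mul_one] using this

end Representation

end KLR

end

noncomputable section

/-! ### Spanning of `R(ν)` by normal forms over `Pol(ν)` -/

namespace KLR

universe u

variable {I : Type u}

section Crossings

open MvPolynomial Equiv

variable {Γ : SimpleGraph I} {ν : I →₀ ℕ}

variable (Γ) in
/-- The element `δ_{a,i}` of `R(ν)`. -/
def cross (a b : Fin (size ν)) (h : a.val + 1 = b.val) (s : Seq ν) : R Γ ν :=
  gen Γ ν (.cross a b h s)

/-! ### The defining relations as equations in R(ν), and total crossings -/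

section Relations

variable {a b c d : Fin (size ν)} (h : a.val + 1 = b.val) (s : Seq ν)

theorem idem_mul_cross : idem Γ (swap a b • s) * cross Γ a b h s = cross Γ a b h s := by
  simpa [idem, cross, gen] using mk_rel (Rel.idem_mul_cross (Γ := Γ) a b h s)

theorem cross_mul_idem : cross Γ a b h s * idem Γ s = cross Γ a b h s := by
  simpa [idem, cross, gen] using mk_rel (Rel.cross_mul_idem (Γ := Γ) a b h s)

theorem dot_mul_cross_far (hca : c ≠ a) (hcb : c ≠ b) :
    dot Γ c (swap a b • s) * cross Γ a b h s = cross Γ a b h s * dot Γ c s := by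
  simpa [dot, cross, gen] using mk_rel (Rel.dot_mul_cross_far (Γ := Γ) a b c h s hca hcb)

theorem cross_mul_cross_far (h' : c.val + 1 = d.val) (hbc : b < c) :
    cross Γ a b h (swap c d • s) * cross Γ c d h' s =
      cross Γ c d h' (swap a b • s) * cross Γ a b h s := by
  simpa [cross, gen] using mk_rel (Rel.cross_mul_cross_far (Γ := Γ) a b c d h h' hbc s)

theorem cross_sq_same (hi : s a = s b) :
    cross Γ a b h (swap a b • s) * cross Γ a b h s = 0 := by
  simpa [cross, gen] using mk_rel (Rel.cross_sq_same (Γ := Γ) a b h s hi)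

theorem cross_sq_zero (hi : cartan Γ (s a) (s b) = 0) :
    cross Γ a b h (swap a b • s) * cross Γ a b h s = idem Γ s := by
  simpa [cross, idem, gen] using mk_rel (Rel.cross_sq_zero (Γ := Γ) a b h s hi)

theorem cross_sq_edge (hi : cartan Γ (s a) (s b) = -1) :
    cross Γ a b h (swap a b • s) * cross Γ a b h s = dot Γ a s + dot Γ b s := by
  simpa [cross, dot, gen] using mk_rel (Rel.cross_sq_edge (Γ := Γ) a b h s hi)

theorem slide_ne_left (hi : s a ≠ s b) :
    dot Γ a (swap a b • s) * cross Γ a b h s = cross Γ a b h s * dot Γ b s := by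
  simpa [cross, dot, gen] using mk_rel (Rel.slide_ne_left (Γ := Γ) a b h s hi)

theorem slide_ne_right (hi : s a ≠ s b) :
    dot Γ b (swap a b • s) * cross Γ a b h s = cross Γ a b h s * dot Γ a s := by
  simpa [cross, dot, gen] using mk_rel (Rel.slide_ne_right (Γ := Γ) a b h s hi)

theorem slide_same_left (hi : s a = s b) :
    dot Γ a (swap a b • s) * cross Γ a b h s - cross Γ a b h s * dot Γ b s = idem Γ s := by
  simpa [cross, dot, idem, gen] using mk_rel (Rel.slide_same_left (Γ := Γ) a b h s hi)

theorem slide_same_right (hi : s a = s b) :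
    cross Γ a b h s * dot Γ a s - dot Γ b (swap a b • s) * cross Γ a b h s = idem Γ s := by
  simpa [cross, dot, idem, gen] using mk_rel (Rel.slide_same_right (Γ := Γ) a b h s hi)

theorem braid_easy (h' : b.val + 1 = c.val)
    (hi : ¬ (s a = s c ∧ cartan Γ (s a) (s b) = -1)) :
    cross Γ a b h (swap b c • swap a b • s) * cross Γ b c h' (swap a b • s) * cross Γ a b h s =
      cross Γ b c h' (swap a b • swap b c • s) * cross Γ a b h (swap b c • s) *
        cross Γ b c h' s := by
  simpa [cross, gen] using mk_rel (Rel.braid_easy (Γ := Γ) a b c h h' s hi)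

theorem braid_hard (h' : b.val + 1 = c.val) (hi : s a = s c) (hi' : cartan Γ (s a) (s b) = -1) :
    cross Γ a b h (swap b c • swap a b • s) * cross Γ b c h' (swap a b • s) * cross Γ a b h s -
      cross Γ b c h' (swap a b • swap b c • s) * cross Γ a b h (swap b c • s) *
        cross Γ b c h' s = idem Γ s := by
  simpa [cross, idem, gen] using mk_rel (Rel.braid_hard (Γ := Γ) a b c h h' s hi hi')

theorem idem_mul_cross_of_ne {t : Seq ν} (ht : t ≠ swap a b • s) :
    idem Γ t * cross Γ a b h s = 0 := by
  rw [← idem_mul_cross, ← mul_assoc, idem_mul_of_ne ht, zero_mul]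

theorem cross_mul_idem_of_ne {t : Seq ν} (ht : s ≠ t) :
    cross Γ a b h s * idem Γ t = 0 := by
  rw [← cross_mul_idem, mul_assoc, idem_mul_of_ne ht, mul_zero]

variable (Γ) in
/-- The sum over all sequences of the crossings of the strands `a` and `b`. -/
def totalCross (h : a.val + 1 = b.val) : R Γ ν := ∑ s, cross Γ a b h s

theorem totalCross_mul_idem : totalCross Γ h * idem Γ s = cross Γ a b h s := by
  rw [totalCross, Finset.sum_mul, Finset.sum_eq_single s, cross_mul_idem]
  · intro t _ hts
    exact cross_mul_idem_of_ne h t hts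
  · simp

theorem idem_mul_totalCross : idem Γ (swap a b • s) * totalCross Γ h = cross Γ a b h s := by
  rw [totalCross, Finset.mul_sum, Finset.sum_eq_single s, idem_mul_cross]
  · intro t _ hts
    exact idem_mul_cross_of_ne h t fun e => hts (MulAction.injective _ e).symm
  · simp

theorem totalCross_mul_cross (h' : c.val + 1 = d.val) :
    totalCross Γ h * cross Γ c d h' s = cross Γ a b h (swap c d • s) * cross Γ c d h' s := by
  rw [← idem_mul_cross h' s, ← mul_assoc, totalCross_mul_idem, idem_mul_cross]

end Relations

theorem induction_gen {p : R Γ ν → Prop} (int : ∀ r : ℤ, p r) (gen : ∀ g, p (gen Γ ν g))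
    (mul : ∀ x y, p x → p y → p (x * y)) (add : ∀ x y, p x → p y → p (x + y)) (x : R Γ ν) :
    p x := by
  obtain ⟨y, rfl⟩ : ∃ y, mk Γ ν y = x := RingQuot.mkRingHom_surjective (Rel Γ ν) x
  induction y using FreeAlgebra.induction with
  | grade0 r => rw [eq_intCast, map_intCast]; exact int r
  | grade1 g => exact gen g
  | mul x y hx hy => rw [map_mul]; exact mul _ _ hx hy
  | add x y hx hy => rw [map_add]; exact add _ _ hx hy

theorem eq_of_mul_idem {x y : R Γ ν} (h : ∀ s, x * idem Γ s = y * idem Γ s) : x = y := by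
  rw [← mul_one x, ← mul_one y, ← sum_idem, Finset.mul_sum, Finset.mul_sum]
  exact Finset.sum_congr rfl fun s _ => h s

variable (Γ ν) in
/-- The image of `Pol(ν)` in `R(ν)`. -/
def polPart : Submodule ℤ (R Γ ν) := AddSubgroup.toIntSubmodule (polClosure Γ ν).toAddSubgroup

theorem mem_polPart {x : R Γ ν} : x ∈ polPart Γ ν ↔ x ∈ polClosure Γ ν := Iff.rfl

theorem idem_mem (s : Seq ν) : idem Γ s ∈ polClosure Γ ν :=
  Subring.subset_closure (Or.inl ⟨s, rfl⟩)

theorem dot_mem (a : Fin (size ν)) (s : Seq ν) : dot Γ a s ∈ polClosure Γ ν :=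
  Subring.subset_closure (Or.inr ⟨(a, s), rfl⟩)

theorem mem_of_mul_idem {x : R Γ ν} (h : ∀ s, x * idem Γ s ∈ polClosure Γ ν) :
    x ∈ polClosure Γ ν := by
  rw [← mul_one x, ← sum_idem, Finset.mul_sum]
  exact sum_mem fun s _ => h s

theorem polToR_single (s : Seq ν) (p : MvPolynomial (Fin (size ν)) ℤ) :
    polToR Γ ν (Pi.single s p) = ((pIdem Γ s *
      eval₂ (Int.castRingHom (polClosure Γ ν)) (fun a => pDot Γ a s) p : polClosure Γ ν) :
      R Γ ν) := by
  rw [polToR_apply]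
  congr 1
  rw [Finset.sum_eq_single s, Pi.single_eq_same]
  · intro t _ hts
    rw [Pi.single_eq_of_ne hts, eval₂_zero, mul_zero]
  · simp

theorem polToR_single_one (s : Seq ν) : polToR Γ ν (Pi.single s 1) = idem Γ s := by
  rw [polToR_single, eval₂_one, mul_one]; rfl

theorem polToR_single_X (a : Fin (size ν)) (s : Seq ν) :
    polToR Γ ν (Pi.single s (X a)) = dot Γ a s := by
  rw [polToR_single, eval₂_X]
  exact idem_mul_dot a s

theorem mem_polClosure {x : R Γ ν} : x ∈ polClosure Γ ν ↔ ∃ f, polToR Γ ν f = x := by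
  constructor
  · intro h
    have : polClosure Γ ν ≤ (polToR Γ ν).range := by
      rw [Subring.closure_le]
      rintro _ (⟨s, rfl⟩ | ⟨⟨a, s⟩, rfl⟩)
      · exact ⟨_, polToR_single_one s⟩
      · exact ⟨_, polToR_single_X a s⟩
    exact this h
  · rintro ⟨f, rfl⟩
    exact Subtype.prop _

theorem dot_slide {a b : Fin (size ν)} (h : a.val + 1 = b.val) (c : Fin (size ν)) (s : Seq ν) :
    cross Γ a b h s * dot Γ c s - dot Γ (swap a b c) (swap a b • s) * cross Γ a b h s ∈
      polClosure Γ ν := by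
  rcases eq_or_ne c a with rfl | ha
  · rw [swap_apply_left]
    by_cases hs : s c = s b
    · rw [slide_same_right h s hs]; exact idem_mem s
    · rw [slide_ne_right h s hs, sub_self]; exact zero_mem _
  rcases eq_or_ne c b with rfl | hb
  · rw [swap_apply_right]
    by_cases hs : s a = s c
    · rw [← neg_sub, slide_same_left h s hs]; exact neg_mem (idem_mem s)
    · rw [slide_ne_left h s hs, sub_self]; exact zero_mem _
  · rw [swap_apply_of_ne_of_ne ha hb, dot_mul_cross_far h s ha hb, sub_self]
    exact zero_mem _

/-- The witness is x with strands and labels swapped. Elements admitting a witness are closed under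
products because δxy - x'y'δ = (δx - x'δ)y + x'(δy - y'δ), so the dot slides suffice. -/
theorem totalCross_left {a b : Fin (size ν)} (h : a.val + 1 = b.val) {x : R Γ ν}
    (hx : x ∈ polClosure Γ ν) : ∃ y ∈ polClosure Γ ν,
      totalCross Γ h * x - y * totalCross Γ h ∈ polClosure Γ ν := by
  induction hx using Subring.closure_induction with
  | mem x hx =>
    rcases hx with ⟨s, rfl⟩ | ⟨⟨c, s⟩, rfl⟩
    · refine ⟨idem Γ (swap a b • s), idem_mem _, ?_⟩
      rw [totalCross_mul_idem, idem_mul_totalCross, sub_self]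
      exact zero_mem _
    · refine ⟨dot Γ (swap a b c) (swap a b • s), dot_mem _ _, ?_⟩
      have h1 : totalCross Γ h * dot Γ c s = cross Γ a b h s * dot Γ c s := by
        rw [← idem_mul_dot, ← mul_assoc, totalCross_mul_idem, idem_mul_dot]
      have h2 (e : Fin (size ν)) : dot Γ e (swap a b • s) * totalCross Γ h =
          dot Γ e (swap a b • s) * cross Γ a b h s := by
        rw [← dot_mul_idem, mul_assoc, idem_mul_totalCross, dot_mul_idem]
      change totalCross Γ h * dot Γ c s - _ ∈ _
      rw [h1, h2]
      exact dot_slide h c s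
  | zero => exact ⟨0, zero_mem _, by simp⟩
  | one => exact ⟨1, one_mem _, by simp⟩
  | add x y hx hy ihx ihy =>
    obtain ⟨x', hx', h1⟩ := ihx
    obtain ⟨y', hy', h2⟩ := ihy
    refine ⟨x' + y', add_mem hx' hy', ?_⟩
    convert add_mem h1 h2 using 1
    noncomm_ring
  | neg x hx ih =>
    obtain ⟨x', hx', h1⟩ := ih
    refine ⟨-x', neg_mem hx', ?_⟩
    convert neg_mem h1 using 1
    noncomm_ring
  | mul x y hx hy ihx ihy =>
    obtain ⟨x', hx', h1⟩ := ihx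
    obtain ⟨y', hy', h2⟩ := ihy
    refine ⟨x' * y', mul_mem hx' hy', ?_⟩
    convert add_mem (mul_mem h1 hy) (mul_mem hx' h2) using 1
    noncomm_ring

theorem totalCross_right {a b : Fin (size ν)} (h : a.val + 1 = b.val) {x : R Γ ν}
    (hx : x ∈ polClosure Γ ν) : ∃ y ∈ polClosure Γ ν,
      x * totalCross Γ h - totalCross Γ h * y ∈ polClosure Γ ν := by
  induction hx using Subring.closure_induction with
  | mem x hx =>
    rcases hx with ⟨s, rfl⟩ | ⟨⟨c, s⟩, rfl⟩
    · refine ⟨idem Γ (swap a b • s), idem_mem _, ?_⟩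
      rw [totalCross_mul_idem, ← idem_mul_totalCross, Seq.swap_swap_smul, sub_self]
      exact zero_mem _
    · refine ⟨dot Γ (swap a b c) (swap a b • s), dot_mem _ _, ?_⟩
      have := neg_mem (dot_slide (Γ := Γ) h (swap a b c) (swap a b • s))
      rw [swap_apply_self, Seq.swap_swap_smul, neg_sub] at this
      have h1 : totalCross Γ h * dot Γ (swap a b c) (swap a b • s) =
          cross Γ a b h (swap a b • s) * dot Γ (swap a b c) (swap a b • s) := by
        rw [← idem_mul_dot, ← mul_assoc, totalCross_mul_idem, idem_mul_dot]
      have h2 : dot Γ c s * totalCross Γ h = dot Γ c s * cross Γ a b h (swap a b • s) := by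
        rw [← dot_mul_idem, mul_assoc, ← idem_mul_totalCross h (swap a b • s),
          Seq.swap_swap_smul]
        simp only [← mul_assoc, dot_mul_idem]
      change dot Γ c s * totalCross Γ h - _ ∈ _
      rw [h1, h2]
      exact this
  | zero => exact ⟨0, zero_mem _, by simp⟩
  | one => exact ⟨1, one_mem _, by simp⟩
  | add x y hx hy ihx ihy =>
    obtain ⟨x', hx', h1⟩ := ihx
    obtain ⟨y', hy', h2⟩ := ihy
    refine ⟨x' + y', add_mem hx' hy', ?_⟩
    convert add_mem h1 h2 using 1
    noncomm_ring
  | neg x hx ih =>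
    obtain ⟨x', hx', h1⟩ := ih
    refine ⟨-x', neg_mem hx', ?_⟩
    convert neg_mem h1 using 1
    noncomm_ring
  | mul x y hx hy ihx ihy =>
    obtain ⟨x', hx', h1⟩ := ihx
    obtain ⟨y', hy', h2⟩ := ihy
    refine ⟨x' * y', mul_mem hx' hy', ?_⟩
    convert add_mem (mul_mem hx h2) (mul_mem h1 hy') using 1
    noncomm_ring

theorem totalCross_sq {a b : Fin (size ν)} (h : a.val + 1 = b.val) :
    totalCross Γ h * totalCross Γ h ∈ polClosure Γ ν := by
  refine mem_of_mul_idem fun s => ?_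
  rw [mul_assoc, totalCross_mul_idem, totalCross_mul_cross]
  by_cases h1 : s a = s b
  · rw [cross_sq_same h s h1]; exact zero_mem _
  by_cases h2 : Γ.Adj (s a) (s b)
  · rw [cross_sq_edge h s (cartan_eq_neg_one.2 h2)]
    exact add_mem (dot_mem _ _) (dot_mem _ _)
  · rw [cross_sq_zero h s (by unfold cartan; rw [if_neg h1, if_neg h2])]
    exact idem_mem s

theorem totalCross_far {a b c d : Fin (size ν)} (h : a.val + 1 = b.val) (h' : c.val + 1 = d.val)
    (hbc : b < c) : totalCross Γ h * totalCross Γ h' = totalCross Γ h' * totalCross Γ h := by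
  refine eq_of_mul_idem fun s => ?_
  rw [mul_assoc, mul_assoc, totalCross_mul_idem, totalCross_mul_idem, totalCross_mul_cross,
    totalCross_mul_cross, cross_mul_cross_far h s h' hbc]

theorem totalCross_braid {a b c : Fin (size ν)} (h : a.val + 1 = b.val) (h' : b.val + 1 = c.val) :
    totalCross Γ h * totalCross Γ h' * totalCross Γ h -
      totalCross Γ h' * totalCross Γ h * totalCross Γ h' ∈ polClosure Γ ν := by
  refine mem_of_mul_idem fun s => ?_
  have h1 : totalCross Γ h * totalCross Γ h' * totalCross Γ h * idem Γ s =
      cross Γ a b h (swap b c • swap a b • s) * cross Γ b c h' (swap a b • s) *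
        cross Γ a b h s := by
    rw [mul_assoc, mul_assoc, totalCross_mul_idem, totalCross_mul_cross, ← mul_assoc,
      totalCross_mul_cross]
  have h2 : totalCross Γ h' * totalCross Γ h * totalCross Γ h' * idem Γ s =
      cross Γ b c h' (swap a b • swap b c • s) * cross Γ a b h (swap b c • s) *
        cross Γ b c h' s := by
    rw [mul_assoc, mul_assoc, totalCross_mul_idem, totalCross_mul_cross, ← mul_assoc,
      totalCross_mul_cross]
  rw [sub_mul, h1, h2]
  by_cases hi : s a = s c ∧ cartan Γ (s a) (s b) = -1
  · rw [braid_hard h s h' hi.1 hi.2]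
    exact idem_mem s
  · rw [braid_easy h s h' hi, sub_self]
    exact zero_mem _

variable (Γ ν) in
/-- The total crossings, indexed by natural numbers. -/
def crossings (k : ℕ) : R Γ ν :=
  if h : k + 1 < size ν then
    totalCross Γ (a := (⟨k, by omega⟩ : Fin (size ν))) (b := ⟨k + 1, h⟩) rfl
  else 0

theorem crossings_of_lt {k : ℕ} (h : k + 1 < size ν) : crossings Γ ν k =
    totalCross Γ (a := (⟨k, by omega⟩ : Fin (size ν))) (b := ⟨k + 1, h⟩) rfl := dif_pos h

theorem crossings_of_not_lt {k : ℕ} (h : ¬ k + 1 < size ν) : crossings Γ ν k = 0 := dif_neg h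

/-- Total crossings carry no sequence, so the abstract spanning argument applies to them. The value
0 outside the range of strands satisfies all the relations. -/
theorem braidLike : BraidLike (polPart Γ ν) (crossings Γ ν) where
  one_le := Submodule.one_le.2 (one_mem (polClosure Γ ν))
  mul_le := Submodule.mul_le.2 fun _ hx _ hy => mul_mem (S := Subring (R Γ ν)) hx hy
  left k := Submodule.mul_le.2 fun x hx y hy => by
    obtain ⟨z, rfl⟩ := Submodule.mem_span_singleton.1 hx
    rw [smul_mul_assoc]
    refine Submodule.smul_mem _ _ ?_
    by_cases hk : k + 1 < size ν
    · rw [crossings_of_lt hk]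
      obtain ⟨y', hy', h1⟩ := totalCross_left (Γ := Γ) (ν := ν) (a := ⟨k, by omega⟩)
        (b := ⟨k + 1, hk⟩) rfl hy
      exact Submodule.mem_sup.2 ⟨_, Submodule.mul_mem_mul (mem_polPart.2 hy')
        (Submodule.mem_span_singleton_self _), _, mem_polPart.2 h1, by abel⟩
    · rw [crossings_of_not_lt hk, zero_mul]; exact zero_mem _
  right k := Submodule.mul_le.2 fun y hy x hx => by
    obtain ⟨z, rfl⟩ := Submodule.mem_span_singleton.1 hx
    rw [mul_smul_comm]
    refine Submodule.smul_mem _ _ ?_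
    by_cases hk : k + 1 < size ν
    · rw [crossings_of_lt hk]
      obtain ⟨y', hy', h1⟩ := totalCross_right (Γ := Γ) (ν := ν) (a := ⟨k, by omega⟩)
        (b := ⟨k + 1, hk⟩) rfl hy
      exact Submodule.mem_sup.2 ⟨_, Submodule.mul_mem_mul (Submodule.mem_span_singleton_self _)
        (mem_polPart.2 hy'), _, mem_polPart.2 h1, by abel⟩
    · rw [crossings_of_not_lt hk, mul_zero]; exact zero_mem _
  sq k := by
    by_cases hk : k + 1 < size ν
    · rw [crossings_of_lt hk]; exact totalCross_sq _
    · rw [crossings_of_not_lt hk, zero_mul]; exact zero_mem _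
  far k l hkl := by
    by_cases hl : l + 1 < size ν
    · rw [crossings_of_lt hl, crossings_of_lt (by omega : k + 1 < size ν)]
      exact totalCross_far _ _ hkl
    · rw [crossings_of_not_lt hl, mul_zero, zero_mul]
  braid k := by
    by_cases hk : k + 1 + 1 < size ν
    · rw [crossings_of_lt hk, crossings_of_lt (by omega : k + 1 < size ν)]
      exact totalCross_braid _ _
    · rw [crossings_of_not_lt hk]; simp

/-- The last stage of the tower is a ring containing every generator, since δ_{a,i} is a total
crossing times 1_i. -/
theorem tower_eq_top (x : R Γ ν) : x ∈ tower (polPart Γ ν) (crossings Γ ν) (size ν - 1) := by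
  set W := tower (polPart Γ ν) (crossings Γ ν) (size ν - 1)
  have hmul {x y : R Γ ν} (hx : x ∈ W) (hy : y ∈ W) : x * y ∈ W :=
    braidLike.tower_mul_le _ (Submodule.mul_mem_mul hx hy)
  have hP : polPart Γ ν ≤ W := tower_mono (Nat.zero_le _)
  induction x using induction_gen with
  | int r => exact hP (mem_polPart.2 (intCast_mem (polClosure Γ ν) r))
  | gen g =>
    cases g with
    | idem s => exact hP (idem_mem s)
    | dot a s => exact hP (dot_mem a s)
    | cross a b h s =>
      obtain ⟨k, hk⟩ := a
      obtain ⟨l, hl⟩ := b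
      obtain rfl : k + 1 = l := h
      change cross Γ _ _ _ s ∈ W
      rw [← totalCross_mul_idem]
      refine hmul ?_ (hP (idem_mem s))
      have := (braidLike (Γ := Γ) (ν := ν)).mem_tower (show k < size ν - 1 by omega)
      rwa [crossings_of_lt hl] at this
  | mul x y hx hy => exact hmul hx hy
  | add x y hx hy => exact add_mem hx hy

variable (ν) in
/-- The index set of the normal form words, a set with `m!` elements. -/
abbrev NF : Type := (i : Fin (size ν - 1)) → Fin (i + 2)

theorem card_NF : Fintype.card (NF ν) = (size ν)! := by
  rw [Fintype.card_pi]
  simp only [Fintype.card_fin]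
  rw [Fin.prod_univ_eq_prod_range (fun i => i + 2)]
  have (n : ℕ) : ∏ i ∈ Finset.range n, (i + 2) = (n + 1)! := by
    induction n with
    | zero => rfl
    | succ n ih => rw [Finset.prod_range_succ, ih, Nat.factorial_succ (n + 1), mul_comm]
  rw [this]
  -- For m = 0 the truncated m - 1 makes the claim 1! = 0!.
  cases size ν with
  | zero => rfl
  | succ n => rfl

variable (Γ) in
/-- The products of total crossings for the normal form words. -/
def nfWord (c : NF ν) : R Γ ν :=
  nf (crossings Γ ν) (fun i => if hi : i < size ν - 1 then (c ⟨i, hi⟩ : ℕ) else 0) (size ν - 1)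

theorem exists_eq_sum (x : R Γ ν) : ∃ f : NF ν → Pol ν, x = ∑ c, polToR Γ ν (f c) * nfWord Γ c := by
  have hx := braidLike.tower_le_nf _ (tower_eq_top x)
  refine Submodule.iSup_induction _ (motive := fun x => ∃ f : NF ν → Pol ν,
    x = ∑ c, polToR Γ ν (f c) * nfWord Γ c) hx ?_ ⟨0, by simp⟩ ?_
  · intro c x hx
    obtain ⟨y, hy, rfl⟩ := Submodule.mem_mul_span_singleton.1 hx
    obtain ⟨f, rfl⟩ := mem_polClosure.1 (mem_polPart.1 hy)
    refine ⟨Pi.single c f, ?_⟩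
    rw [Finset.sum_eq_single c, Pi.single_eq_same]
    · rfl
    · intro b _ hb
      rw [Pi.single_eq_of_ne hb, map_zero, zero_mul]
    · simp
  · rintro _ _ ⟨f, rfl⟩ ⟨g, rfl⟩
    exact ⟨f + g, by simp [add_mul, Finset.sum_add_distrib]⟩

end Crossings

end KLR

end

noncomputable section

/-! ### Faithfulness of the action and the center -/

namespace KLR

universe u

variable {I : Type u}

section Faithful

open MvPolynomial Equiv

variable {Γ : SimpleGraph I} {ν : I →₀ ℕ}

theorem perm_induction {n : ℕ} {p : Perm (Fin n) → Prop} (one : p 1)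
    (mul : ∀ v w, p v → p w → p (v * w))
    (adj : ∀ a b : Fin n, a.val + 1 = b.val → p (swap a b)) (w : Perm (Fin n)) : p w := by
  cases n with
  | zero => rwa [Subsingleton.elim w 1]
  | succ n =>
    have hw : w ∈ Submonoid.closure (Set.range fun i : Fin n ↦ swap i.castSucc i.succ) := by
      rw [Equiv.Perm.mclosure_swap_castSucc_succ]; trivial
    induction hw using Submonoid.closure_induction with
    | mem x hx =>
      obtain ⟨i, rfl⟩ := hx
      exact adj _ _ (by simp)
    | one => exact one
    | mul x y _ _ hx hy => exact mul _ _ hx hy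

theorem permute_apply (w : Perm (Fin (size ν))) (f : Pol ν) (s : Seq ν) :
    permute w f s = rename w (f (w⁻¹ • s)) := rfl

theorem permute_one (f : Pol ν) : permute 1 f = f := by
  funext s
  rw [permute_apply, inv_one, one_smul]
  exact rename_id_apply _

theorem permute_mul (v w : Perm (Fin (size ν))) (f : Pol ν) :
    permute (v * w) f = permute v (permute w f) := by
  funext s
  simp only [permute_apply, rename_rename, mul_inv_rev, mul_smul, Perm.coe_mul]

-- This inverts the crossing operators up to polynomial factors: permutations, which are easy to
-- handle, are recovered inside the image of R(ν). The factors are kept nonzero in every component,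
-- so that they can be cancelled componentwise.
variable (Γ) in
theorem exists_rho_eq_permute (w : Perm (Fin (size ν))) : ∃ (x : R Γ ν) (g : Pol ν),
    (∀ s, g s ≠ 0) ∧ ∀ f, rho Γ ν x f = g * permute w f := by
  induction w using perm_induction with
  | one => exact ⟨1, 1, fun s => one_ne_zero, fun f => by simp [permute_one]⟩
  | mul v w hv hw =>
    obtain ⟨x, g, hg, hx⟩ := hv
    obtain ⟨y, h, hh, hy⟩ := hw
    refine ⟨x * y, g * permute v h, fun s => mul_ne_zero (hg s) ?_, fun f => ?_⟩
    · rw [permute_apply]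
      exact (map_ne_zero_iff _ (rename_injective v v.injective)).2 (hh _)
    · rw [map_mul, Module.End.mul_apply, hy, hx, map_mul, permute_mul, mul_assoc]
  | adj a b h =>
    have hab : a ≠ b := fun e => by rw [e] at h; omega
    have key (s : Seq ν) : ∃ (x : R Γ ν) (k : MvPolynomial (Fin (size ν)) ℤ), k ≠ 0 ∧
        ∀ f, rho Γ ν x f = Pi.single (swap a b • s) (k * rename (swap a b) (f s)) := by
      by_cases hs : s a = s b
      -- For equal labels, s = 1 - (x_a - x_b)∂.
      · refine ⟨idem Γ s - (dot Γ a s - dot Γ b s) * cross Γ a b h s, 1, one_ne_zero, fun f => ?_⟩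
        simp only [idem, dot, cross, map_sub, map_mul, rho_gen, genOp, Seq.swap_smul_of_eq hs,
          ← block_sub, block_mul, block_apply]
        congr 1
        rw [hs]
        simp only [LinearMap.sub_apply, LinearMap.comp_apply, LinearMap.id_apply,
          LinearMap.mulLeft_apply, crossOp_same, one_mul]
        rw [← sub_mul, divDiff_spec hab, sub_sub_cancel]
      · refine ⟨cross Γ a b h s, _, coef_ne_zero Γ (s a) (s b) a b, fun f => ?_⟩
        rw [cross, rho_gen, genOp, block_apply, crossOp_of_ne Γ a b hs]
    choose x k hk hx using key
    refine ⟨∑ s, x s, fun t => k (swap a b • t), fun t => hk _, fun f => ?_⟩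
    funext t
    rw [map_sum, LinearMap.sum_apply, Finset.sum_apply, Finset.sum_eq_single (swap a b • t), hx,
      Seq.swap_swap_smul, Pi.single_eq_same]
    · rw [Pi.mul_apply, permute_apply, swap_inv]
    · intro s _ hs
      rw [hx, Pi.single_eq_of_ne]
      rintro rfl
      exact hs (Seq.swap_swap_smul a b s).symm
    · simp

/-- Dedekind's independence of characters: f ↦ (w f)_s is multiplicative, and the element with every
component x_a is sent to x_{w(a)}, which tells the permutations apart. -/
theorem linearIndependent_permute (s : Seq ν) :
    LinearIndependent (MvPolynomial (Fin (size ν)) ℤ)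
      (fun (w : Perm (Fin (size ν))) (f : Pol ν) => permute w f s) := by
  let e (w : Perm (Fin (size ν))) : Pol ν →* MvPolynomial (Fin (size ν)) ℤ :=
    ((Pi.evalRingHom (fun _ : Seq ν => MvPolynomial (Fin (size ν)) ℤ) s).comp
      (permute w)).toMonoidHom
  have he : Function.Injective e := fun v w h => by
    ext a
    have := DFunLike.congr_fun h (fun _ => X a)
    change rename v (X a) = rename w (X a) at this
    rw [rename_X, rename_X] at this
    exact congrArg Fin.val (X_injective this)
  exact (linearIndependent_monoidHom (Pol ν) (MvPolynomial (Fin (size ν)) ℤ)).comp e he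

/-- The normal form words act on `Pol(ν)` by operators that are independent over `Pol(ν)`. -/
theorem eq_zero_of_rho_eq_zero (f : NF ν → Pol ν)
    (hf : rho Γ ν (∑ c, polToR Γ ν (f c) * nfWord Γ c) = 0) : f = 0 := by
  choose x g hg hx using exists_rho_eq_permute Γ (ν := ν)
  choose a ha using fun w => exists_eq_sum (x w)
  have hact (h : NF ν → Pol ν) (p : Pol ν) : rho Γ ν (∑ c, polToR Γ ν (h c) * nfWord Γ c) p =
      ∑ c, h c * rho Γ ν (nfWord Γ c) p := by
    rw [map_sum, LinearMap.sum_apply]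
    exact Finset.sum_congr rfl fun c _ => by rw [map_mul, Module.End.mul_apply, rho_polToR]
  funext c s
  -- At each `s`, work in the module of all functions from Pol(ν) to the polynomial ring: the m!
  -- functions f ↦ (g_w · w f)_s are independent and lie in the span of the m! words.
  refine congrFun (eq_zero_of_span (by rw [card_NF, Fintype.card_perm, Fintype.card_fin])
    (fun c p => rho Γ ν (nfWord Γ c) p s) (fun w p => rho Γ ν (x w) p s) ?_
    (fun w c => a w c s) (fun w => ?_) (fun c => f c s) ?_) c
  · refine Fintype.linearIndependent_iff.2 fun y hy w => ?_
    have := Fintype.linearIndependent_iff.1 (linearIndependent_permute s)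
      (fun w => y w * g w s) (by
        rw [← hy]
        refine Finset.sum_congr rfl fun w _ => funext fun p => ?_
        simp only [Pi.smul_apply, smul_eq_mul, hx, Pi.mul_apply, mul_assoc]) w
    exact (mul_eq_zero.1 this).resolve_right (hg w s)
  · funext p
    conv_lhs => rw [ha w, hact]
    simp
  · funext p
    have := congrFun (LinearMap.congr_fun hf p) s
    rw [hact] at this
    simpa using this

theorem rho_injective : Function.Injective (rho Γ ν) := by
  refine (injective_iff_map_eq_zero _).2 fun x hx => ?_
  obtain ⟨f, rfl⟩ := exists_eq_sum x
  simp [eq_zero_of_rho_eq_zero f hx]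

theorem eq_zero_of_sum_eq_zero {f : NF ν → Pol ν}
    (hf : ∑ c, polToR Γ ν (f c) * nfWord Γ c = 0) : f = 0 :=
  eq_zero_of_rho_eq_zero (Γ := Γ) f (by rw [hf, map_zero])

theorem rename_invariant {f : Pol ν} (hf : f ∈ invariants ν) (w : Perm (Fin (size ν)))
    (s : Seq ν) : rename w (f s) = f (w • s) := by
  conv_rhs => rw [← hf w, permute_apply, inv_smul_smul]

/-- Only crossings need an argument. For equal labels f_s is fixed by the transposition, so the
divided difference is linear over it; for different labels the transposition carries f_s to the
component at the new sequence. -/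
theorem rho_invariant {f : Pol ν} (hf : f ∈ invariants ν) (x : R Γ ν) (p : Pol ν) :
    rho Γ ν x (f * p) = f * rho Γ ν x p := by
  have hblock {s t : Seq ν}
      {F : MvPolynomial (Fin (size ν)) ℤ →ₗ[ℤ] MvPolynomial (Fin (size ν)) ℤ}
      (h : ∀ q, F (f s * q) = f t * F q) (p : Pol ν) :
      block s t F (f * p) = f * block s t F p := by
    rw [block_apply, block_apply, Pi.mul_apply, h]
    funext r
    rcases eq_or_ne r t with rfl | hr
    · rw [Pi.mul_apply, Pi.single_eq_same, Pi.single_eq_same]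
    · rw [Pi.mul_apply, Pi.single_eq_of_ne hr, Pi.single_eq_of_ne hr, mul_zero]
  induction x using induction_gen generalizing p with
  | int r =>
    rw [map_intCast]
    simp [mul_left_comm]
  | gen g =>
    rw [rho_gen]
    cases g with
    | idem s => exact hblock (fun q => rfl) p
    | dot a s => exact hblock (fun q => mul_left_comm _ _ _) p
    | cross a b h s =>
      refine hblock (fun q => ?_) p
      have h1 := rename_invariant hf (swap a b) s
      by_cases hs : s a = s b
      · rw [Seq.swap_smul_of_eq hs] at h1 ⊢
        rw [hs, crossOp_same, crossOp_same,
          divDiff_mul (fun e => by rw [e] at h; omega) h1]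
      · rw [crossOp_of_ne _ _ _ hs, crossOp_of_ne _ _ _ hs, map_mul, h1, mul_left_comm]
  | mul x y hx hy =>
    rw [map_mul (rho Γ ν), Module.End.mul_apply, Module.End.mul_apply, hy, hx]
  | add x y hx hy =>
    rw [map_add (rho Γ ν), LinearMap.add_apply, LinearMap.add_apply, hx, hy, mul_add]

theorem center_eq_Sym : Subring.center (R Γ ν) = Sym Γ ν := by
  ext z
  rw [Subring.mem_center_iff]
  constructor
  · intro hz
    set g := rho Γ ν z 1 with hg
    -- Commuting with multiplication by f: z·f = z·(f·1) = f·(z·1).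
    have hzg (f : Pol ν) : rho Γ ν z f = f * g := by
      have := congrArg (fun x => rho Γ ν x 1) (hz (polToR Γ ν f))
      simp only [map_mul, Module.End.mul_apply, rho_polToR, mul_one] at this
      exact this.symm
    refine ⟨g, fun w => ?_, rho_injective (LinearMap.ext fun f => ?_)⟩
    -- Evaluate xz = zx at 1, where x acts as h·w: this gives h·w(g) = h·g, and h cancels in each
    -- component.
    · obtain ⟨x, h, hh, hx⟩ := exists_rho_eq_permute Γ w
      have := congrArg (fun y => rho Γ ν y 1) (hz x)
      simp only [map_mul, Module.End.mul_apply, ← hg, hzg, hx, map_one, mul_one] at this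
      funext s
      exact mul_left_cancel₀ (hh s) (congrFun this s)
    · rw [rho_polToR, hzg, mul_comm]
  · rintro ⟨f, hf, rfl⟩ x
    refine rho_injective (LinearMap.ext fun p => ?_)
    rw [map_mul, map_mul, Module.End.mul_apply, Module.End.mul_apply, rho_polToR, rho_polToR,
      rho_invariant hf]

end Faithful

end KLR

end

noncomputable section

/-! ### `Pol(ν)` as a module over its invariants -/

namespace KLR

universe u

variable {I : Type u}

/-! ### Monomial spanning sets of iterated integral extensions -/

section AdjoinSpan

open Polynomial

/-- A ring generated by `y 0, …, y (n - 1)`, each integral of degree `D k` over the ring generated by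
the preceding ones, is spanned by monomials with exponents less than the degrees. -/
theorem mem_span_monomials {K B : Type*} [CommRing K] [CommRing B] [Nontrivial B] [Algebra K B]
    (y : ℕ → B) (D : ℕ → ℕ) (n : ℕ)
    (H : ∀ k < n, ∃ f : (Algebra.adjoin K (y '' Set.Iio k))[X],
      f.Monic ∧ f.natDegree = D k ∧ aeval (y k) f = 0) (x : B)
    (hx : x ∈ Algebra.adjoin K (y '' Set.Iio n)) :
    x ∈ Submodule.span K
      (Set.range fun α : (i : Fin n) → Fin (D i) => ∏ i : Fin n, y i ^ (α i : ℕ)) := by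
  induction n generalizing x with
  | zero =>
    have h0 : y '' Set.Iio 0 = ∅ := by simp
    rw [h0, Algebra.adjoin_empty] at hx
    obtain ⟨k, rfl⟩ := Algebra.mem_bot.1 hx
    rw [Algebra.algebraMap_eq_smul_one]
    exact Submodule.smul_mem _ _ (Submodule.subset_span ⟨finZeroElim, by simp⟩)
  | succ n ih =>
    obtain ⟨f, hf, hdeg, hroot⟩ := H n (Nat.lt_succ_self n)
    have ih := ih fun k hk => H k (by omega)
    have hset : y '' Set.Iio (n + 1) = y '' Set.Iio n ∪ {y n} := by
      rw [← Order.succ_eq_add_one, Order.Iio_succ_eq_insert, Set.image_insert_eq,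
        Set.insert_eq, Set.union_comm]
    rw [hset, Algebra.adjoin_union_eq_adjoin_adjoin, Subalgebra.mem_restrictScalars,
      Algebra.adjoin_singleton_eq_range_aeval] at hx
    obtain ⟨q, rfl⟩ := hx
    have hf1 : f ≠ 1 := by
      rintro rfl
      rw [map_one] at hroot
      exact one_ne_zero hroot
    change aeval (y n) q ∈ _
    -- Dividing by the monic relation replaces a polynomial in `y n` by one of degree less than `D
    -- n`, whose coefficients are covered by induction.
    rw [← aeval_modByMonic_eq_self_of_root hroot,
      aeval_eq_sum_range' (natDegree_modByMonic_lt q hf hf1), hdeg]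
    refine sum_mem fun j hj => ?_
    have hc := ih _ ((q %ₘ f).coeff j).2
    rw [Algebra.smul_def]
    change ((q %ₘ f).coeff j : B) * y n ^ j ∈ _
    refine (Submodule.map_span_le (LinearMap.mulRight K (y n ^ j)) _ _).2 ?_
      (Submodule.mem_map_of_mem hc)
    rintro _ ⟨α, rfl⟩
    refine Submodule.subset_span ⟨Fin.snoc (α := fun i : Fin (n + 1) => Fin (D i)) α
      ⟨j, Finset.mem_range.1 hj⟩, ?_⟩
    simp [Fin.prod_univ_castSucc]

end AdjoinSpan

/-! ### Counting sequences, stabilizers and monomials -/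

section Combinatorics

open Equiv

variable {ν : I →₀ ℕ}

theorem Seq.card_fiber (s : Seq ν) (i : I) [Fintype {a // s a = i}] :
    Fintype.card {a // s a = i} = ν i := by
  classical
  have h := DFunLike.congr_fun s.2 i
  rw [Finsupp.finsetSum_apply] at h
  rw [← h, Fintype.card_subtype, Finset.card_filter]
  exact Finset.sum_congr rfl fun a _ => by rw [Finsupp.single_apply]

theorem Seq.exists_smul_eq (s t : Seq ν) : ∃ w : Perm (Fin (size ν)), w • s = t := by
  classical
  let e (i : I) : {a // s a = i} ≃ {a // t a = i} :=
    Fintype.equivOfCardEq (by rw [s.card_fiber, t.card_fiber])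
  refine ⟨Equiv.ofFiberEquiv e, Subtype.ext (funext fun x => ?_)⟩
  have := Equiv.ofFiberEquiv_map e ((Equiv.ofFiberEquiv e).symm x)
  rw [Equiv.apply_symm_apply] at this
  exact this.symm

instance : MulAction.IsPretransitive (Perm (Fin (size ν))) (Seq ν) := ⟨Seq.exists_smul_eq⟩

instance : Nonempty (Seq ν) := by
  classical
  have hcard : Fintype.card (Σ i : ν.support, Fin (ν i)) = size ν := by
    rw [Fintype.card_sigma]
    simp only [Fintype.card_fin]
    exact Finset.sum_coe_sort ν.support ν
  let e : Fin (size ν) ≃ Σ i : ν.support, Fin (ν i) :=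
    (Fintype.equivFinOfCardEq hcard).symm
  refine ⟨⟨fun a => (e a).1, ?_⟩⟩
  rw [e.sum_comp (fun p => Finsupp.single (p.1 : I) 1), Fintype.sum_sigma]
  conv_rhs => rw [← Finsupp.sum_single ν, Finsupp.sum, ← Finset.sum_coe_sort]
  refine Finset.sum_congr rfl fun i _ => ?_
  simp

/-- The number of positions from `l` on with the same label as `l`. -/
def dg (s : Seq ν) (l : ℕ) : ℕ := by
  classical
  exact if h : l < size ν then
    (Finset.univ.filter fun b : Fin (size ν) => s b = s ⟨l, h⟩ ∧ l ≤ b.val).card else 0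

theorem prod_card_filter_le {α : Type*} [LinearOrder α] (S : Finset α) :
    ∏ a ∈ S, (S.filter fun b => a ≤ b).card = S.card ! := by
  induction S using Finset.induction_on_min with
  | empty => rfl
  | insert a S h ih =>
    have ha : a ∉ S := fun h' => lt_irrefl _ (h a h')
    rw [Finset.prod_insert ha, Finset.card_insert_of_notMem ha, Nat.factorial_succ, ← ih]
    congr 1
    · rw [← Finset.card_insert_of_notMem ha]
      congr 1
      refine Finset.filter_true_of_mem fun b hb => ?_
      rcases Finset.mem_insert.1 hb with rfl | hb
      · exact le_rfl
      · exact (h b hb).le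
    · refine Finset.prod_congr rfl fun b hb => ?_
      rw [Finset.filter_insert, if_neg (h b hb).not_ge]

/-- Within the positions of one label i the factors `dg` run through ν_i, …, 1, so the product is ∏
ν_i!, the order of the stabilizer. -/
theorem prod_dg (s : Seq ν) :
    ∏ a : Fin (size ν), dg s a =
      Nat.card (MulAction.stabilizer (Perm (Fin (size ν))) s) := by
  classical
  let e : MulAction.stabilizer (Perm (Fin (size ν))) s ≃ {g : Perm (Fin (size ν)) // s.1 ∘ g = s.1} :=
    (Equiv.inv _).subtypeEquiv fun w => by
      rw [MulAction.mem_stabilizer_iff]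
      exact ⟨fun h => congrArg Subtype.val h, fun h => Subtype.ext h⟩
  rw [Nat.card_congr e, Nat.card_eq_fintype_card, DomMulAct.stabilizer_card']
  rw [← Finset.prod_fiberwise_of_maps_to (t := Finset.univ.image s.1) (g := s.1)
    (fun a _ => Finset.mem_image_of_mem _ (Finset.mem_univ a))]
  refine Finset.prod_congr rfl fun i _ => ?_
  rw [Fintype.card_subtype, ← prod_card_filter_le]
  refine Finset.prod_congr rfl fun a ha => ?_
  rw [dg, dif_pos a.2, Finset.filter_filter]
  have := (Finset.mem_filter.1 ha).2
  subst this
  rfl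

variable (ν) in
/-- The index set of a basis of `Pol(ν)` over its invariants. -/
abbrev Mon : Type u := Σ s : Seq ν, (i : Fin (size ν)) → Fin (dg s i)

/-- Each sequence contributes the order of its stabilizer. By transitivity these orders agree, so
the sum is |Seq(ν)| times that order, hence m! by orbit–stabilizer. -/
theorem card_Mon : Fintype.card (Mon ν) = (size ν)! := by
  classical
  obtain ⟨s⟩ := (inferInstance : Nonempty (Seq ν))
  have h (t : Seq ν) : ∏ a : Fin (size ν), dg t a = ∏ a : Fin (size ν), dg s a := by
    rw [prod_dg, prod_dg]
    have h1 := (MulAction.stabilizer (Perm (Fin (size ν))) t).card_mul_index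
    have h2 := (MulAction.stabilizer (Perm (Fin (size ν))) s).card_mul_index
    rw [MulAction.index_stabilizer_of_transitive] at h1 h2
    exact Nat.eq_of_mul_eq_mul_right Nat.card_pos (h1.trans h2.symm)
  rw [Fintype.card_sigma]
  simp only [Fintype.card_pi, Fintype.card_fin]
  rw [Finset.sum_congr rfl fun t _ => h t, Finset.sum_const, Finset.card_univ, prod_dg, smul_eq_mul,
    mul_comm, ← Nat.card_eq_fintype_card, ← MulAction.index_stabilizer_of_transitive
      (Perm (Fin (size ν))) s, Subgroup.card_mul_index, Nat.card_perm, Nat.card_fin]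

end Combinatorics

/-! ### A basis of Pol(ν) over its invariants -/

section Invariants

open MvPolynomial Equiv

variable {ν : I →₀ ℕ}

/-- The polynomials that are invariant under the stabilizer of a sequence. -/
def stabInv (s : Seq ν) : Subalgebra ℤ (MvPolynomial (Fin (size ν)) ℤ) where
  carrier := {p | ∀ w : Perm (Fin (size ν)), w • s = s → rename w p = p}
  mul_mem' hp hq w hw := by rw [map_mul, hp w hw, hq w hw]
  add_mem' hp hq w hw := by rw [map_add, hp w hw, hq w hw]
  algebraMap_mem' r w _ := by simp

/-- An invariant polynomial at a sequence extends to an element of the ring of invariants. -/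
theorem exists_invariant {s : Seq ν} {p : MvPolynomial (Fin (size ν)) ℤ} (hp : p ∈ stabInv s) :
    ∃ f ∈ invariants ν, f s = p := by
  choose w hw using Seq.exists_smul_eq s
  refine ⟨fun t => rename (w t) p, fun v => funext fun t => ?_, hp _ (hw s)⟩
  -- This permutation fixes `s`; invariance of p under it is the required compatibility of the
  -- transported components.
  have h := hp ((w t)⁻¹ * v * w (v⁻¹ • t)) (by
    rw [mul_smul, mul_smul, hw, smul_inv_smul, inv_smul_eq_iff, hw])
  have h2 := congrArg (rename (w t)) h
  rw [rename_rename, ← Perm.coe_mul, mul_assoc, mul_inv_cancel_left] at h2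
  rw [permute_apply, rename_rename, ← h2, Perm.coe_mul]

theorem eq_of_invariant {f g : Pol ν} (hf : f ∈ invariants ν) (hg : g ∈ invariants ν) (s : Seq ν)
    (h : f s = g s) : f = g := by
  funext t
  obtain ⟨w, rfl⟩ := Seq.exists_smul_eq s t
  rw [← rename_invariant hf, ← rename_invariant hg, h]

/-- The variables, indexed by natural numbers. -/
def var (ν : I →₀ ℕ) (l : ℕ) : MvPolynomial (Fin (size ν)) ℤ :=
  if h : l < size ν then X ⟨l, h⟩ else 0

theorem var_coe (a : Fin (size ν)) : var ν a = X a := dif_pos a.2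

-- The full product of X - x_b over the positions with the label of k has stabilizer-invariant
-- coefficients. Its factor over b < k has coefficients in the ring generated by earlier variables.
-- Dividing one by the other leaves the factors with b ≥ k, of which x_k is a root.
open Polynomial in
theorem exists_monic {K : Type*} [CommRing K] [Algebra K (MvPolynomial (Fin (size ν)) ℤ)]
    (s : Seq ν) (hK : ∀ p ∈ stabInv s, p ∈ Set.range (algebraMap K (MvPolynomial (Fin (size ν)) ℤ)))
    (k : ℕ) (hk : k < size ν) :
    ∃ f : (Algebra.adjoin K (var ν '' Set.Iio k))[X],
      f.Monic ∧ f.natDegree = dg s k ∧ Polynomial.aeval (var ν k) f = 0 := by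
  classical
  set C := Algebra.adjoin K (var ν '' Set.Iio k)
  let ι : C →+* MvPolynomial (Fin (size ν)) ℤ := algebraMap _ _
  have hι : Function.Injective ι := Subtype.val_injective
  let a : Fin (size ν) := ⟨k, hk⟩
  let lin (b : Fin (size ν)) : (MvPolynomial (Fin (size ν)) ℤ)[X] :=
    Polynomial.X - Polynomial.C (MvPolynomial.X b)
  let S := Finset.univ.filter fun b => s b = s a
  obtain ⟨F, hF⟩ : ∃ F : C[X], F.map ι = ∏ b ∈ S, lin b := by
    rw [← mem_lifts, lifts_iff_coeff_lifts]
    intro n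
    suffices h : (∏ b ∈ S, lin b).coeff n ∈ stabInv s from
      let ⟨c, hc⟩ := hK _ h
      ⟨algebraMap K C c, hc⟩
    intro w hw
    have hS (b : Fin (size ν)) : w b ∈ S ↔ b ∈ S := by
      have : s (w b) = s b := by
        conv_lhs => rw [← hw]
        exact congrArg s.1 (w.symm_apply_apply b)
      simp [S, this]
    have h1 : (∏ b ∈ S, lin b).map (rename w : MvPolynomial (Fin (size ν)) ℤ →ₐ[ℤ] _).toRingHom =
        ∏ b ∈ S, lin b := by
      rw [Polynomial.map_prod]
      refine Finset.prod_bij (fun b _ => w b) (fun b hb => (hS b).2 hb)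
        (fun b _ c _ h => w.injective h)
        (fun b hb => ⟨w⁻¹ b, (hS _).1 (by simpa using hb), by simp⟩) fun b _ => ?_
      simp [lin]
    conv_rhs => rw [← h1, Polynomial.coeff_map]
    rfl
  obtain ⟨G, hG⟩ : ∃ G : C[X], G.map ι = ∏ b ∈ S.filter (fun b => ¬ k ≤ b.val), lin b := by
    have hX (b : Fin (size ν)) (hb : ¬ k ≤ b.val) : MvPolynomial.X b ∈ C :=
      Algebra.subset_adjoin ⟨b.val, not_le.1 hb, var_coe b⟩
    let Y (b : Fin (size ν)) : C := if hb : ¬ k ≤ b.val then ⟨MvPolynomial.X b, hX b hb⟩ else 0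
    refine ⟨∏ b ∈ S.filter (fun b => ¬ k ≤ b.val), ((Polynomial.X : C[X]) - Polynomial.C (Y b)), ?_⟩
    rw [Polynomial.map_prod]
    refine Finset.prod_congr rfl fun b hb => ?_
    rw [Polynomial.map_sub, Polynomial.map_X, Polynomial.map_C]
    simp only [Y, dif_pos (Finset.mem_filter.1 hb).2]
    rfl
  have hmonic (T : Finset (Fin (size ν))) : (∏ b ∈ T, lin b).Monic :=
    monic_prod_of_monic _ _ fun b _ => monic_X_sub_C _
  have hGm : G.Monic := monic_of_injective hι (by rw [hG]; exact hmonic _)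
  -- Division by a monic polynomial commutes with extending the coefficients, so the quotient is
  -- already defined over the smaller ring.
  have hq : (F /ₘ G).map ι = ∏ b ∈ S.filter (fun b => k ≤ b.val), lin b := by
    refine (Polynomial.map_divByMonic (R := C) (p := F) (q := G) ι hGm).trans ?_
    rw [hF, hG, ← Finset.prod_filter_mul_prod_filter_not S
      (fun b => k ≤ b.val), mul_comm, mul_divByMonic_cancel_left _ (hmonic _)]
  refine ⟨F /ₘ G, monic_of_injective hι (by rw [hq]; exact hmonic _), ?_, ?_⟩
  · rw [← natDegree_map_eq_of_injective hι, hq,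
      natDegree_prod_of_monic _ _ fun b _ => monic_X_sub_C _]
    simp only [natDegree_X_sub_C, lin, Finset.sum_const, smul_eq_mul, mul_one]
    rw [dg, dif_pos hk, Finset.filter_filter]
  · rw [Polynomial.aeval_def, ← Polynomial.eval_map]
    change Polynomial.eval _ ((F /ₘ G).map ι) = 0
    rw [hq, Polynomial.eval_prod]
    refine Finset.prod_eq_zero (i := a) ?_ ?_
    · simp [S, a]
    · simp only [lin, a]
      rw [var, dif_pos hk]
      simp

variable (ν) in
/-- The elements of a basis of `Pol(ν)` over its invariants. -/
def monElt (t : Mon ν) : Pol ν := Pi.single t.1 (∏ i, X i ^ (t.2 i : ℕ))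

theorem exists_eq_sum_monomials (s : Seq ν) (p : MvPolynomial (Fin (size ν)) ℤ) :
    ∃ c : ((i : Fin (size ν)) → Fin (dg s i)) → MvPolynomial (Fin (size ν)) ℤ,
      (∀ α, c α ∈ stabInv s) ∧ p = ∑ α, c α * ∏ i, X i ^ (α i : ℕ) := by
  have hp : p ∈ Algebra.adjoin (stabInv s) (var ν '' Set.Iio (size ν)) := by
    induction p using MvPolynomial.induction_on with
    | C r => exact (Algebra.adjoin _ _).algebraMap_mem (algebraMap ℤ (stabInv s) r)
    | add p q hp hq => exact add_mem hp hq
    | mul_X p a hp => exact mul_mem hp (Algebra.subset_adjoin ⟨a.val, a.2, var_coe a⟩)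
  have := mem_span_monomials (var ν) (dg s) (size ν)
    (exists_monic s fun q hq => ⟨⟨q, hq⟩, rfl⟩) p hp
  obtain ⟨c, hc⟩ := (Submodule.mem_span_range_iff_exists_fun _).1 this
  refine ⟨fun α => c α, fun α => (c α).2, ?_⟩
  rw [← hc]
  refine Finset.sum_congr rfl fun α _ => ?_
  simp only [var_coe]
  rfl

theorem exists_eq_sum_monElt (f : Pol ν) :
    ∃ z : Mon ν → invariants ν, f = ∑ t, (z t : Pol ν) * monElt ν t := by
  choose c hc hf using fun s => exists_eq_sum_monomials s (f s)
  choose z hz hzc using fun t : Mon ν => exists_invariant (hc t.1 t.2)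
  refine ⟨fun t => ⟨z t, hz t⟩, ?_⟩
  rw [Fintype.sum_sigma]
  funext r
  rw [Finset.sum_apply, Finset.sum_eq_single r]
  · rw [Finset.sum_apply]
    conv_lhs => rw [hf r]
    refine Finset.sum_congr rfl fun α _ => ?_
    rw [Pi.mul_apply, monElt, Pi.single_eq_same]
    exact congrArg (· * _) (hzc ⟨r, α⟩).symm
  · intro s _ hs
    rw [Finset.sum_apply]
    refine Finset.sum_eq_zero fun α _ => ?_
    rw [Pi.mul_apply, monElt, Pi.single_eq_of_ne hs.symm, mul_zero]
  · simp

/-- Applying every w to a relation and evaluating at `s` gives a linear system with the square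
matrix of the (w·mon)_s. A relation among its rows would extend, by the spanning result, to a
relation among the characters f ↦ (w f)_s, against Dedekind. So the columns are independent as well,
and an invariant that vanishes at `s` is zero. -/
theorem eq_zero_of_sum_monElt (z : Mon ν → invariants ν)
    (hz : ∑ t, (z t : Pol ν) * monElt ν t = 0) : z = 0 := by
  obtain ⟨s⟩ := (inferInstance : Nonempty (Seq ν))
  have hact (z : Mon ν → invariants ν) (w : Perm (Fin (size ν))) :
      permute w (∑ t, (z t : Pol ν) * monElt ν t) s =
        ∑ t, (z t : Pol ν) s * permute w (monElt ν t) s := by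
    rw [map_sum, Finset.sum_apply]
    refine Finset.sum_congr rfl fun t _ => ?_
    rw [map_mul, (z t).2 w, Pi.mul_apply]
  have := eq_zero_of_rows (by rw [card_Mon, Fintype.card_perm, Fintype.card_fin])
    (fun (w : Perm (Fin (size ν))) t => permute w (monElt ν t) s) (fun y hy => ?_)
    (fun t => (z t : Pol ν) s) (fun w => by rw [← hact, hz, map_zero]; rfl)
  · funext t
    exact Subtype.ext (eq_of_invariant (z t).2 (zero_mem _) s (congrFun this t))
  · refine funext fun w => Fintype.linearIndependent_iff.1 (linearIndependent_permute s) y ?_ w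
    funext f
    obtain ⟨c, rfl⟩ := exists_eq_sum_monElt f
    simp only [Finset.sum_apply, Pi.smul_apply, smul_eq_mul, hact, Finset.mul_sum]
    rw [Finset.sum_comm]
    refine Finset.sum_eq_zero fun t _ => ?_
    simp only [mul_left_comm _ ((c t : Pol ν) s)]
    rw [← Finset.mul_sum, hy, mul_zero]

end Invariants

end KLR

end

noncomputable section

/-! ### The grading -/

namespace KLR

universe u

variable {I : Type u}

section Grading

open Equiv

variable {Γ : SimpleGraph I} {ν : I →₀ ℕ}

theorem cartan_comm (i j : I) : cartan Γ i j = cartan Γ j i := by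
  by_cases h : i = j
  · rw [h]
  · unfold cartan
    rw [if_neg h, if_neg (Ne.symm h)]
    by_cases h1 : Γ.Adj i j
    · rw [if_pos h1, if_pos h1.symm]
    · rw [if_neg h1, if_neg fun h2 => h1 h2.symm]

variable (Γ) in
/-- The ring homomorphism to the group ring of `ℤ` over `R(ν)` which keeps track of degrees. -/
def freeGrade : FreeAlgebra ℤ (Gen ν) →ₐ[ℤ] AddMonoidAlgebra (R Γ ν) ℤ :=
  FreeAlgebra.lift ℤ fun g => AddMonoidAlgebra.single (g.deg Γ) (gen Γ ν g)

variable (Γ) in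
/-- An element of the free ring which is homogeneous, as seen by `freeGrade`. -/
def Homog (d : ℤ) (x : FreeAlgebra ℤ (Gen ν)) : Prop :=
  freeGrade Γ x = AddMonoidAlgebra.single d (mk Γ ν x)

namespace Homog

variable {x y : FreeAlgebra ℤ (Gen ν)} {d e : ℤ}

theorem gen (g : Gen ν) {d : ℤ} (h : g.deg Γ = d) : Homog Γ d (FreeAlgebra.ι ℤ g) := by
  subst h
  rw [Homog, freeGrade, FreeAlgebra.lift_ι_apply]
  rfl

theorem mul (hx : Homog Γ d x) (hy : Homog Γ e y) {k : ℤ} (hk : d + e = k) :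
    Homog Γ k (x * y) := by
  subst hk
  rw [Homog, map_mul, hx, hy, AddMonoidAlgebra.single_mul_single, map_mul]

theorem add (hx : Homog Γ d x) (hy : Homog Γ d y) : Homog Γ d (x + y) := by
  rw [Homog, map_add, hx, hy, ← AddMonoidAlgebra.single_add, map_add]

theorem sub (hx : Homog Γ d x) (hy : Homog Γ d y) : Homog Γ d (x - y) := by
  rw [Homog, map_sub, hx, hy, map_sub, sub_eq_iff_eq_add, ← AddMonoidAlgebra.single_add,
    sub_add_cancel]

theorem zero (d : ℤ) : Homog Γ d (0 : FreeAlgebra ℤ (Gen ν)) := by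
  rw [Homog, map_zero, map_zero, AddMonoidAlgebra.single_zero]

theorem one : Homog Γ 0 (1 : FreeAlgebra ℤ (Gen ν)) := by
  rw [Homog, map_one, map_one]; rfl

theorem sum {ι : Type*} (s : Finset ι) (f : ι → FreeAlgebra ℤ (Gen ν))
    (h : ∀ i, Homog Γ d (f i)) : Homog Γ d (∑ i ∈ s, f i) := by
  classical
  induction s using Finset.induction_on with
  | empty => exact zero d
  | insert a s ha ih => rw [Finset.sum_insert ha]; exact (h a).add ih

end Homog

/-- Homogeneity of the relations is what lets `freeGrade` descend to R(ν). -/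
theorem Rel.homog {x y : FreeAlgebra ℤ (Gen ν)} (h : Rel Γ ν x y) :
    ∃ d, Homog Γ d x ∧ Homog Γ d y := by
  have ne {a b : Fin (size ν)} (h : a.val + 1 = b.val) : a ≠ b := fun e => by
    rw [e] at h; omega
  cases h with
  | idem_mul_self i => exact ⟨0, (Homog.gen _ rfl).mul (Homog.gen _ rfl) rfl, Homog.gen _ rfl⟩
  | idem_mul_of_ne i j hij => exact ⟨0, (Homog.gen _ rfl).mul (Homog.gen _ rfl) rfl, Homog.zero _⟩
  | sum_idem => exact ⟨0, Homog.sum _ _ fun i => Homog.gen _ rfl, Homog.one⟩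
  | idem_mul_dot a i => exact ⟨2, (Homog.gen _ rfl).mul (Homog.gen _ rfl) rfl, Homog.gen _ rfl⟩
  | dot_mul_idem a i => exact ⟨2, (Homog.gen _ rfl).mul (Homog.gen _ rfl) rfl, Homog.gen _ rfl⟩
  | idem_mul_cross a b h i =>
    exact ⟨_, (Homog.gen _ rfl).mul (Homog.gen _ rfl) (zero_add _), Homog.gen _ rfl⟩
  | cross_mul_idem a b h i =>
    exact ⟨_, (Homog.gen _ rfl).mul (Homog.gen _ rfl) (add_zero _), Homog.gen _ rfl⟩
  | dot_mul_dot a b i =>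
    exact ⟨4, (Homog.gen _ rfl).mul (Homog.gen _ rfl) rfl,
      (Homog.gen _ rfl).mul (Homog.gen _ rfl) rfl⟩
  | dot_mul_cross_far a b c h i hca hcb =>
    exact ⟨_, (Homog.gen _ rfl).mul (Homog.gen _ rfl) rfl,
      (Homog.gen _ rfl).mul (Homog.gen _ rfl) (add_comm _ _)⟩
  | cross_mul_cross_far a b c d h h' hbc i =>
    have hab : a < b := Fin.lt_def.2 (by omega)
    have hcd : c < d := Fin.lt_def.2 (by omega)
    refine ⟨_, (Homog.gen _ rfl).mul (Homog.gen _ rfl) rfl,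
      (Homog.gen _ rfl).mul (Homog.gen _ rfl) ?_⟩
    simp only [Gen.deg, Seq.smul_apply, swap_inv]
    rw [swap_apply_of_ne_of_ne (hab.trans hbc).ne (hab.trans (hbc.trans hcd)).ne,
      swap_apply_of_ne_of_ne hbc.ne (hbc.trans hcd).ne,
      swap_apply_of_ne_of_ne (hab.trans hbc).ne' hbc.ne',
      swap_apply_of_ne_of_ne (hab.trans (hbc.trans hcd)).ne' (hbc.trans hcd).ne', add_comm]
  | cross_sq_same a b h i hi =>
    exact ⟨_, (Homog.gen _ rfl).mul (Homog.gen _ rfl) rfl, Homog.zero _⟩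
  | cross_sq_zero a b h i hi =>
    refine ⟨0, (Homog.gen _ rfl).mul (Homog.gen _ rfl) ?_, Homog.gen _ rfl⟩
    simp [Gen.deg, Seq.smul_apply, hi, cartan_comm (i b)]
  | cross_sq_edge a b h i hi =>
    refine ⟨2, (Homog.gen _ rfl).mul (Homog.gen _ rfl) ?_,
      (Homog.gen _ rfl).add (Homog.gen _ rfl)⟩
    simp [Gen.deg, Seq.smul_apply, hi, cartan_comm (i b)]
  | slide_ne_left a b h i hi =>
    exact ⟨_, (Homog.gen _ rfl).mul (Homog.gen _ rfl) rfl,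
      (Homog.gen _ rfl).mul (Homog.gen _ rfl) (add_comm _ _)⟩
  | slide_ne_right a b h i hi =>
    exact ⟨_, (Homog.gen _ rfl).mul (Homog.gen _ rfl) rfl,
      (Homog.gen _ rfl).mul (Homog.gen _ rfl) (add_comm _ _)⟩
  | slide_same_left a b h i hi =>
    refine ⟨0, ((Homog.gen _ rfl).mul (Homog.gen _ rfl) ?_).sub
      ((Homog.gen _ rfl).mul (Homog.gen _ rfl) ?_), Homog.gen _ rfl⟩ <;>
    simp [Gen.deg, hi, cartan_same]
  | slide_same_right a b h i hi =>
    refine ⟨0, ((Homog.gen _ rfl).mul (Homog.gen _ rfl) ?_).sub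
      ((Homog.gen _ rfl).mul (Homog.gen _ rfl) ?_), Homog.gen _ rfl⟩ <;>
    simp [Gen.deg, hi, cartan_same]
  | braid_easy a b c h h' i hi =>
    have hac : a ≠ c := fun e => by rw [e] at h; omega
    refine ⟨_, ((Homog.gen _ rfl).mul (Homog.gen _ rfl) rfl).mul (Homog.gen _ rfl) rfl,
      ((Homog.gen _ rfl).mul (Homog.gen _ rfl) rfl).mul (Homog.gen _ rfl) ?_⟩
    simp only [Gen.deg, Seq.smul_apply, swap_inv, swap_apply_left, swap_apply_right,
      swap_apply_of_ne_of_ne (ne h) hac, swap_apply_of_ne_of_ne hac.symm (ne h').symm]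
    ring
  | braid_hard a b c h h' i hi hi' =>
    have hac : a ≠ c := fun e => by rw [e] at h; omega
    have h1 : cartan Γ (i b) (i c) = -1 := by rw [← hi, cartan_comm, hi']
    have h2 : cartan Γ (i a) (i c) = 2 := by rw [← hi, cartan_same]
    refine ⟨0, (((Homog.gen _ rfl).mul (Homog.gen _ rfl) rfl).mul (Homog.gen _ rfl) ?_).sub
      (((Homog.gen _ rfl).mul (Homog.gen _ rfl) rfl).mul (Homog.gen _ rfl) ?_),
      Homog.gen _ rfl⟩ <;>
    simp only [Gen.deg, Seq.smul_apply, swap_inv, swap_apply_left, swap_apply_right,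
      swap_apply_of_ne_of_ne (ne h) hac, swap_apply_of_ne_of_ne hac.symm (ne h').symm, hi', h1,
      h2] <;>
    norm_num

variable (Γ ν) in
/-- The ring homomorphism to the group ring of `ℤ` over `R(ν)` which keeps track of degrees. -/
def grade : R Γ ν →+* AddMonoidAlgebra (R Γ ν) ℤ :=
  RingQuot.lift (⟨(freeGrade Γ).toRingHom, fun x y h => by
    obtain ⟨d, hx, hy⟩ := h.homog
    exact hx.trans ((congrArg _ (mk_rel h)).trans hy.symm)⟩ :
    {f : FreeAlgebra ℤ (Gen ν) →+* AddMonoidAlgebra (R Γ ν) ℤ // ∀ ⦃x y⦄, Rel Γ ν x y → f x = f y})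

theorem grade_gen (g : Gen ν) :
    grade Γ ν (gen Γ ν g) = AddMonoidAlgebra.single (g.deg Γ) (gen Γ ν g) := by
  have : grade Γ ν (gen Γ ν g) = freeGrade Γ (FreeAlgebra.ι ℤ g) :=
    RingQuot.lift_mkRingHom_apply _ _ _
  rw [this]
  exact Homog.gen g rfl

theorem grade_of_mem {d : ℤ} {x : R Γ ν} (hx : x ∈ degreePart Γ ν d) :
    grade Γ ν x = AddMonoidAlgebra.single d x := by
  induction hx using AddSubgroup.closure_induction with
  | mem x hx =>
    obtain ⟨l, rfl, rfl⟩ := hx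
    induction l with
    | nil => exact map_one _
    | cons g l ih =>
      simp only [List.map_cons, List.prod_cons, List.sum_cons, map_mul, ih, grade_gen,
        AddMonoidAlgebra.single_mul_single]
  | zero => rw [map_zero, AddMonoidAlgebra.single_zero]
  | add x y _ _ hx hy => rw [map_add, hx, hy, AddMonoidAlgebra.single_add]
  | neg x _ hx =>
    rw [map_neg, hx, neg_eq_iff_add_eq_zero, ← AddMonoidAlgebra.single_add, add_neg_cancel,
      AddMonoidAlgebra.single_zero]

theorem gen_mem_degreePart (g : Gen ν) : gen Γ ν g ∈ degreePart Γ ν (g.deg Γ) :=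
  AddSubgroup.subset_closure ⟨[g], by simp, by simp⟩

instance : SetLike.GradedMonoid (degreePart Γ ν) where
  one_mem := AddSubgroup.subset_closure ⟨[], rfl, rfl⟩
  mul_mem d e x y hx hy := by
    induction hx using AddSubgroup.closure_induction with
    | mem x hx =>
      induction hy using AddSubgroup.closure_induction with
      | mem y hy =>
        obtain ⟨l, rfl, rfl⟩ := hx
        obtain ⟨l', rfl, rfl⟩ := hy
        exact AddSubgroup.subset_closure ⟨l ++ l', by simp, by simp⟩
      | zero => rw [mul_zero]; exact zero_mem _
      | add y z _ _ h1 h2 => rw [mul_add]; exact add_mem h1 h2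
      | neg y _ h => rw [mul_neg]; exact neg_mem h
    | zero => rw [zero_mul]; exact zero_mem _
    | add y z _ _ h1 h2 => rw [add_mul]; exact add_mem h1 h2
    | neg y _ h => rw [neg_mul]; exact neg_mem h

theorem idem_mem_degreePart (s : Seq ν) : idem Γ s ∈ degreePart Γ ν 0 :=
  gen_mem_degreePart (Gen.idem s)

theorem isInternal_degreePart : DirectSum.IsInternal (degreePart Γ ν) := by
  constructor
  · have key (z : DirectSum ℤ fun d => degreePart Γ ν d) (d : ℤ) :
        (grade Γ ν (DirectSum.coeAddMonoidHom (degreePart Γ ν) z)).coeff d = z d := by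
      induction z using DirectSum.induction_on with
      | zero => simp
      | of e x =>
        rw [DirectSum.coeAddMonoidHom_of, grade_of_mem x.2, AddMonoidAlgebra.coeff_single,
          DirectSum.coe_of_apply, Finsupp.single_apply]
        split_ifs <;> rfl
      | add x y hx hy =>
        rw [map_add, map_add, AddMonoidAlgebra.coeff_add, Finsupp.add_apply, hx, hy]
        rfl
    intro z z' h
    refine DFinsupp.ext fun d => Subtype.ext ?_
    rw [← key, ← key, h]
  · intro x
    change x ∈ Set.range (DirectSum.coeAddMonoidHom (degreePart Γ ν))
    have hof {d : ℤ} {x : R Γ ν} (hx : x ∈ degreePart Γ ν d) :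
        x ∈ Set.range (DirectSum.coeAddMonoidHom (degreePart Γ ν)) :=
      ⟨DirectSum.of (fun d => degreePart Γ ν d) d ⟨x, hx⟩, DirectSum.coeAddMonoidHom_of _ _ _⟩
    induction x using induction_gen with
    | int r =>
      refine hof (d := 0) ?_
      rw [← zsmul_one]
      exact zsmul_mem SetLike.GradedOne.one_mem r
    | gen g => exact hof (gen_mem_degreePart g)
    | mul x y hx hy =>
      obtain ⟨x', rfl⟩ := hx
      obtain ⟨y', rfl⟩ := hy
      exact ⟨x' * y', map_mul (DirectSum.coeRingHom (degreePart Γ ν)) x' y'⟩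
    | add x y hx hy =>
      obtain ⟨x', rfl⟩ := hx
      obtain ⟨y', rfl⟩ := hy
      exact ⟨x' + y', map_add _ _ _⟩

instance : GradedRing (degreePart Γ ν) :=
  { (inferInstance : SetLike.GradedMonoid (degreePart Γ ν)),
    isInternal_degreePart.chooseDecomposition with }

theorem totalCross_homogeneous (k : ℕ) (s : Seq ν) :
    ∃ (d : ℤ) (t : Seq ν), idem Γ s * crossings Γ ν k = crossings Γ ν k * idem Γ t ∧
      idem Γ s * crossings Γ ν k ∈ degreePart Γ ν d := by
  by_cases hk : k + 1 < size ν
  · rw [crossings_of_lt hk]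
    set a : Fin (size ν) := ⟨k, by omega⟩
    set b : Fin (size ν) := ⟨k + 1, hk⟩
    have key : idem Γ s * totalCross Γ (a := a) (b := b) rfl = cross Γ a b rfl (swap a b • s) := by
      conv_lhs => rw [← Seq.swap_swap_smul a b s, idem_mul_totalCross]
    refine ⟨(Gen.cross a b rfl (swap a b • s)).deg Γ, swap a b • s, ?_, ?_⟩
    · rw [totalCross_mul_idem, key]
    · rw [key]
      exact gen_mem_degreePart (Gen.cross a b rfl (swap a b • s))
  · rw [crossings_of_not_lt hk]
    exact ⟨0, s, by simp, by simp⟩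

/-- Elements whose truncations at sequences are homogeneous. -/
def SeqHomogeneous (x : R Γ ν) : Prop := ∀ s, ∃ (d : ℤ) (t : Seq ν),
  idem Γ s * x = idem Γ s * x * idem Γ t ∧ idem Γ s * x ∈ degreePart Γ ν d

/-- The degree of a crossing depends on its labels, so total crossings need not be homogeneous.
Truncating at one sequence repairs this, and the truncated first factor ends at a single sequence,
which truncates the second. -/
theorem SeqHomogeneous.mul {x y : R Γ ν} (hx : SeqHomogeneous x) (hy : SeqHomogeneous y) :
    SeqHomogeneous (x * y) := fun s => by
  obtain ⟨d, t, h1, h2⟩ := hx s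
  obtain ⟨e, r, h3, h4⟩ := hy t
  have h5 : idem Γ s * (x * y) = idem Γ s * x * (idem Γ t * y) := by
    rw [← mul_assoc, ← mul_assoc, ← h1]
  refine ⟨d + e, r, ?_, ?_⟩
  · rw [h5, mul_assoc (idem Γ s * x), ← h3]
  · rw [h5]
    exact SetLike.mul_mem_graded h2 h4

theorem SeqHomogeneous.one : SeqHomogeneous (1 : R Γ ν) := fun s =>
  ⟨0, s, by rw [mul_one, idem_mul_self], by rw [mul_one]; exact idem_mem_degreePart s⟩

theorem seqHomogeneous_crossings (k : ℕ) : SeqHomogeneous (crossings Γ ν k) := fun s => by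
  obtain ⟨d, t, h1, h2⟩ := totalCross_homogeneous (Γ := Γ) k s
  exact ⟨d, t, by rw [h1, mul_assoc, idem_mul_self], h2⟩

theorem seqHomogeneous_run (n j : ℕ) : SeqHomogeneous (run (crossings Γ ν) n j) := by
  induction n generalizing j with
  | zero => cases j <;> exact SeqHomogeneous.one
  | succ n ih =>
    cases j with
    | zero => exact SeqHomogeneous.one
    | succ j => exact (seqHomogeneous_crossings n).mul (ih j)

theorem seqHomogeneous_nf (c : ℕ → ℕ) (n : ℕ) : SeqHomogeneous (nf (crossings Γ ν) c n) := by
  induction n with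
  | zero => exact SeqHomogeneous.one
  | succ n ih => exact ih.mul (seqHomogeneous_run _ _)

theorem polToR_mul_single (f : Pol ν) (s : Seq ν) (p : MvPolynomial (Fin (size ν)) ℤ)
    (hf : f = Pi.single s p) : polToR Γ ν f = polToR Γ ν f * idem Γ s := by
  rw [← polToR_single_one, ← map_mul, hf, ← Pi.single_mul, mul_one]

theorem exists_monElt_mem (t : Mon ν) : ∃ d, polToR Γ ν (monElt ν t) ∈ degreePart Γ ν d := by
  classical
  suffices h : ∀ S : Finset (Fin (size ν)), ∃ d, polToR Γ ν
      (Pi.single t.1 (∏ i ∈ S, MvPolynomial.X i ^ (t.2 i : ℕ))) ∈ degreePart Γ ν d from h _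
  intro S
  induction S using Finset.induction_on with
  | empty => exact ⟨0, by rw [Finset.prod_empty, polToR_single_one]; exact idem_mem_degreePart _⟩
  | insert a S ha ih =>
    obtain ⟨d, hd⟩ := ih
    have h (n : ℕ) : ∃ e, polToR Γ ν (Pi.single t.1 (MvPolynomial.X a ^ n)) ∈
        degreePart Γ ν e := by
      induction n with
      | zero => exact ⟨0, by rw [pow_zero, polToR_single_one]; exact idem_mem_degreePart _⟩
      | succ n ih =>
        obtain ⟨e, he⟩ := ih
        refine ⟨e + 2, ?_⟩
        rw [pow_succ, Pi.single_mul, map_mul, polToR_single_X]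
        exact SetLike.mul_mem_graded he (gen_mem_degreePart (.dot a t.1))
    obtain ⟨e, he⟩ := h (t.2 a)
    refine ⟨e + d, ?_⟩
    rw [Finset.prod_insert ha, Pi.single_mul, map_mul]
    exact SetLike.mul_mem_graded he hd

/-- The monomial is supported at one sequence, so it sees only the truncation of the word there. -/
theorem exists_basis_mem (t : Mon ν) (c : NF ν) :
    ∃ d, polToR Γ ν (monElt ν t) * nfWord Γ c ∈ degreePart Γ ν d := by
  obtain ⟨d, hd⟩ := exists_monElt_mem (Γ := Γ) t
  obtain ⟨e, _, _, he⟩ := seqHomogeneous_nf (Γ := Γ) (ν := ν)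
    (fun i => if hi : i < size ν - 1 then (c ⟨i, hi⟩ : ℕ) else 0) (size ν - 1) t.1
  refine ⟨d + e, ?_⟩
  rw [polToR_mul_single (monElt ν t) t.1 _ rfl, mul_assoc]
  exact SetLike.mul_mem_graded hd he

end Grading

end KLR

end

noncomputable section

/-! ### The invariants as a tensor product -/

namespace KLR

universe u

variable {I : Type u}

/-! ### Orbits of exponents and free groups of coefficient functions -/

section Fibers

open Finset

theorem exists_perm_of_map_eq {n : ℕ} {f g : Fin n → ℕ}
    (h : univ.val.map f = univ.val.map g) : ∃ w : Equiv.Perm (Fin n), ∀ a, g (w a) = f a := by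
  classical
  have hc (k : ℕ) : Nonempty ({a // f a = k} ≃ {a // g a = k}) := by
    refine ⟨Fintype.equivOfCardEq ?_⟩
    have := congrArg (Multiset.count k) h
    rw [Multiset.count_map, Multiset.count_map] at this
    simp only [Fintype.card_subtype, Finset.card_def, Finset.filter_val, eq_comm (b := k)]
    exact this
  exact ⟨Equiv.ofFiberEquiv fun k => (hc k).some, Equiv.ofFiberEquiv_map _⟩

/-- The multiset of exponents of a monomial. -/
def exponents {n : ℕ} (α : Fin n →₀ ℕ) : _root_.Sym ℕ n :=
  ⟨univ.val.map α, by rw [Multiset.card_map]; exact Finset.card_fin n⟩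

theorem exponents_surjective (n : ℕ) : Function.Surjective (exponents (n := n)) := by
  rintro ⟨s, hs⟩
  induction s using Quotient.inductionOn with
  | h l =>
    subst hs
    refine ⟨Finsupp.equivFunOnFinite.symm l.get, Subtype.ext ?_⟩
    change univ.val.map l.get = _
    rw [Fin.univ_val_map, List.ofFn_get]
    rfl

theorem exists_perm_of_exponents_eq {n : ℕ} {α β : Fin n →₀ ℕ} (h : exponents α = exponents β) :
    ∃ w : Equiv.Perm (Fin n), ∀ a, β (w a) = α a :=
  exists_perm_of_map_eq (congrArg Subtype.val h)

variable {A X Q : Type*} [AddCommGroup A] (co : A →+ X → ℤ) {q : X → Q}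

/-- An additive group whose elements are given by coefficients is free, if the functions that occur
are those of finite support which are constant on the fibers of a map with finite fibers. -/
theorem exists_coeff_equiv (hq : Function.Surjective q) (hfin : ∀ c, (q ⁻¹' {c}).Finite)
    (hinj : Function.Injective co) (hsupp : ∀ a, (Function.support (co a)).Finite)
    (hconst : ∀ a x y, q x = q y → co a x = co a y)
    (hsurj : ∀ f : X → ℤ, (Function.support f).Finite → (∀ x y, q x = q y → f x = f y) →
      ∃ a, co a = f) :
    ∃ E : A ≃+ (Q →₀ ℤ), ∀ a x, E a (q x) = co a x := by
  have hr (x : X) : q (Function.surjInv hq (q x)) = q x := Function.surjInv_eq hq _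
  let E : A →+ (Q →₀ ℤ) :=
    { toFun := fun a => Finsupp.ofSupportFinite (fun c => co a (Function.surjInv hq c))
        ((hsupp a).preimage (Function.injective_surjInv hq).injOn)
      map_zero' := Finsupp.ext fun c => by
        change co 0 _ = 0
        rw [map_zero]; rfl
      map_add' := fun a b => Finsupp.ext fun c => by
        change co (a + b) _ = co a _ + co b _
        rw [map_add]; rfl }
  have hE (a : A) (x : X) : E a (q x) = co a x := hconst a _ _ (hr x)
  refine ⟨AddEquiv.ofBijective E ⟨fun a b h => hinj (funext fun x => ?_), fun g => ?_⟩, hE⟩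
  · rw [← hE, ← hE, h]
  -- The pullback of a finitely supported function has finite support because the fibers of `q` are
  -- finite.
  · obtain ⟨a, ha⟩ := hsurj (fun x => g (q x)) (by
      refine (g.support.finite_toSet.biUnion fun c _ => hfin c).subset fun x hx => ?_
      simp only [Set.mem_iUnion]
      exact ⟨q x, Finsupp.mem_support_iff.2 hx, rfl⟩) (fun x y h => by rw [h])
    refine ⟨a, Finsupp.ext fun c => ?_⟩
    obtain ⟨x, rfl⟩ := hq c
    rw [hE, ha]

end Fibers

/-! ### Symmetric polynomials as a free abelian group -/

section Symmetric

open MvPolynomial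

theorem coeff_rename_perm {n : ℕ} (w : Equiv.Perm (Fin n)) (p : MvPolynomial (Fin n) ℤ)
    (α : Fin n →₀ ℕ) : coeff α (rename w p) = coeff (α.equivMapDomain w.symm) p := by
  have h : α = (α.equivMapDomain w.symm).mapDomain w := by
    rw [← Finsupp.equivMapDomain_eq_mapDomain, ← Finsupp.equivMapDomain_trans,
      Equiv.symm_trans_self, Finsupp.equivMapDomain_refl]
  conv_lhs => rw [h, coeff_rename_mapDomain _ w.injective]

theorem exists_coeff_eq {σ : Type*} (f : (σ →₀ ℕ) → ℤ) (hf : (Function.support f).Finite) :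
    ∃ p : MvPolynomial σ ℤ, ∀ α, coeff α p = f α := by
  classical
  refine ⟨∑ β ∈ hf.toFinset, monomial β (f β), fun α => ?_⟩
  rw [coeff_sum]
  simp only [coeff_monomial]
  rw [Finset.sum_ite_eq' hf.toFinset α f]
  split_ifs with h
  · rfl
  · exact (by simpa using h : f α = 0).symm

theorem finite_exponents_fiber {n : ℕ} (c : _root_.Sym ℕ n) : (exponents ⁻¹' {c}).Finite := by
  obtain ⟨α, rfl⟩ := exponents_surjective n c
  refine (Set.finite_range fun w : Equiv.Perm (Fin n) => α.equivMapDomain w).subset fun β hβ => ?_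
  obtain ⟨w, hw⟩ := exists_perm_of_exponents_eq (α := β) (β := α) hβ
  exact ⟨w.symm, Finsupp.ext hw⟩

theorem finite_support_coeff {σ : Type*} (p : MvPolynomial σ ℤ) :
    (Function.support fun α => coeff α p).Finite :=
  p.support.finite_toSet.subset fun _ hα => mem_support_iff.2 hα

/-- A polynomial is symmetric exactly when its coefficients are constant on the orbits of exponent
vectors, and such orbits are multisets of size n. The basis is that of monomial symmetric functions.
-/
theorem exists_symmetric_equiv (n : ℕ) : ∃ E : symmetricSubalgebra (Fin n) ℤ ≃+
    (_root_.Sym ℕ n →₀ ℤ), ∀ p α, E p (exponents α) = coeff α (p : MvPolynomial (Fin n) ℤ) := by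
  refine exists_coeff_equiv
    ({ toFun := fun p α => coeff α (p : MvPolynomial (Fin n) ℤ)
       map_zero' := rfl
       map_add' := fun p r => rfl } : symmetricSubalgebra (Fin n) ℤ →+ (Fin n →₀ ℕ) → ℤ)
    (exponents_surjective n) finite_exponents_fiber
    (fun p r h => Subtype.ext (MvPolynomial.ext _ _ fun α => congrFun h α))
    (fun p => finite_support_coeff _) (fun p α β h => ?_) fun f hf hf' => ?_
  · obtain ⟨w, hw⟩ := exists_perm_of_exponents_eq h
    change coeff α (p : MvPolynomial (Fin n) ℤ) = coeff β (p : MvPolynomial (Fin n) ℤ)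
    conv_rhs => rw [← p.2 w, coeff_rename_perm]
    exact congrArg (fun γ => coeff γ (p : MvPolynomial (Fin n) ℤ))
      (Finsupp.ext fun a => (hw a).symm)
  · obtain ⟨p, hp⟩ := exists_coeff_eq f hf
    refine ⟨⟨p, fun w => MvPolynomial.ext _ _ fun α => ?_⟩, funext hp⟩
    rw [coeff_rename_perm, hp, hp]
    refine hf' _ _ (Subtype.ext ?_)
    change Finset.univ.val.map (fun a => α (w a)) = Finset.univ.val.map α
    conv_rhs => rw [← Multiset.map_univ_val_equiv w, Multiset.map_map]
    rfl

end Symmetric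

/-! ### Sym(ν) as a tensor product of rings of symmetric polynomials -/

section Invariants

open MvPolynomial Finset

variable {ν : I →₀ ℕ}

/-- The positions of a sequence as a disjoint union over the vertices. -/
def IsSplitting (s : Seq ν) (e : (Σ i : ν.support, Fin (ν i)) ≃ Fin (size ν)) : Prop :=
  ∀ x, s (e x) = x.1

/-- The equivalence assembled from a numbering of the positions of each vertex. -/
def splitting (s : Seq ν) (σ : ∀ i : ν.support, Fin (ν i) ≃ {a // s a = i}) :
    (Σ i : ν.support, Fin (ν i)) ≃ Fin (size ν) :=
  (Equiv.sigmaCongrRight σ).trans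
    { toFun := fun x => x.2
      invFun := fun a => ⟨⟨s a, s.mem_support a⟩, a, rfl⟩
      left_inv := by
        rintro ⟨⟨i, hi⟩, a, ha⟩
        change s a = i at ha
        subst ha
        rfl
      right_inv := fun _ => rfl }

theorem isSplitting_splitting (s : Seq ν) (σ : ∀ i : ν.support, Fin (ν i) ≃ {a // s a = i}) :
    IsSplitting s (splitting s σ) := fun x => (σ x.1 x.2).2

theorem exists_numbering (s : Seq ν) :
    Nonempty (∀ i : ν.support, Fin (ν i) ≃ {a // s a = i}) := by
  classical
  exact ⟨fun i => Fintype.equivOfCardEq (by rw [Fintype.card_fin, Seq.card_fiber])⟩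

theorem exists_isSplitting (s : Seq ν) : ∃ e, IsSplitting s e :=
  (exists_numbering s).elim fun σ => ⟨_, isSplitting_splitting s σ⟩

/-- The exponents of the variables at the positions of a given vertex. -/
def restrictExp (e : (Σ i : ν.support, Fin (ν i)) ≃ Fin (size ν)) (α : Fin (size ν) →₀ ℕ)
    (i : ν.support) : Fin (ν i) →₀ ℕ := Finsupp.equivFunOnFinite.symm fun k => α (e ⟨i, k⟩)

open Classical in
/-- The multisets of exponents of the variables at the positions of each vertex. -/
def labelledExponents (x : Seq ν × (Fin (size ν) →₀ ℕ)) (i : ν.support) : _root_.Sym ℕ (ν i) :=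
  ⟨(univ.filter fun a => x.1 a = i).val.map x.2, by
    rw [Multiset.card_map, ← Seq.card_fiber x.1 i, Fintype.card_subtype]; rfl⟩

theorem labelledExponents_eq {s : Seq ν} {e : (Σ i : ν.support, Fin (ν i)) ≃ Fin (size ν)}
    (he : IsSplitting s e) (α : Fin (size ν) →₀ ℕ) (i : ν.support) :
    labelledExponents (s, α) i = exponents (restrictExp e α i) := by
  classical
  refine Subtype.ext ?_
  have h : univ.filter (fun a => s a = i) =
      univ.map ((Function.Embedding.sigmaMk i).trans e.toEmbedding) := by
    ext a
    simp only [mem_filter, mem_univ, true_and, mem_map, Function.Embedding.trans_apply,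
      Equiv.coe_toEmbedding, Function.Embedding.sigmaMk_apply]
    constructor
    · intro ha
      obtain ⟨⟨j, k⟩, rfl⟩ := e.surjective a
      rw [he] at ha
      obtain rfl : j = i := Subtype.ext ha
      exact ⟨k, rfl⟩
    · rintro ⟨k, rfl⟩
      exact he _
  change (univ.filter (fun a => s a = i)).val.map α = _
  rw [h, Finset.map_val, Multiset.map_map]
  rfl

theorem exists_perm_of_labelledExponents_eq {s t : Seq ν} {α β : Fin (size ν) →₀ ℕ}
    (h : labelledExponents (s, α) = labelledExponents (t, β)) :
    ∃ w : Equiv.Perm (Fin (size ν)), w • s = t ∧ ∀ a, β (w a) = α a := by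
  obtain ⟨e, he⟩ := exists_isSplitting s
  obtain ⟨f, hf⟩ := exists_isSplitting t
  have h1 (i : ν.support) : ∃ w : Equiv.Perm (Fin (ν i)), ∀ k,
      restrictExp f β i (w k) = restrictExp e α i k := by
    refine exists_perm_of_exponents_eq ?_
    rw [← labelledExponents_eq he, ← labelledExponents_eq hf, h]
  choose w hw using h1
  refine ⟨(e.symm.trans (Equiv.sigmaCongrRight w)).trans f, Subtype.ext (funext fun a => ?_),
    fun a => ?_⟩
  · change s (e ((Equiv.sigmaCongrRight w).symm (f.symm a))) = t a
    obtain ⟨x, rfl⟩ := f.surjective a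
    rw [he, hf, Equiv.symm_apply_apply]
    rfl
  · obtain ⟨⟨i, k⟩, rfl⟩ := e.surjective a
    change β (f (Equiv.sigmaCongrRight w (e.symm (e ⟨i, k⟩)))) = _
    rw [Equiv.symm_apply_apply]
    exact hw i k

theorem labelledExponents_smul (w : Equiv.Perm (Fin (size ν))) (s : Seq ν)
    (α : Fin (size ν) →₀ ℕ) :
    labelledExponents (s, α.equivMapDomain w.symm) = labelledExponents (w • s, α) := by
  obtain ⟨e, he⟩ := exists_isSplitting s
  have he' : IsSplitting (w • s) (e.trans w) := fun x => by
    rw [← he x, Seq.smul_apply]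
    exact congrArg s (w.symm_apply_apply (e x))
  funext i
  rw [labelledExponents_eq he, labelledExponents_eq he']
  rfl

theorem labelledExponents_surjective :
    Function.Surjective (labelledExponents (ν := ν)) := by
  intro c
  obtain ⟨s⟩ := (inferInstance : Nonempty (Seq ν))
  obtain ⟨e, he⟩ := exists_isSplitting s
  choose α hα using fun i : ν.support => exponents_surjective (ν i) (c i)
  refine ⟨(s, Finsupp.equivFunOnFinite.symm fun a => α (e.symm a).1 (e.symm a).2), ?_⟩
  funext i
  rw [labelledExponents_eq he, ← hα]
  congr 1
  ext k
  change α (e.symm (e ⟨i, k⟩)).1 (e.symm (e ⟨i, k⟩)).2 = _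
  rw [Equiv.symm_apply_apply]

/-- The orbits of S_m on pairs (sequence, exponent vector) are the families of multisets of
exponents, one for each vertex; coefficients of an invariant are constant on them. -/
theorem exists_invariants_equiv :
    ∃ E : invariants ν ≃+ ((∀ i : ν.support, _root_.Sym ℕ (ν i)) →₀ ℤ),
      ∀ f x, E f (labelledExponents x) = coeff x.2 ((f : Pol ν) x.1) := by
  refine exists_coeff_equiv
    ({ toFun := fun f x => coeff x.2 ((f : Pol ν) x.1)
       map_zero' := rfl
       map_add' := fun p r => rfl } : invariants ν →+ Seq ν × (Fin (size ν) →₀ ℕ) → ℤ)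
    labelledExponents_surjective (fun c => ?_)
    (fun f g h => Subtype.ext (funext fun s => MvPolynomial.ext _ _ fun α => congrFun h (s, α)))
    (fun f => ?_) (fun f => ?_) fun f hf hf' => ?_
  · obtain ⟨⟨s, α⟩, rfl⟩ := labelledExponents_surjective c
    refine (Set.finite_range fun w : Equiv.Perm (Fin (size ν)) =>
      (w • s, α.equivMapDomain w)).subset ?_
    rintro ⟨t, β⟩ h
    obtain ⟨w, h1, h2⟩ := exists_perm_of_labelledExponents_eq (s := t) (t := s) h
    refine ⟨w.symm, Prod.ext ?_ (Finsupp.ext h2)⟩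
    rw [← h1]
    exact inv_smul_smul w t
  · refine (Set.finite_iUnion fun s : Seq ν =>
      (finite_support_coeff ((f : Pol ν) s)).image (Prod.mk s)).subset ?_
    rintro ⟨s, α⟩ h
    exact Set.mem_iUnion.2 ⟨s, α, h, rfl⟩
  · rintro ⟨s, α⟩ ⟨t, β⟩ h
    obtain ⟨w, rfl, hw⟩ := exists_perm_of_labelledExponents_eq h
    change coeff α ((f : Pol ν) s) = coeff β ((f : Pol ν) (w • s))
    rw [← rename_invariant f.2, coeff_rename_perm]
    exact congrArg (fun γ => coeff γ ((f : Pol ν) s)) (Finsupp.ext fun a => (hw a).symm)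
  · have h1 (s : Seq ν) : ∃ p : MvPolynomial (Fin (size ν)) ℤ, ∀ α, coeff α p = f (s, α) :=
      exists_coeff_eq _ (hf.preimage (Prod.mk_right_injective s).injOn)
    choose p hp using h1
    refine ⟨⟨p, fun w => funext fun s => MvPolynomial.ext _ _ fun α => ?_⟩,
      funext fun x => hp _ _⟩
    rw [permute_apply, coeff_rename_perm, hp, hp]
    refine hf' _ _ ?_
    rw [labelledExponents_smul, smul_inv_smul]

/-- The variables of the factors are disjoint, so coefficients multiply. Both sides are multilinear
in the factors, which reduces the claim to monomials. -/
theorem coeff_prod_rename_sigma {ι : Type*} [Fintype ι] {κ : ι → Type*} [∀ i, Fintype (κ i)]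
    (p : ∀ i, MvPolynomial (κ i) ℤ) (β : (Σ i, κ i) →₀ ℕ) :
    coeff β (∏ i, rename (Sigma.mk i) (p i)) =
      ∏ i, coeff (Finsupp.equivFunOnFinite.symm fun k => β ⟨i, k⟩) (p i) := by
  classical
  let F : MultilinearMap ℤ (fun i => MvPolynomial (κ i) ℤ) ℤ :=
    (lcoeff ℤ β).compMultilinearMap ((MultilinearMap.mkPiAlgebra ℤ ι _).compLinearMap
      fun i => (rename (R := ℤ) (Sigma.mk i : κ i → Σ i, κ i)).toLinearMap)
  let G : MultilinearMap ℤ (fun i => MvPolynomial (κ i) ℤ) ℤ :=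
    (MultilinearMap.mkPiAlgebra ℤ ι ℤ).compLinearMap
      fun i => lcoeff ℤ (Finsupp.equivFunOnFinite.symm fun k => β ⟨i, k⟩)
  suffices h : F = G by
    have := DFunLike.congr_fun h p
    exact this
  refine Module.Basis.ext_multilinear (fun i => basisMonomials (κ i) ℤ) fun v => ?_
  change coeff β (∏ i, rename (Sigma.mk i) (basisMonomials (κ i) ℤ (v i))) =
    ∏ i, coeff (Finsupp.equivFunOnFinite.symm fun k => β ⟨i, k⟩) (basisMonomials (κ i) ℤ (v i))
  simp only [coe_basisMonomials, rename_monomial, coeff_monomial]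
  rw [← monomial_sum_one, coeff_monomial]
  have h2 (i : ι) (k : κ i) : (∑ i, (v i).mapDomain (Sigma.mk i : κ i → Σ i, κ i)) ⟨i, k⟩ =
      v i k := by
    rw [Finsupp.finsetSum_apply, Finset.sum_eq_single i]
    · exact Finsupp.mapDomain_apply sigma_mk_injective _ _
    · intro j _ hj
      refine Finsupp.mapDomain_of_notMem_range _ _ ?_
      rintro ⟨l, hl⟩
      exact hj (congrArg Sigma.fst hl)
    · simp
  rw [Finset.prod_ite_zero]
  simp only [Finset.prod_const_one]
  refine if_congr ⟨fun h i _ => ?_, fun h => ?_⟩ rfl rfl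
  · ext k
    rw [← h2, h]; rfl
  · ext ⟨i, k⟩
    rw [h2, h i (mem_univ i)]; rfl

theorem coeff_prod_rename {s : Seq ν} (σ : ∀ i : ν.support, Fin (ν i) ≃ {a // s a = i})
    (p : ∀ i : ν.support, MvPolynomial (Fin (ν i)) ℤ) (α : Fin (size ν) →₀ ℕ) :
    coeff α (∏ i : ν.support, rename (fun k => (σ i k).val) (p i)) =
      ∏ i, coeff (restrictExp (splitting s σ) α i) (p i) := by
  have h (i : ν.support) : rename (fun k => (σ i k).val) (p i) =
      rename (splitting s σ) (rename (Sigma.mk i) (p i)) := by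
    rw [rename_rename]; rfl
  have hα : α = (α.equivMapDomain (splitting s σ).symm).mapDomain (splitting s σ) := by
    rw [← Finsupp.equivMapDomain_eq_mapDomain, ← Finsupp.equivMapDomain_trans,
      Equiv.symm_trans_self, Finsupp.equivMapDomain_refl]
  simp only [h]
  rw [← map_prod]
  conv_lhs => rw [hα]
  rw [coeff_rename_mapDomain _ (splitting s σ).injective, coeff_prod_rename_sigma]
  rfl

theorem map_mul_of_tprod {K ι B : Type*} {A : ι → Type*} [CommRing K] [∀ i, CommRing (A i)]
    [∀ i, Algebra K (A i)] [Ring B] [Algebra K B] (F : (⨂[K] i, A i) →ₗ[K] B)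
    (hF : ∀ p r : ∀ i, A i, F (PiTensorProduct.tprod K (p * r)) =
      F (PiTensorProduct.tprod K p) * F (PiTensorProduct.tprod K r)) (x y : ⨂[K] i, A i) :
    F (x * y) = F x * F y := by
  induction x using PiTensorProduct.induction_on with
  | add x z hx hz => rw [add_mul, map_add, map_add, add_mul, hx, hz]
  | smul_tprod k p =>
    rw [smul_mul_assoc, map_smul, map_smul, smul_mul_assoc]
    congr 1
    induction y using PiTensorProduct.induction_on with
    | add x z hx hz => rw [mul_add, map_add, map_add, mul_add, hx, hz]
    | smul_tprod k r =>
      rw [mul_smul_comm, map_smul, map_smul, mul_smul_comm, PiTensorProduct.tprod_mul_tprod, hF]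

/-- The tensor product of the free groups on multisets is free on families of multisets, as is
Sym(ν). The composite is additive by construction; the coefficient formula determines it on pure
tensors, and multiplicativity follows from that formula. -/
theorem exists_tensor_equiv : ∃ Φ :
    (⨂[ℤ] i : ν.support, symmetricSubalgebra (Fin (ν i)) ℤ) ≃+* invariants ν,
      ∀ (p : ∀ i : ν.support, symmetricSubalgebra (Fin (ν i)) ℤ) (s : Seq ν)
        (σ : ∀ i : ν.support, Fin (ν i) ≃ {a // s a = i}),
        (Φ (PiTensorProduct.tprod ℤ p) : Pol ν) s =
          ∏ i : ν.support, rename (fun k => (σ i k).val) (p i : MvPolynomial (Fin (ν i)) ℤ) := by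
  classical
  choose E hE using exists_symmetric_equiv
  obtain ⟨F, hF⟩ := exists_invariants_equiv (ν := ν)
  let Φ : (⨂[ℤ] i : ν.support, symmetricSubalgebra (Fin (ν i)) ℤ) ≃ₗ[ℤ] invariants ν :=
    ((PiTensorProduct.congr fun i : ν.support => (E (ν i)).toIntLinearEquiv).trans
      PiTensorProduct.ofFinsuppEquiv').trans F.symm.toIntLinearEquiv
  have hΦ (p : ∀ i : ν.support, symmetricSubalgebra (Fin (ν i)) ℤ) (s : Seq ν)
      (σ : ∀ i : ν.support, Fin (ν i) ≃ {a // s a = i}) :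
      (Φ (PiTensorProduct.tprod ℤ p) : Pol ν) s =
        ∏ i : ν.support, rename (fun k => (σ i k).val) (p i : MvPolynomial (Fin (ν i)) ℤ) := by
    refine MvPolynomial.ext _ _ fun α => ?_
    rw [coeff_prod_rename]
    refine (hF _ (s, α)).symm.trans ?_
    change F (F.symm (PiTensorProduct.ofFinsuppEquiv' (PiTensorProduct.congr _ _))) _ = _
    rw [F.apply_symm_apply, PiTensorProduct.congr_tprod, PiTensorProduct.ofFinsuppEquiv'_apply_apply]
    refine Finset.prod_congr rfl fun i _ => ?_
    rw [labelledExponents_eq (isSplitting_splitting s σ)]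
    exact hE _ _ _
  have hmul := map_mul_of_tprod Φ.toLinearMap fun p r => Subtype.ext (funext fun s => by
    obtain ⟨σ⟩ := exists_numbering s
    change (Φ _ : Pol ν) s = (Φ _ : Pol ν) s * (Φ _ : Pol ν) s
    rw [hΦ _ s σ, hΦ _ s σ, hΦ _ s σ, ← Finset.prod_mul_distrib]
    exact Finset.prod_congr rfl fun i _ => map_mul _ _ _)
  exact ⟨{ Φ with map_mul' := hmul }, hΦ⟩

end Invariants

end KLR

end

noncomputable section

/-! ### Freeness over the center, Noetherianity and indecomposability -/

namespace KLR

universe u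

variable {I : Type u}

section Main

variable {Γ : SimpleGraph I} {ν : I →₀ ℕ}

theorem polToR_mem_center (z : invariants ν) :
    polToR Γ ν z ∈ Subring.center (R Γ ν) := by
  rw [center_eq_Sym]
  exact ⟨z, z.2, rfl⟩

variable (Γ ν) in
/-- The inclusion of the invariants into the center of `R(ν)`. -/
def toCenter : invariants ν →+* Subring.center (R Γ ν) :=
  ((polToR Γ ν).comp (invariants ν).subtype).codRestrict _ polToR_mem_center

theorem toCenter_surjective : Function.Surjective (toCenter Γ ν) := by
  rintro ⟨x, hx⟩
  have hx' := hx
  rw [center_eq_Sym] at hx'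
  obtain ⟨f, hf, rfl⟩ := hx'
  exact ⟨⟨f, hf⟩, rfl⟩

variable (Γ ν) in
/-- The elements of a basis of `R(ν)` over its center. -/
def basisElt (p : Mon ν × NF ν) : R Γ ν := polToR Γ ν (monElt ν p.1) * nfWord Γ p.2

theorem sum_toCenter_smul (z : Mon ν × NF ν → invariants ν) :
    ∑ p, toCenter Γ ν (z p) • basisElt Γ ν p =
      ∑ c, polToR Γ ν (∑ t, (z (t, c) : Pol ν) * monElt ν t) * nfWord Γ c := by
  rw [Fintype.sum_prod_type_right]
  refine Finset.sum_congr rfl fun c _ => ?_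
  rw [map_sum, Finset.sum_mul]
  refine Finset.sum_congr rfl fun t _ => ?_
  rw [map_mul, mul_assoc]
  rfl

theorem linearIndependent_basisElt :
    LinearIndependent (Subring.center (R Γ ν)) (basisElt Γ ν) := by
  refine Fintype.linearIndependent_iff.2 fun g hg p => ?_
  choose z hz using fun p => toCenter_surjective (g p)
  simp only [← hz] at hg ⊢
  rw [sum_toCenter_smul] at hg
  have h := congrFun (eq_zero_of_sum_monElt (fun t => z (t, p.2))
    (congrFun (eq_zero_of_sum_eq_zero hg) p.2)) p.1
  rw [show z p = 0 from h, map_zero]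

theorem span_basisElt : ⊤ ≤ Submodule.span (Subring.center (R Γ ν)) (Set.range (basisElt Γ ν)) := by
  rintro x -
  obtain ⟨f, rfl⟩ := exists_eq_sum x
  choose z hz using fun c => exists_eq_sum_monElt (f c)
  refine (Submodule.mem_span_range_iff_exists_fun _).2
    ⟨fun p => toCenter Γ ν (z p.2 p.1), ?_⟩
  rw [sum_toCenter_smul fun p : Mon ν × NF ν => z p.2 p.1]
  simp only [← hz]

variable (Γ ν) in
/-- A basis of `R(ν)` over its center. -/
def basis : Module.Basis (Mon ν × NF ν) (Subring.center (R Γ ν)) (R Γ ν) :=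
  Module.Basis.mk linearIndependent_basisElt span_basisElt

theorem card_index : Fintype.card (Mon ν × NF ν) = (size ν)! ^ 2 := by
  rw [Fintype.card_prod, card_Mon, card_NF, sq]

/-- It is enough to commute with a homogeneous y of degree e, and there one compares the components
of degree d + e in zy = yz. -/
theorem decompose_mem_center {z : R Γ ν} (hz : z ∈ Subring.center (R Γ ν)) (d : ℤ) :
    (DirectSum.decompose (degreePart Γ ν) z d : R Γ ν) ∈ Subring.center (R Γ ν) := by
  rw [Subring.mem_center_iff] at hz ⊢
  intro y
  induction y using DirectSum.Decomposition.inductionOn (degreePart Γ ν) with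
  | zero => rw [mul_zero, zero_mul]
  | @homogeneous e y =>
    have h1 := DirectSum.coe_decompose_mul_add_of_right_mem (degreePart Γ ν) (i := d) (a := z) y.2
    have h2 := DirectSum.coe_decompose_mul_add_of_left_mem (degreePart Γ ν) (j := d) (b := z) y.2
    rw [← h1, ← h2, hz, add_comm]
  | add x y hx hy => rw [add_mul, mul_add, hx, hy]

theorem mem_degreePart_iff {ι : Type*} [Fintype ι]
    (b : Module.Basis ι (Subring.center (R Γ ν)) (R Γ ν)) {e : ι → ℤ}
    (he : ∀ k, b k ∈ degreePart Γ ν (e k)) (d : ℤ) (x : R Γ ν) :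
    x ∈ degreePart Γ ν d ↔ ∀ k, (b.repr x k : R Γ ν) ∈ degreePart Γ ν (d - e k) := by
  constructor
  · intro hx
    let z (k : ι) : Subring.center (R Γ ν) :=
      ⟨_, decompose_mem_center (b.repr x k).2 (d - e k)⟩
    -- Taking the degree d component of the expansion of x replaces every coordinate by its
    -- component of degree `d - e k`. These are again central, so by uniqueness they are the
    -- coordinates.
    have hz : ∑ k, z k • b k = x := by
      have h := congrArg (fun y : R Γ ν => (DirectSum.decompose (degreePart Γ ν) y d : R Γ ν))
        (b.sum_repr x)
      simp only [DirectSum.decompose_of_mem_same _ hx] at h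
      rw [DirectSum.decompose_sum, DirectSum.sum_apply, AddSubgroup.val_finsetSum] at h
      rw [← h]
      refine Finset.sum_congr rfl fun k _ => ?_
      have h1 := DirectSum.coe_decompose_mul_add_of_right_mem (degreePart Γ ν) (i := d - e k)
        (a := (b.repr x k : R Γ ν)) (he k)
      rw [sub_add_cancel] at h1
      exact h1.symm
    intro k
    have h2 : b.repr x k = z k := by
      conv_lhs => rw [← hz, b.repr_sum_self]
    rw [h2]
    exact SetLike.coe_mem _
  · intro h
    rw [← b.sum_repr x]
    refine sum_mem fun k _ => ?_
    have := SetLike.mul_mem_graded (h k) (he k)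
    rwa [sub_add_cancel] at this

/-- Artin–Tate: Pol(ν) is of finite type over ℤ and finite over the invariants, so the invariants
are of finite type over ℤ, and Hilbert's basis theorem applies. -/
instance : IsNoetherianRing (invariants ν) := by
  have h1 : Module.Finite (invariants ν) (Pol ν) := by
    refine ⟨⟨Finset.univ.image (monElt ν), eq_top_iff.2 fun f _ => ?_⟩⟩
    obtain ⟨z, rfl⟩ := exists_eq_sum_monElt f
    exact sum_mem fun t _ => Submodule.smul_mem _ (z t)
      (Submodule.subset_span (Finset.mem_coe.2 (Finset.mem_image_of_mem _ (Finset.mem_univ t))))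
  have h2 : Algebra.FiniteType ℤ (Pol ν) := inferInstance
  have h3 : Algebra.FiniteType ℤ (invariants ν) :=
    ⟨fg_of_fg_of_fg ℤ (invariants ν) (Pol ν) h2.1 h1.1 Subtype.val_injective⟩
  exact Algebra.FiniteType.isNoetherianRing ℤ _

instance : IsNoetherianRing (Subring.center (R Γ ν)) :=
  isNoetherianRing_of_surjective _ _ (toCenter Γ ν) toCenter_surjective

instance : Module.Finite (Subring.center (R Γ ν)) (R Γ ν) := Module.Finite.of_basis (basis Γ ν)

theorem isNoetherianRing_R : IsNoetherianRing (R Γ ν) :=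
  isNoetherian_of_tower (Subring.center (R Γ ν)) inferInstance

theorem isNoetherianRing_op : IsNoetherianRing (R Γ ν)ᵐᵒᵖ := by
  have h : IsNoetherian (Subring.center (R Γ ν)) (R Γ ν)ᵐᵒᵖ :=
    isNoetherian_of_linearEquiv (MulOpposite.opLinearEquiv (Subring.center (R Γ ν)))
  exact isNoetherian_of_tower (Subring.center (R Γ ν)) h

/-- S_m is transitive on Seq(ν), so an invariant is determined by one component, which is here an
idempotent of a polynomial ring over ℤ. -/
theorem eq_zero_or_one_of_mem_center {x : R Γ ν} (hx : x ∈ Subring.center (R Γ ν))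
    (h : x * x = x) : x = 0 ∨ x = 1 := by
  rw [center_eq_Sym] at hx
  obtain ⟨f, hf, rfl⟩ := hx
  rw [← map_mul] at h
  obtain ⟨s⟩ := (inferInstance : Nonempty (Seq ν))
  have h1 : f s * f s = f s := congrFun (polToR_injective h) s
  rcases IsIdempotentElem.iff_eq_zero_or_one.1 h1 with h2 | h2
  · left
    rw [eq_of_invariant hf (zero_mem _) s h2, map_zero]
  · right
    rw [eq_of_invariant hf (one_mem _) s h2, map_one]

theorem isIndecomposableRing_R : IsIndecomposableRing (R Γ ν) := by
  refine ⟨polToR_injective.nontrivial, fun S T _ _ ⟨f⟩ => ?_⟩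
  -- A product decomposition would give the central idempotent (1, 0), which must be 0 or 1.
  have hc : f.symm (1, 0) ∈ Subring.center (R Γ ν) := by
    refine Subring.mem_center_iff.2 fun y => f.injective ?_
    rw [map_mul, map_mul, f.apply_symm_apply]
    ext <;> simp
  rcases eq_zero_or_one_of_mem_center hc (by rw [← map_mul]; simp) with h | h
  · left
    rw [map_eq_zero_iff _ f.symm.injective] at h
    exact subsingleton_of_zero_eq_one (congrArg Prod.fst h).symm
  · right
    rw [map_eq_one_iff _ f.symm.injective] at h
    exact subsingleton_of_zero_eq_one (congrArg Prod.snd h)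

end Main

end KLR

end

theorem mainTheorem4 {I : Type*} (Γ : SimpleGraph I) (ν : I →₀ ℕ) :
    -- `Pol(ν)` is a subring of `R(ν)`, and the center of `R(ν)` is `Sym(ν)`
    Function.Injective (KLR.polToR Γ ν) ∧
    Subring.center (KLR.R Γ ν) = KLR.Sym Γ ν ∧
    -- `Sym(ν)` is the tensor product over the support of `ν` of rings of symmetric polynomials
    (∃ Φ : (⨂[ℤ] i : ν.support, MvPolynomial.symmetricSubalgebra (Fin (ν i)) ℤ) ≃+*
        KLR.invariants ν,
      ∀ (p : ∀ i : ν.support, MvPolynomial.symmetricSubalgebra (Fin (ν i)) ℤ) (s : KLR.Seq ν)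
        (σ : ∀ i : ν.support, Fin (ν i) ≃ {a // s a = i}),
        (Φ (PiTensorProduct.tprod ℤ p) : KLR.Pol ν) s =
          ∏ i : ν.support, MvPolynomial.rename (fun k => (σ i k).val)
            (p i : MvPolynomial (Fin (ν i)) ℤ)) ∧
    -- `R(ν)` is a graded ring and a free graded module of rank `(m!)^2` over its center
    Nonempty (GradedRing (KLR.degreePart Γ ν)) ∧
    (∃ (b : Module.Basis (Fin ((KLR.size ν)! ^ 2)) (Subring.center (KLR.R Γ ν)) (KLR.R Γ ν))
        (e : Fin ((KLR.size ν)! ^ 2) → ℤ),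
      (∀ k, b k ∈ KLR.degreePart Γ ν (e k)) ∧
      ∀ (d : ℤ) (x : KLR.R Γ ν), x ∈ KLR.degreePart Γ ν d ↔
        ∀ k, (b.repr x k : KLR.R Γ ν) ∈ KLR.degreePart Γ ν (d - e k)) ∧
    -- `R(ν)` is left and right Noetherian, and indecomposable
    IsNoetherianRing (KLR.R Γ ν) ∧
    IsNoetherianRing (KLR.R Γ ν)ᵐᵒᵖ ∧
    KLR.IsIndecomposableRing (KLR.R Γ ν) := by
  let e : KLR.Mon ν × KLR.NF ν ≃ Fin ((KLR.size ν)! ^ 2) :=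
    Fintype.equivFinOfCardEq KLR.card_index
  have hb (k : Fin ((KLR.size ν)! ^ 2)) :
      ∃ d, (KLR.basis Γ ν).reindex e k ∈ KLR.degreePart Γ ν d := by
    rw [Module.Basis.reindex_apply, KLR.basis, Module.Basis.mk_apply]
    exact KLR.exists_basis_mem _ _
  choose d hd using hb
  exact ⟨KLR.polToR_injective, KLR.center_eq_Sym, KLR.exists_tensor_equiv, ⟨inferInstance⟩,
    ⟨(KLR.basis Γ ν).reindex e, d, hd, KLR.mem_degreePart_iff _ hd⟩,
    KLR.isNoetherianRing_R, KLR.isNoetherianRing_op, KLR.isIndecomposableRing_R⟩
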